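/- Let $n\ge 2$, and let $B$ be either the positive braid monoid $B_n^+$, presented by generators $\sigma_1,\dots,\sigma_{n-1}$ with relations $\sigma_i\sigma_j=\sigma_j\sigma_i$ for $|i-j|\ge 2$ and $\sigma_i\sigma_j\sigma_i=\sigma_j\sigma_i\sigma_j$ for $|i-j|=1$; or the dual braid monoid $B_n^{+*}$, presented by generators $\sigma_{i,j}=\sigma_{j,i}$, $1\le i<j\le n$, with relations $\sigma_{i,j}\sigma_{j,k}=\sigma_{j,k}\sigma_{k,i}=\sigma_{k,i}\sigma_{i,j}$ for $i<j<k$, and $\sigma_{i,j}\sigma_{k,\ell}=\sigma_{k,\ell}\sigma_{i,j}$ for $i<j<k<\ell$ and for $i<k<\ell<j$. Let $\Sigma$ be the set of generators and $|x|$ the length of any word representing $x\in B$. For $X\subseteq\Sigma$ let $\Delta_X$ be the least upper bound of $X$ for left divisibility, and put $\Delta=\Delta_\Sigma$. Let $S$ be the set of divisors of $\Delta$ (the simple braids), and for $x,y\in S$ write $x\to y$ if $x\sigma\notin S$ for every $\sigma\in\Sigma$ that left divides $y$. Let $\overline{B}$ be the set of infinite paths $(x_k)_{k\ge1}$ in the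 graph $(S,\to)$ (the generalized braids), with the topology induced by the product topology on $S^{\mathbb N}$ ($S$ being discrete) and its Borel $\sigma$-algebra. Each $x\in B$ is identified with its extended Garside decomposition, that is, the unique path in $\overline B$ that is eventually equal to the unit and whose factors have product $x$. Put $\partial B=\overline B\setminus B$, and for $x\in B$ let $\uparrow x=\overline{\{xz : z\in B\}}\cap\partial B$, the closure being taken in $\overline B$. Let $q_n$ be the radius of convergence of the growth series $\sum_{x\in B}t^{|x|}$. Then $q_n$ is positive, and it is a root of smallest modulus of the Möbius polynomial $H_n(t)=\sum_{X\subseteq\Sigma}(-1)^{|X|}t^{|\Delta_X|}$. There is a unique Borel probability measure $\nu_{q_n}$ on $\overline B$ such that $\nu_{q_n}(\uparrow x)=q_n^{|x|}$ for all $x\in B$ (the uniform measure at infinity). The uniform distributions $\mu_{n,k}$ on the finite sets $\{x\in B : |x|=k\}$, viewed as probability measures on $\overline B$, converge weakly to $\nu_{q_n}$ as $k\to\infty$. -/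

import Mathlib

open Filter Topology MeasureTheory Polynomial

noncomputable section

/-- The two families of braid monoids: the positive braid monoids `B_n^+` (Artin generators) and
the positive dual braid monoids `B_n^{+*}` (Birman–Ko–Lee generators). -/
inductive BraidType
  | artin
  | dual

/-- Index set of the generators: `σ_{i+1}` with `i : Fin (n - 1)` for `B_n^+`, and
`σ_{i+1,j+1}` with `i < j` in `Fin n` for `B_n^{+*}`. -/
def BraidGen : BraidType → ℕ → Type
  | .artin, n => Fin (n - 1)
  | .dual, n => {p : Fin n × Fin n // p.1 < p.2}

instance instFintypeBraidGen : (t : BraidType) → (n : ℕ) → Fintype (BraidGen t n)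
  | .artin, n => inferInstanceAs (Fintype (Fin (n - 1)))
  | .dual, n => inferInstanceAs (Fintype {p : Fin n × Fin n // p.1 < p.2})

/-- Defining relations of `B_n^+`. -/
inductive ArtinRel (n : ℕ) : FreeMonoid (Fin (n - 1)) → FreeMonoid (Fin (n - 1)) → Prop
  | comm (i j : Fin (n - 1)) (h : (i : ℕ) + 2 ≤ j) :
      ArtinRel n (.of i * .of j) (.of j * .of i)
  | braid (i j : Fin (n - 1)) (h : (i : ℕ) + 1 = j) :
      ArtinRel n (.of i * .of j * .of i) (.of j * .of i * .of j)

/-- The letter `σ_{i,j}`, for `i < j`. -/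
def dualLetter {n : ℕ} (i j : Fin n) (h : i < j) :
    FreeMonoid {p : Fin n × Fin n // p.1 < p.2} :=
  .of ⟨(i, j), h⟩

/-- Defining relations of `B_n^{+*}` (with the convention `σ_{k,i} = σ_{i,k}` for `i < k`). -/
inductive DualRel (n : ℕ) : FreeMonoid {p : Fin n × Fin n // p.1 < p.2} →
    FreeMonoid {p : Fin n × Fin n // p.1 < p.2} → Prop
  | triangle₁ (i j k : Fin n) (hij : i < j) (hjk : j < k) :
      DualRel n (dualLetter i j hij * dualLetter j k hjk)
        (dualLetter j k hjk * dualLetter i k (hij.trans hjk))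
  | triangle₂ (i j k : Fin n) (hij : i < j) (hjk : j < k) :
      DualRel n (dualLetter j k hjk * dualLetter i k (hij.trans hjk))
        (dualLetter i k (hij.trans hjk) * dualLetter i j hij)
  | separated (i j k l : Fin n) (hij : i < j) (_ : j < k) (hkl : k < l) :
      DualRel n (dualLetter i j hij * dualLetter k l hkl)
        (dualLetter k l hkl * dualLetter i j hij)
  | nested (i k l j : Fin n) (hik : i < k) (hkl : k < l) (hlj : l < j) :
      DualRel n (dualLetter i j (hik.trans (hkl.trans hlj)) * dualLetter k l hkl)
        (dualLetter k l hkl * dualLetter i j (hik.trans (hkl.trans hlj)))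

/-- Defining relations of the braid monoid of type `t` on `n` strands. -/
def braidRel : (t : BraidType) → (n : ℕ) →
    FreeMonoid (BraidGen t n) → FreeMonoid (BraidGen t n) → Prop
  | .artin, n => ArtinRel n
  | .dual, n => DualRel n

/-- The braid monoid of type `t` on `n` strands: `B_n^+` or `B_n^{+*}`. The divisibility relation
`x ∣ y` of this noncommutative monoid is left divisibility, `∃ z, y = x * z`. -/
abbrev Braid (t : BraidType) (n : ℕ) : Type := PresentedMonoid (braidRel t n)

/-- The generators as elements of the braid monoid. -/
def braidOf {t : BraidType} {n : ℕ} (σ : BraidGen t n) : Braid t n :=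
  PresentedMonoid.of (braidRel t n) σ

theorem braidRel_homogeneous (t : BraidType) (n : ℕ) (a b : FreeMonoid (BraidGen t n))
    (h : braidRel t n a b) :
    FreeMonoid.lift (fun _ : BraidGen t n => Multiplicative.ofAdd (1 : ℕ)) a =
      FreeMonoid.lift (fun _ : BraidGen t n => Multiplicative.ofAdd (1 : ℕ)) b := by
  cases t with
  | artin => cases h <;> rfl
  | dual => cases h <;> rfl

/-- The length, as a monoid homomorphism sending every generator to `1`. -/
def lengthHom (t : BraidType) (n : ℕ) : Braid t n →* Multiplicative ℕ :=
  PresentedMonoid.lift (fun _ => Multiplicative.ofAdd 1) (braidRel_homogeneous t n)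

/-- The length `|x|` of a braid: the length of any word representing it. -/
def braidLength {t : BraidType} {n : ℕ} (x : Braid t n) : ℕ :=
  Multiplicative.toAdd (lengthHom t n x)

theorem braidLength_one {t : BraidType} {n : ℕ} : braidLength (1 : Braid t n) = 0 := by
  simp [braidLength]

theorem braidLength_mul {t : BraidType} {n : ℕ} (x y : Braid t n) :
    braidLength (x * y) = braidLength x + braidLength y := by
  simp [braidLength]

theorem braidLength_of {t : BraidType} {n : ℕ} (σ : BraidGen t n) :
    braidLength (braidOf σ) = 1 := rfl

/-- The length of the braid of a word is the length of the word. -/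
theorem braidLength_mk {t : BraidType} {n : ℕ} (w : FreeMonoid (BraidGen t n)) :
    braidLength (PresentedMonoid.mk (braidRel t n) w) = w.length := by
  induction w with
  | one => simp [braidLength_one]
  | of σ => exact braidLength_of σ
  | mul x y hx hy => rw [map_mul, braidLength_mul, hx, hy, FreeMonoid.length_mul]

/-- The set `B_n(k)` of braids of length `k`. -/
def braidSphere (t : BraidType) (n k : ℕ) : Set (Braid t n) := {x | braidLength x = k}

theorem braidSphere_finite (t : BraidType) (n k : ℕ) : (braidSphere t n k).Finite := by
  refine ((List.finite_length_eq (BraidGen t n) k).image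
    (fun l => PresentedMonoid.mk (braidRel t n) (FreeMonoid.ofList l))).subset ?_
  intro x hx
  obtain ⟨w, rfl⟩ := PresentedMonoid.surjective_mk x
  refine ⟨w.toList, ?_, rfl⟩
  have := braidLength_mk w
  exact this.symm.trans hx

theorem braidSphere_nonempty (t : BraidType) {n : ℕ} (hn : 2 ≤ n) (k : ℕ) :
    (braidSphere t n k).Nonempty := by
  have h : Nonempty (BraidGen t n) := by
    cases t with
    | artin => exact ⟨(⟨0, by omega⟩ : Fin (n - 1))⟩
    | dual => exact ⟨⟨(⟨0, by omega⟩, ⟨1, by omega⟩), Nat.zero_lt_one⟩⟩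
  obtain ⟨σ⟩ := h
  refine ⟨braidOf σ ^ k, ?_⟩
  change braidLength (braidOf σ ^ k) = k
  induction k with
  | zero => simp [braidLength_one]
  | succ k ih => rw [pow_succ, braidLength_mul, ih, braidLength_of]

/-- `d` is a least upper bound, for left divisibility, of the set `X` of generators. -/
def IsGenJoin {t : BraidType} {n : ℕ} (X : Finset (BraidGen t n)) (d : Braid t n) : Prop :=
  (∀ σ ∈ X, braidOf σ ∣ d) ∧ ∀ y : Braid t n, (∀ σ ∈ X, braidOf σ ∣ y) → d ∣ y

/-- `Δ_X`, the least upper bound of `X ⊆ Σ` for left divisibility. It exists because the braid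
monoids are Garside monoids, and it is unique because left divisibility is a partial order. -/
def deltaOf {t : BraidType} {n : ℕ} (X : Finset (BraidGen t n)) : Braid t n :=
  Classical.epsilon (IsGenJoin X)

/-- The Garside element `Δ = Δ_Σ`. -/
def garside (t : BraidType) (n : ℕ) : Braid t n := deltaOf Finset.univ

/-- A braid is simple if it divides `Δ`. -/
def IsSimple {t : BraidType} {n : ℕ} (x : Braid t n) : Prop := x ∣ garside t n

/-- The set `S_n` of simple braids. -/
def SimpleBraid (t : BraidType) (n : ℕ) : Type := {x : Braid t n // IsSimple x}

/-- The unit braid as a simple braid. -/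
def simpleOne (t : BraidType) (n : ℕ) : SimpleBraid t n := ⟨1, one_dvd _⟩

/-- `x → y`: every generator `σ` that left divides `y` is such that `x * σ` is not simple, that is
`L(y) ⊆ R(x)`. -/
def Arrow {t : BraidType} {n : ℕ} (x y : SimpleBraid t n) : Prop :=
  {σ : BraidGen t n | braidOf σ ∣ y.1} ⊆ {σ | ¬ IsSimple (x.1 * braidOf σ)}

/-- Simple braids carry the discrete topology. -/
instance instTopSimpleBraid (t : BraidType) (n : ℕ) : TopologicalSpace (SimpleBraid t n) := ⊥

/-- Generalized braids: infinite paths `(x_1, x_2, …)` in the graph `(S_n, →)`; the vertex `x_{k+1}`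
is the value at `k`. -/
def GenBraid (t : BraidType) (n : ℕ) : Type :=
  {ξ : ℕ → SimpleBraid t n // ∀ k, Arrow (ξ k) (ξ (k + 1))}

/-- The topology on generalized braids is induced by the product topology. -/
instance instTopGenBraid (t : BraidType) (n : ℕ) : TopologicalSpace (GenBraid t n) :=
  inferInstanceAs (TopologicalSpace {ξ : ℕ → SimpleBraid t n // ∀ k, Arrow (ξ k) (ξ (k + 1))})

instance instMeasGenBraid (t : BraidType) (n : ℕ) : MeasurableSpace (GenBraid t n) := borel _

instance instBorelGenBraid (t : BraidType) (n : ℕ) : BorelSpace (GenBraid t n) := ⟨rfl⟩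

theorem arrow_simpleOne (t : BraidType) (n : ℕ) : Arrow (simpleOne t n) (simpleOne t n) := by
  rintro σ ⟨z, hz⟩
  have h := congrArg braidLength hz
  rw [braidLength_mul, braidLength_of] at h
  change braidLength (1 : Braid t n) = _ at h
  rw [braidLength_one] at h
  omega

instance instNonemptyGenBraid (t : BraidType) (n : ℕ) : Nonempty (GenBraid t n) :=
  ⟨⟨fun _ => simpleOne t n, fun _ => arrow_simpleOne t n⟩⟩

/-- `ξ` is the extended Garside decomposition of `x`: it is eventually equal to the unit, and the
product of its factors is `x`. -/
def IsExtDecomp {t : BraidType} {n : ℕ} (x : Braid t n) (ξ : GenBraid t n) : Prop :=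
  ∃ N : ℕ, (∀ k, N ≤ k → ξ.1 k = simpleOne t n) ∧
    ((List.range N).map fun k => (ξ.1 k).1).prod = x

/-- The embedding of braids into generalized braids, sending `x` to its extended Garside
decomposition (which exists and is unique, by the theorem on Garside normal forms). -/
def toGen {t : BraidType} {n : ℕ} (x : Braid t n) : GenBraid t n :=
  Classical.epsilon (IsExtDecomp x)

/-- The boundary: generalized braids that are not finite braids. -/
def braidBoundary (t : BraidType) (n : ℕ) : Set (GenBraid t n) := (Set.range toGen)ᶜ

/-- The full visual cylinder of `x`: the closure of the set of right multiples of `x`. -/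
def fullVisualCylinder {t : BraidType} {n : ℕ} (x : Braid t n) : Set (GenBraid t n) :=
  closure {ξ | ∃ z : Braid t n, ξ = toGen (x * z)}

/-- The visual cylinder `↑x`: the infinite braids in the full visual cylinder. -/
def visualCylinder {t : BraidType} {n : ℕ} (x : Braid t n) : Set (GenBraid t n) :=
  fullVisualCylinder x ∩ braidBoundary t n

/-- The Möbius polynomial `H_n = ∑_{X ⊆ Σ} (-1)^{|X|} t^{|Δ_X|}`. -/
def moebiusPoly (t : BraidType) (n : ℕ) : ℝ[X] :=
  ∑ X : Finset (BraidGen t n), (-1) ^ X.card * Polynomial.X ^ braidLength (deltaOf X)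

/-- `q_n`, the radius of convergence of the growth series `∑_k #B_n(k) t^k`. -/
def braidRadius (t : BraidType) (n : ℕ) : ℝ :=
  (FormalMultilinearSeries.ofScalars ℝ
    (fun k => ((braidSphere t n k).ncard : ℝ))).radius.toReal

/-- The uniform distribution `μ_{n,k}` on the braids of length `k`, as a probability measure on
generalized braids. -/
def uniformSphere (t : BraidType) {n : ℕ} (hn : 2 ≤ n) (k : ℕ) :
    ProbabilityMeasure (GenBraid t n) :=
  ⟨((PMF.uniformOfFinset (braidSphere_finite t n k).toFinset
      ((braidSphere_finite t n k).toFinset_nonempty.2 (braidSphere_nonempty t hn k))).map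
        toGen).toMeasure, inferInstance⟩

/-- `ν` is the uniform measure at infinity: `ν(↑x) = q_n ^ |x|` for every braid `x`. -/
def IsUniformAtInfinity {t : BraidType} {n : ℕ} (ν : ProbabilityMeasure (GenBraid t n)) : Prop :=
  ∀ x : Braid t n, (ν : Measure (GenBraid t n)) (visualCylinder x) =
    ENNReal.ofReal (braidRadius t n ^ braidLength x)

end

/-! Everything rests on the Garside structure of `B`, which is extracted from the symmetric group.
Simple braids are modelled by an interval `[1, top]` of `S_n` for a prefix order: the weak order
below the reversal for `B_n^+`, the absolute order below the long cycle for `B_n^{+*}`. This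
interval is a lattice, its elements lift uniquely to braids, and braids act on pairs (greatest
simple left divisor, remaining factor). Cancellation, joins and normal forms follow
(`GermModel.garsideFacts`).

Inclusion-exclusion over the generators dividing a braid shows that the growth series is the inverse
of the Möbius polynomial `H` (`growthSeries_mul`). So `H` has no root inside the disc of
convergence, and Pringsheim's argument puts a root at the radius `q` itself (`isRoot_radius`).
Convergence of the measures needs more: `q` must be a simple root and the only one on its circle, so
that `#B(k) * q ^ k` has a positive limit (`exists_tendsto_coeff`). Both properties follow from one
inequality, `‖1 - z‖ - (1 - q) ≤ C * ‖H(z)‖` for `‖z‖ < q`.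

For `n ≥ 3` this inequality comes from counting paths in the graph of simple braids other than `1`
and `Δ`. A generator carries a loop of weight one, which produces the factor `1 - z`, and a maximum
principle compares every other generating function with that of the looped vertex
(`exists_resolvent_bound`). This uses strong connectivity of the graph. The complement with respect
to `Δ` reverses arrows up to conjugation by `Δ`, so it suffices to join the generators to one
another and to find one arrow from a vertex reached by a generator to the complement of another such
vertex (`reflTransGen_of_dual`). Riffle shuffles provide it for `B_n^+`, reflections of a polygon
for `B_n^{+*}`.

Finally, `μ_{n,k}` gives the full visual cylinder of `x` the mass `#B(k - |x|) / #B(k)`, which tends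
to `q ^ |x|`. Full cylinders are clopen and determine a probability measure, each finite braid is an
isolated point of eventually zero mass, and the space is compact. Hence all limit points of
`μ_{n,k}` coincide with the uniform measure at infinity. -/

/-! ### Joins in graded posets -/

/-- In a graded poset of bounded rank, joins exist as soon as they exist locally: two elements
strictly above `z` lie above elements `x'`, `y'` that are strictly above `z` and are connected
through an element `d`, forced by `x'` and `y'`, such that `x' ⊔ d` and `d ⊔ y'` exist. -/
theorem exists_isLUB_of_local {P : Type*} [PartialOrder P] (rk : P → ℕ) (hrk : StrictMono rk)
    (N : ℕ) (hN : ∀ x, rk x ≤ N)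
    (hloc : ∀ z x y : P, z < x → z < y → ∃ x' y' d w₁ w₂, z < x' ∧ x' ≤ x ∧ z < y' ∧ y' ≤ y ∧
      z < d ∧ (∀ u, x' ≤ u → y' ≤ u → d ≤ u) ∧ IsLUB {x', d} w₁ ∧ IsLUB {d, y'} w₂)
    (z x y : P) (hx : z ≤ x) (hy : z ≤ y) : ∃ w, IsLUB {x, y} w := by
  -- Descending induction on the rank of the common lower bound `z`.
  induction h : N - rk z using Nat.strong_induction_on generalizing z x y with
  | _ k ih =>
    rcases hx.eq_or_lt with rfl | hx
    · exact ⟨y, by rintro u (rfl | rfl); exacts [hy, le_rfl], fun u hu => hu (by simp)⟩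
    rcases hy.eq_or_lt with rfl | hy
    · exact ⟨x, by rintro u (rfl | rfl); exacts [le_rfl, hx.le], fun u hu => hu (by simp)⟩
    obtain ⟨x', y', d, w₁, w₂, hzx, hxx, hzy, hyy, hzd, hd, h₁, h₂⟩ := hloc z x y hx hy
    have key : ∀ z', z < z' → N - rk z' < k := fun z' hz' => by
      have := hrk hz'
      have := hN z'
      omega
    -- `x₁ = x ⊔ (x' ⊔ d)` is formed above `x'` and `y₁ = y ⊔ (d ⊔ y')` above `y'`. Both lie above
    -- `d`, which serves as the base point for joining them.
    obtain ⟨x₁, hx₁⟩ := ih _ (key x' hzx) x' x w₁ hxx (h₁.1 (by simp)) rfl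
    obtain ⟨y₁, hy₁⟩ := ih _ (key y' hzy) y' y w₂ hyy (h₂.1 (by simp)) rfl
    have hdx : d ≤ x₁ := (h₁.1 (by simp)).trans (hx₁.1 (by simp))
    have hdy : d ≤ y₁ := (h₂.1 (by simp)).trans (hy₁.1 (by simp))
    obtain ⟨w, hw⟩ := ih _ (key d hzd) d x₁ y₁ hdx hdy rfl
    refine ⟨w, ?_, ?_⟩
    · rintro u (rfl | rfl)
      · exact (hx₁.1 (by simp)).trans (hw.1 (by simp))
      · exact (hy₁.1 (by simp)).trans (hw.1 (by simp))
    · intro u hu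
      have hxu : x ≤ u := hu (by simp)
      have hyu : y ≤ u := hu (by simp)
      have hdu := hd u (hxx.trans hxu) (hyy.trans hyu)
      apply hw.2
      rintro v (rfl | rfl)
      · apply hx₁.2
        rintro v (rfl | rfl)
        · exact hxu
        · apply h₁.2
          rintro v (rfl | rfl)
          exacts [hxx.trans hxu, hdu]
      · apply hy₁.2
        rintro v (rfl | rfl)
        · exact hyu
        · apply h₂.2
          rintro v (rfl | rfl)
          exacts [hdu, hyy.trans hyu]

/-- A graded poset of bounded rank with a bottom and binary joins has binary meets. -/
theorem exists_isGLB_of_isLUB {P : Type*} [PartialOrder P] (rk : P → ℕ) (hrk : StrictMono rk)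
    (N : ℕ) (hN : ∀ x, rk x ≤ N) (hlub : ∀ x y : P, ∃ w, IsLUB {x, y} w) (b : P)
    (hb : ∀ x, b ≤ x) (x y : P) : ∃ w, IsGLB {x, y} w := by
  classical
  -- A common lower bound of greatest rank: its join with any other lower bound is again a lower
  -- bound, hence cannot exceed it.
  have hex : ∃ k, ∃ m, m ≤ x ∧ m ≤ y ∧ N - rk m = k := ⟨_, b, hb x, hb y, rfl⟩
  obtain ⟨m, hmx, hmy, hm⟩ := Nat.find_spec hex
  refine ⟨m, ?_, ?_⟩
  · rintro u (rfl | rfl)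
    exacts [hmx, hmy]
  · intro u hu
    obtain ⟨w, hw⟩ := hlub u m
    have hwx : w ≤ x := hw.2 (by rintro v (rfl | rfl); exacts [hu (by simp), hmx])
    have hwy : w ≤ y := hw.2 (by rintro v (rfl | rfl); exacts [hu (by simp), hmy])
    have hmw : m ≤ w := hw.1 (by simp)
    rcases hmw.eq_or_lt with rfl | hlt
    · exact hw.1 (by simp)
    · have h1 := Nat.find_min' hex ⟨w, hwx, hwy, rfl⟩
      have h2 := hrk hlt
      have h3 := hN w
      omega

/-! ### Basic facts on braids -/

section Braids

variable {t : BraidType} {n : ℕ}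

theorem braid_cases (x : Braid t n) : x = 1 ∨ ∃ a y, x = braidOf a * y := by
  obtain ⟨w, rfl⟩ := PresentedMonoid.surjective_mk x
  induction w using FreeMonoid.casesOn with
  | one => exact Or.inl (map_one _)
  | of_mul a w => exact Or.inr ⟨a, PresentedMonoid.mk _ w, map_mul _ _ _⟩

theorem braid_induction {p : Braid t n → Prop} (one : p 1)
    (mul : ∀ a x, p x → p (braidOf a * x)) (x : Braid t n) : p x := by
  obtain ⟨w, rfl⟩ := PresentedMonoid.surjective_mk x
  induction w using FreeMonoid.inductionOn' with
  | one => rwa [map_one]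
  | of_mul a w ih => rw [map_mul]; exact mul a _ ih

theorem eq_one_of_braidLength {x : Braid t n} (h : braidLength x = 0) : x = 1 := by
  rcases braid_cases x with rfl | ⟨a, y, rfl⟩
  · rfl
  · rw [braidLength_mul, braidLength_of] at h
    omega

theorem braidLength_le_of_dvd {x y : Braid t n} (h : x ∣ y) : braidLength x ≤ braidLength y := by
  obtain ⟨z, rfl⟩ := h
  rw [braidLength_mul]
  omega

theorem braid_eq_of_dvd {x y : Braid t n} (h : x ∣ y) (hl : braidLength y ≤ braidLength x) :
    x = y := by
  obtain ⟨z, rfl⟩ := h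
  rw [braidLength_mul] at hl
  rw [eq_one_of_braidLength (x := z) (by omega), mul_one]

theorem braid_dvd_antisymm {x y : Braid t n} (h : x ∣ y) (h' : y ∣ x) : x = y :=
  braid_eq_of_dvd h (braidLength_le_of_dvd h')

theorem exists_braidOf_dvd {x : Braid t n} (h : x ≠ 1) : ∃ a, braidOf a ∣ x := by
  rcases braid_cases x with rfl | ⟨a, y, rfl⟩
  · exact absurd rfl h
  · exact ⟨a, dvd_mul_right _ _⟩

theorem isGenJoin_unique {X : Finset (BraidGen t n)} {d e : Braid t n} (hd : IsGenJoin X d)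
    (he : IsGenJoin X e) : d = e :=
  braid_dvd_antisymm (hd.2 e he.1) (he.2 d hd.1)

theorem deltaOf_eq {X : Finset (BraidGen t n)} {d : Braid t n} (hd : IsGenJoin X d) :
    deltaOf X = d :=
  isGenJoin_unique (Classical.epsilon_spec (p := IsGenJoin X) ⟨d, hd⟩) hd

end Braids

/-! ### Germs -/

/-- The prefix order attached to a length function on a group. -/
def PrefixLE {G : Type*} [Group G] (len : G → ℕ) (g h : G) : Prop :=
  len g + len (g⁻¹ * h) = len h

/-- Subadditivity through `z * a` gives upper bounds that the two hypotheses already saturate, so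
all inequalities are equalities. -/
theorem PrefixLE.mul {G : Type*} [Group G] {len : G → ℕ}
    (hlen : ∀ g h, len (g * h) ≤ len g + len h) {z a u : G} (hz : PrefixLE len z u)
    (ha : PrefixLE len a (z⁻¹ * u)) :
    PrefixLE len (z * a) u ∧ len (z * a) = len z + len a := by
  unfold PrefixLE at *
  have h1 := hlen z a
  have h2 := hlen (z * a) ((z * a)⁻¹ * u)
  rw [mul_inv_cancel_left] at h2
  rw [mul_inv_rev, mul_assoc] at h2 ⊢
  omega

/-- The atoms `a` and `b` have a join below `top`, and both reduced decompositions of this join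
that start with `a` and with `b` represent the same braid. -/
def AtomsLinked {t : BraidType} {n : ℕ} {G : Type*} [Group G] (len : G → ℕ) (top : G)
    (proj : Braid t n →* G) (a b : BraidGen t n) : Prop :=
  ∃ p r : Braid t n, braidOf a * p = braidOf b * r ∧
    len (proj (braidOf a * p)) = braidLength (braidOf a * p) ∧
    PrefixLE len (proj (braidOf a * p)) top ∧
    ∀ u, PrefixLE len u top → PrefixLE len (proj (braidOf a)) u →
      PrefixLE len (proj (braidOf b)) u → PrefixLE len (proj (braidOf a * p)) u

/-- A model of the simple braids as an interval `[1, top]` for the prefix order of a group. -/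
structure GermModel (t : BraidType) (n : ℕ) (G : Type*) [Group G] where
  len : G → ℕ
  top : G
  proj : Braid t n →* G
  len_one : len 1 = 0
  len_mul_le : ∀ g h, len (g * h) ≤ len g + len h
  eq_one_of_len : ∀ g, len g = 0 → g = 1
  len_atom : ∀ a, len (proj (braidOf a)) = 1
  balanced : ∀ g h, PrefixLE len g h → PrefixLE len h top → PrefixLE len (g⁻¹ * h) top
  exists_atom : ∀ g, PrefixLE len g top → g ≠ 1 → ∃ a, PrefixLE len (proj (braidOf a)) g
  -- The detour through `d` serves the dual case, where two crossing transpositions share no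
  -- defining relation. For positive braids `d = b` suffices.
  linked : ∀ a b, ∃ d, AtomsLinked len top proj a d ∧ AtomsLinked len top proj d b ∧
    ∀ u, PrefixLE len u top → PrefixLE len (proj (braidOf a)) u →
      PrefixLE len (proj (braidOf b)) u → PrefixLE len (proj (braidOf d)) u
  rel_reduced : ∀ u v, braidRel t n u v →
    PrefixLE len (proj (PresentedMonoid.mk _ u)) top ∧
      len (proj (PresentedMonoid.mk _ u)) = u.length
  atom_le_top : ∀ a, PrefixLE len (proj (braidOf a)) top
  eq_top : ∀ u, PrefixLE len u top → (∀ a, PrefixLE len (proj (braidOf a)) u) → u = top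
  atom_sq : ∀ a, proj (braidOf a) * proj (braidOf a) = 1
  conj_atom : ∀ a, ∃ b, proj (braidOf a) * top = top * proj (braidOf b)

namespace GermModel

variable {t : BraidType} {n : ℕ} {G : Type*} [Group G] (M : GermModel t n G)

theorem le_refl (g : G) : PrefixLE M.len g g := by simp [PrefixLE, M.len_one]

theorem one_le (g : G) : PrefixLE M.len 1 g := by simp [PrefixLE, M.len_one]

theorem len_le {g h : G} (hgh : PrefixLE M.len g h) : M.len g ≤ M.len h := by
  unfold PrefixLE at hgh
  omega

theorem le_antisymm {g h : G} (hgh : PrefixLE M.len g h) (hhg : PrefixLE M.len h g) : g = h := by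
  have h1 := M.len_le hhg
  unfold PrefixLE at hgh
  have := M.eq_one_of_len (g⁻¹ * h) (by omega)
  rwa [inv_mul_eq_one] at this

theorem le_mul_of_le {z a u : G} (hz : PrefixLE M.len z u) (ha : PrefixLE M.len a (z⁻¹ * u)) :
    PrefixLE M.len (z * a) u ∧ M.len (z * a) = M.len z + M.len a :=
  hz.mul M.len_mul_le ha

/-- The converse of `le_mul_of_le`, by the same saturation of the triangle inequality. -/
theorem le_of_mul_le {z a u : G} (hl : M.len (z * a) = M.len z + M.len a)
    (h : PrefixLE M.len (z * a) u) : PrefixLE M.len z u ∧ PrefixLE M.len a (z⁻¹ * u) := by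
  unfold PrefixLE at *
  have h1 := M.len_mul_le a (a⁻¹ * (z⁻¹ * u))
  have h2 := M.len_mul_le z (z⁻¹ * u)
  rw [mul_inv_cancel_left] at h1 h2
  rw [mul_inv_rev, mul_assoc] at h
  omega

theorem inv_mul_le {z g u : G} (hz : PrefixLE M.len z g) (h : PrefixLE M.len g u) :
    PrefixLE M.len z u ∧ PrefixLE M.len (z⁻¹ * g) (z⁻¹ * u) := by
  have := M.le_of_mul_le (z := z) (a := z⁻¹ * g) (u := u)
  rw [mul_inv_cancel_left] at this
  exact this hz.symm h

theorem le_trans {g h k : G} (hgh : PrefixLE M.len g h) (hhk : PrefixLE M.len h k) :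
    PrefixLE M.len g k := (M.inv_mul_le hgh hhk).1

theorem le_of_inv_mul_le {z g u : G} (hz : PrefixLE M.len z u)
    (h : PrefixLE M.len (z⁻¹ * g) (z⁻¹ * u)) : PrefixLE M.len g u := by
  have := (M.le_mul_of_le hz h).1
  rwa [mul_inv_cancel_left] at this

theorem len_proj_le (x : Braid t n) : M.len (M.proj x) ≤ braidLength x := by
  induction x using braid_induction with
  | one => rw [map_one, M.len_one]; omega
  | mul a x ih =>
    rw [map_mul, braidLength_mul, braidLength_of]
    have := M.len_mul_le (M.proj (braidOf a)) (M.proj x)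
    rw [M.len_atom] at this
    omega

/-- Reduced decompositions that start with a given factor. -/
theorem le_of_reduced {x y : Braid t n} (h : M.len (M.proj (x * y)) = braidLength (x * y)) :
    M.len (M.proj x) = braidLength x ∧ M.len (M.proj y) = braidLength y ∧
      PrefixLE M.len (M.proj x) (M.proj (x * y)) := by
  have h1 := M.len_proj_le x
  have h2 := M.len_proj_le y
  have h3 := M.len_mul_le (M.proj x) (M.proj y)
  rw [map_mul, braidLength_mul] at h
  refine ⟨by omega, by omega, ?_⟩
  unfold PrefixLE
  rw [map_mul, inv_mul_cancel_left]
  omega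

/-- The simple elements of the germ. -/
def Simp : Type _ := {g : G // PrefixLE M.len g M.top}

instance : PartialOrder M.Simp where
  le g h := PrefixLE M.len g.1 h.1
  le_refl g := M.le_refl g.1
  le_trans _ _ _ := M.le_trans
  le_antisymm _ _ h h' := Subtype.ext (M.le_antisymm h h')

/-- The unit of the germ. -/
def unit : M.Simp := ⟨1, M.one_le _⟩

theorem unit_le (g : M.Simp) : M.unit ≤ g := M.one_le _

/-- The quotient `g⁻¹ h` of simple elements `g ≤ h`. -/
def quot {g h : M.Simp} (hgh : g ≤ h) : M.Simp := ⟨g.1⁻¹ * h.1, M.balanced _ _ hgh h.2⟩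

/-- The greatest simple element. -/
def maxi : M.Simp := ⟨M.top, M.le_refl _⟩

theorem le_maxi (g : M.Simp) : g ≤ M.maxi := g.2

/-- The complement `g⁻¹ top`. -/
def compl (g : M.Simp) : M.Simp := M.quot (M.le_maxi g)

/-- The product `g u` for `u ≤ compl g`. -/
def extend {g u : M.Simp} (h : u ≤ M.compl g) : M.Simp := ⟨g.1 * u.1, (M.le_mul_of_le g.2 h).1⟩

theorem le_extend {g u : M.Simp} (h : u ≤ M.compl g) : g ≤ M.extend h := by
  change PrefixLE M.len g.1 (g.1 * u.1)
  unfold PrefixLE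
  rw [inv_mul_cancel_left, (M.le_mul_of_le g.2 h).2]

/-- The atom of index `a`. -/
noncomputable def atom (a : BraidGen t n) : M.Simp := ⟨M.proj (braidOf a), M.atom_le_top a⟩

theorem simp_strictMono : StrictMono fun g : M.Simp => M.len g.1 := by
  intro g h hgh
  have hle : PrefixLE M.len g.1 h.1 := hgh.le
  have h1 := M.len_le hle
  rcases h1.eq_or_lt with h2 | h2
  · have h3 := hle
    unfold PrefixLE at h3
    have h4 := M.eq_one_of_len (g.1⁻¹ * h.1) (by omega)
    rw [inv_mul_eq_one] at h4
    exact absurd (Subtype.ext h4) hgh.ne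
  · exact h2

theorem lt_mul_atom {z : G} {a : BraidGen t n} {u : G} (hz : PrefixLE M.len z u)
    (ha : PrefixLE M.len (M.proj (braidOf a)) (z⁻¹ * u)) :
    PrefixLE M.len z (z * M.proj (braidOf a)) ∧ z ≠ z * M.proj (braidOf a) := by
  have h := (M.le_mul_of_le hz ha).2
  refine ⟨?_, fun h' => ?_⟩
  · unfold PrefixLE
    rw [inv_mul_cancel_left]
    exact h.symm
  · rw [← h', M.len_atom] at h
    omega

/-- Translation by `z` carries the join of two linked atoms to a join above `z`. An upper bound `u`
of the translated atoms has `z⁻¹ u` in the interval by `balanced`, so the universal property of the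
join applies to it. -/
theorem isLUB_mul_linked {z : M.Simp} {a b : BraidGen t n}
    (ha : M.atom a ≤ M.compl z) (hb : M.atom b ≤ M.compl z)
    (h : AtomsLinked M.len M.top M.proj a b) :
    ∃ w : M.Simp, IsLUB {M.extend ha, M.extend hb} w := by
  obtain ⟨p, r, hpr, hlen, hle, hlub⟩ := h
  have hjt : PrefixLE M.len (M.proj (braidOf a * p)) (z.1⁻¹ * M.top) :=
    hlub _ (M.balanced _ _ z.2 (M.le_refl _)) ha hb
  refine ⟨⟨z.1 * M.proj (braidOf a * p), (M.le_mul_of_le z.2 hjt).1⟩, ?_, ?_⟩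
  · have hz : PrefixLE M.len z.1 (z.1 * M.proj (braidOf a * p)) := by
      unfold PrefixLE
      rw [inv_mul_cancel_left, (M.le_mul_of_le z.2 hjt).2]
    rintro u (rfl | rfl)
    · refine (M.le_mul_of_le hz ?_).1
      rw [inv_mul_cancel_left]
      exact (M.le_of_reduced hlen).2.2
    · refine (M.le_mul_of_le hz ?_).1
      rw [inv_mul_cancel_left, hpr]
      rw [hpr] at hlen
      exact (M.le_of_reduced hlen).2.2
  · intro u hu
    have h1 := M.le_of_mul_le (M.le_mul_of_le z.2 ha).2 (hu (Set.mem_insert _ _))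
    have h2 := M.le_of_mul_le (M.le_mul_of_le z.2 hb).2 (hu (Set.mem_insert_of_mem _ rfl))
    exact (M.le_mul_of_le h1.1 (hlub _ (M.balanced _ _ h1.1 u.2) h1.2 h2.2)).1

/-- The local criterion with rank `len`: elements strictly above `z` lie above some `z a` and `z b`
with `a`, `b` atoms, and the atom `d` of `linked` gives the connecting element `z d`. -/
theorem exists_isLUB (x y : M.Simp) : ∃ w, IsLUB {x, y} w := by
  refine exists_isLUB_of_local (fun g : M.Simp => M.len g.1) M.simp_strictMono (M.len M.top)
    (fun g => M.len_le g.2) ?_ M.unit x y (M.unit_le _) (M.unit_le _)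
  clear x y
  intro z x y hx hy
  have atom : ∀ u : M.Simp, z < u → ∃ a, PrefixLE M.len (M.proj (braidOf a)) (z.1⁻¹ * u.1) ∧
      PrefixLE M.len (M.proj (braidOf a)) (z.1⁻¹ * M.top) := by
    intro u hu
    obtain ⟨a, ha⟩ := M.exists_atom (z.1⁻¹ * u.1) (M.balanced _ _ hu.le u.2)
      (fun h => hu.ne (Subtype.ext (inv_mul_eq_one.1 h)))
    exact ⟨a, ha, M.le_trans ha (M.inv_mul_le hu.le u.2).2⟩
  obtain ⟨a, hax, hat⟩ := atom x hx
  obtain ⟨b, hby, hbt⟩ := atom y hy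
  obtain ⟨d, had, hdb, hd⟩ := M.linked a b
  have hdt := hd _ (M.balanced _ _ z.2 (M.le_refl _)) hat hbt
  obtain ⟨w₁, hw₁⟩ := M.isLUB_mul_linked hat hdt had
  obtain ⟨w₂, hw₂⟩ := M.isLUB_mul_linked hdt hbt hdb
  have lt : ∀ (a) (ha : PrefixLE M.len (M.proj (braidOf a)) (z.1⁻¹ * M.top)),
      z < M.extend (g := z) (u := M.atom a) ha := fun a ha =>
    lt_of_le_of_ne (M.lt_mul_atom z.2 ha).1
      fun h => (M.lt_mul_atom z.2 ha).2 (congrArg Subtype.val h)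
  refine ⟨_, _, _, w₁, w₂, lt a hat, (M.le_mul_of_le hx.le hax).1, lt b hbt,
    (M.le_mul_of_le hy.le hby).1, lt d hdt, ?_, hw₁, hw₂⟩
  intro u hau hbu
  have h1 := M.le_of_mul_le (M.le_mul_of_le z.2 hat).2 hau
  have h2 := M.le_of_mul_le (M.le_mul_of_le z.2 hbt).2 hbu
  exact (M.le_mul_of_le h1.1 (hd _ (M.balanced _ _ h1.1 u.2) h1.2 h2.2)).1

theorem exists_isGLB (x y : M.Simp) : ∃ w, IsGLB {x, y} w :=
  exists_isGLB_of_isLUB (fun g : M.Simp => M.len g.1) M.simp_strictMono (M.len M.top)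
    (fun g => M.len_le g.2) M.exists_isLUB M.unit M.unit_le x y

/-- The meet of two simple elements. -/
noncomputable def inf (x y : M.Simp) : M.Simp := Classical.choose (M.exists_isGLB x y)

theorem le_inf_iff {u x y : M.Simp} : u ≤ M.inf x y ↔ u ≤ x ∧ u ≤ y := by
  have h := Classical.choose_spec (M.exists_isGLB x y)
  rw [inf, le_isGLB_iff h]
  simp

theorem inf_le_left (x y : M.Simp) : M.inf x y ≤ x := (M.le_inf_iff.1 le_rfl).1

theorem inf_le_right (x y : M.Simp) : M.inf x y ≤ y := (M.le_inf_iff.1 le_rfl).2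

/-! #### Lifting simple elements to braids -/

theorem exists_lift (g : G) (hg : PrefixLE M.len g M.top) :
    ∃ x : Braid t n, M.proj x = g ∧ braidLength x = M.len g := by
  induction h : M.len g generalizing g with
  | zero => exact ⟨1, by rw [map_one, M.eq_one_of_len g h], braidLength_one⟩
  | succ k ih =>
    obtain ⟨a, ha⟩ := M.exists_atom g hg (by rintro rfl; rw [M.len_one] at h; omega)
    obtain ⟨x, hx, hl⟩ := ih ((M.proj (braidOf a))⁻¹ * g) (M.balanced _ _ ha hg) (by
      unfold PrefixLE at ha
      rw [M.len_atom] at ha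
      omega)
    exact ⟨braidOf a * x, by rw [map_mul, hx, mul_inv_cancel_left],
      by rw [braidLength_mul, braidLength_of, hl]; omega⟩

/-- An analogue of Matsumoto's theorem: two reduced decompositions of the same simple element
represent the same braid. -/
theorem lift_unique (x y : Braid t n) (hxt : PrefixLE M.len (M.proj x) M.top)
    (hxy : M.proj x = M.proj y) (hx : M.len (M.proj x) = braidLength x)
    (hy : M.len (M.proj y) = braidLength y) : x = y := by
  induction h : braidLength x using Nat.strong_induction_on generalizing x y with
  | _ k ih =>
    -- If the first letters are linked, both decompositions are compared with one passing through
    -- the join `a p = b r`. After removal of the first letter, the induction hypothesis applies on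
    -- each side.
    have link : ∀ (a b : BraidGen t n) (x' y' : Braid t n), AtomsLinked M.len M.top M.proj a b →
        M.proj (braidOf a * x') = M.proj (braidOf b * y') →
        PrefixLE M.len (M.proj (braidOf a * x')) M.top →
        M.len (M.proj (braidOf a * x')) = braidLength (braidOf a * x') →
        M.len (M.proj (braidOf b * y')) = braidLength (braidOf b * y') →
        braidLength (braidOf a * x') = k → braidOf a * x' = braidOf b * y' := by
      rintro a b x' y' ⟨p, r, hpr, hlen, -, hlub⟩ hab hat hla hlb hk
      have ha := (M.le_of_reduced hla).2.2
      have hb := (M.le_of_reduced hlb).2.2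
      have hj := hlub _ hat ha (hab ▸ hb)
      obtain ⟨s, hs, hls⟩ := M.exists_lift _ (M.balanced _ _ hj hat)
      have e1 : M.proj (braidOf a * x') = M.proj (braidOf a * (p * s)) := by
        rw [← mul_assoc, map_mul _ (braidOf a * p), hs, mul_inv_cancel_left]
      have e2 : M.proj (braidOf b * y') = M.proj (braidOf b * (r * s)) := by
        rw [← hab, e1, ← mul_assoc, hpr, mul_assoc]
      have l1 : M.len (M.proj (braidOf a * (p * s))) = braidLength (braidOf a * (p * s)) := by
        rw [← e1, ← mul_assoc, braidLength_mul _ s, hls, ← hlen]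
        exact hj.symm
      have l2 : M.len (M.proj (braidOf b * (r * s))) = braidLength (braidOf b * (r * s)) := by
        rw [← mul_assoc, ← hpr, mul_assoc, l1]
      have hk' : braidLength (braidOf b * y') = k := by rw [← hlb, ← hab, hla, hk]
      have c1 : x' = p * s := by
        have e1' := e1
        rw [map_mul, map_mul _ _ (p * s), mul_left_cancel_iff] at e1'
        refine ih (braidLength x') ?_ x' (p * s) ?_ e1' (M.le_of_reduced hla).2.1
          (M.le_of_reduced l1).2.1 rfl
        · rw [← hk, braidLength_mul, braidLength_of]; omega
        · have := M.balanced _ _ ha hat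
          rwa [map_mul, inv_mul_cancel_left] at this
      have c2 : y' = r * s := by
        have e2' := e2
        rw [map_mul, map_mul _ _ (r * s), mul_left_cancel_iff] at e2'
        refine ih (braidLength y') ?_ y' (r * s) ?_ e2' (M.le_of_reduced hlb).2.1
          (M.le_of_reduced l2).2.1 rfl
        · rw [← hk', braidLength_mul, braidLength_of]; omega
        · have := M.balanced _ _ hb (hab ▸ hat)
          rwa [map_mul, inv_mul_cancel_left] at this
      rw [c1, c2, ← mul_assoc, hpr, mul_assoc]
    have hly : braidLength y = k := by rw [← hy, ← hxy, hx, h]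
    rcases braid_cases x with rfl | ⟨a, x', rfl⟩
    · rw [braidLength_one] at h
      exact (eq_one_of_braidLength (by omega)).symm
    rcases braid_cases y with rfl | ⟨b, y', rfl⟩
    · rw [braidLength_one] at hly
      exact eq_one_of_braidLength (by omega)
    -- In general a third decomposition starting with `d` is inserted between the two.
    obtain ⟨d, had, hdb, hd⟩ := M.linked a b
    have hdg := hd _ hxt (M.le_of_reduced hx).2.2 (hxy ▸ (M.le_of_reduced hy).2.2)
    obtain ⟨z, hz, hlz⟩ := M.exists_lift _ (M.balanced _ _ hdg hxt)
    have hdz : M.proj (braidOf d * z) = M.proj (braidOf a * x') := by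
      rw [map_mul, hz, mul_inv_cancel_left]
    have hldz : M.len (M.proj (braidOf d * z)) = braidLength (braidOf d * z) := by
      rw [hdz, braidLength_mul, hlz, braidLength_of, ← M.len_atom d]
      exact hdg.symm
    have hk : braidLength (braidOf d * z) = k := by rw [← hldz, hdz, hx, h]
    exact (link a d x' z had hdz.symm hxt hx hldz h).trans
      (link d b z y' hdb (hdz.trans hxy) (hdz ▸ hxt) hldz hy hk)

/-- The braid of a simple element. -/
noncomputable def lift (g : M.Simp) : Braid t n := Classical.choose (M.exists_lift g.1 g.2)

theorem proj_lift (g : M.Simp) : M.proj (M.lift g) = g.1 :=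
  (Classical.choose_spec (M.exists_lift g.1 g.2)).1

theorem length_lift (g : M.Simp) : braidLength (M.lift g) = M.len g.1 :=
  (Classical.choose_spec (M.exists_lift g.1 g.2)).2

theorem eq_lift {x : Braid t n} {g : M.Simp} (h : M.proj x = g.1)
    (hl : braidLength x = M.len g.1) : x = M.lift g :=
  M.lift_unique _ _ (h ▸ g.2) (by rw [h, proj_lift]) (by rw [h, hl])
    (by rw [proj_lift, length_lift])

theorem lift_mul {g h k : M.Simp} (hk : g.1 * h.1 = k.1) (hle : g ≤ k) :
    M.lift g * M.lift h = M.lift k := by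
  apply M.eq_lift
  · rw [map_mul, proj_lift, proj_lift, hk]
  · rw [braidLength_mul, length_lift, length_lift]
    have : PrefixLE M.len g.1 k.1 := hle
    unfold PrefixLE at this
    rwa [← hk, inv_mul_cancel_left, hk] at this

theorem lift_unit : M.lift M.unit = 1 :=
  (M.eq_lift (by rw [map_one]; rfl) (by rw [braidLength_one]; exact M.len_one.symm)).symm

theorem lift_mul_quot {g h : M.Simp} (hgh : g ≤ h) : M.lift g * M.lift (M.quot hgh) = M.lift h :=
  M.lift_mul (mul_inv_cancel_left _ _) hgh

theorem lift_extend {g u : M.Simp} (h : u ≤ M.compl g) :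
    M.lift (M.extend h) = M.lift g * M.lift u :=
  (M.lift_mul rfl (M.le_extend h)).symm

/-! ### The action of braids on pairs (head, tail) -/

/-- The left multiplication of a simple element on pairs (head, tail). -/
noncomputable def act (g : M.Simp) : Function.End (M.Simp × Braid t n) := fun p =>
  (M.extend (M.inf_le_left (M.compl g) p.1),
    M.lift (M.quot (M.inf_le_right (M.compl g) p.1)) * p.2)

theorem act_unit : M.act M.unit = 1 := by
  funext p
  have h : M.inf (M.compl M.unit) p.1 = p.1 := by
    refine _root_.le_antisymm (M.inf_le_right _ _) (M.le_inf_iff.2 ⟨?_, le_rfl⟩)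
    change PrefixLE M.len p.1.1 (1⁻¹ * M.top)
    rw [inv_one, one_mul]
    exact p.1.2
  refine Prod.ext (Subtype.ext ?_) ?_
  · change 1 * (M.inf (M.compl M.unit) p.1).1 = p.1.1
    rw [h, one_mul]
  · have : M.quot (M.inf_le_right (M.compl M.unit) p.1) = M.unit := by
      apply Subtype.ext
      change (M.inf (M.compl M.unit) p.1).1⁻¹ * p.1.1 = 1
      rw [h, inv_mul_cancel]
    change M.lift (M.quot (M.inf_le_right (M.compl M.unit) p.1)) * p.2 = p.2
    rw [this, lift_unit, one_mul]

/-- Acting by `g` moves into the head the largest prefix of the old head that still fits after `g`,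
namely its meet with the complement of `g`. Acting by `h` and then `g` transfers the same prefix `w`
as acting by `k = g h` at once; this is the identity `u = h w` below. -/
theorem act_act {g h k : M.Simp} (hk : g.1 * h.1 = k.1) (hle : g ≤ k) :
    M.act g * M.act h = M.act k := by
  funext p
  obtain ⟨a, m⟩ := p
  set v := M.inf (M.compl h) a with hv
  set e := M.extend (M.inf_le_left (M.compl h) a) with he
  set u := M.inf (M.compl g) e with hu
  set w := M.inf (M.compl k) a with hw
  have hkg : k.1⁻¹ * M.top = h.1⁻¹ * (g.1⁻¹ * M.top) := by
    rw [← hk, mul_inv_rev, mul_assoc]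
  have hhg : h ≤ M.compl g := by
    have := (M.inv_mul_le hle k.2).2
    rwa [← hk, inv_mul_cancel_left] at this
  have hkh : M.compl k ≤ M.compl h := by
    have := (M.inv_mul_le hhg (M.compl g).2).2
    change PrefixLE M.len (k.1⁻¹ * M.top) _
    rw [hkg]
    exact this
  have hwv : w ≤ v :=
    M.le_inf_iff.2 ⟨(M.inf_le_left _ _).trans hkh, M.inf_le_right _ _⟩
  have hev : e.1 = h.1 * v.1 := rfl
  have hhe : h ≤ e := M.le_extend _
  have h1 : PrefixLE M.len (h.1 * w.1) (g.1⁻¹ * M.top) :=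
    (M.le_mul_of_le hhg (by
      have : PrefixLE M.len w.1 (k.1⁻¹ * M.top) := M.inf_le_left (M.compl k) a
      rwa [hkg] at this)).1
  have h2 : PrefixLE M.len (h.1 * w.1) e.1 :=
    (M.le_mul_of_le hhe (by rw [hev, inv_mul_cancel_left]; exact hwv)).1
  have h3 : M.len (h.1 * w.1) = M.len h.1 + M.len w.1 :=
    (M.le_mul_of_le hhe (by rw [hev, inv_mul_cancel_left]; exact hwv)).2
  have hhw : PrefixLE M.len h.1 (h.1 * w.1) := by
    unfold PrefixLE
    rw [inv_mul_cancel_left, h3]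
  let hw' : M.Simp := ⟨h.1 * w.1, M.le_trans h2 e.2⟩
  -- The identity `u = h w` by two inequalities; for the second one, `h` divides both sides and the
  -- quotient `h⁻¹ u` is tested against the meet defining `w`.
  have hle1 : hw' ≤ u := M.le_inf_iff.2 ⟨h1, h2⟩
  have hhu : h ≤ u := M.le_trans hhw hle1
  have hle2 : u ≤ hw' := by
    refine M.le_of_inv_mul_le hhw ?_
    change PrefixLE M.len (h.1⁻¹ * u.1) (h.1⁻¹ * (h.1 * w.1))
    rw [inv_mul_cancel_left]
    have c1 : M.quot hhu ≤ M.compl k := by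
      have := (M.inv_mul_le hhu (M.inf_le_left (M.compl g) e)).2
      change PrefixLE M.len _ (k.1⁻¹ * M.top)
      rw [hkg]
      exact this
    have c2 : M.quot hhu ≤ v := by
      have := (M.inv_mul_le hhu (M.inf_le_right (M.compl g) e)).2
      rwa [hev, inv_mul_cancel_left] at this
    exact M.le_inf_iff.2 ⟨c1, c2.trans (M.inf_le_right _ _)⟩
  have huw : u.1 = h.1 * w.1 :=
    congrArg Subtype.val (_root_.le_antisymm (a := u) (b := hw') hle2 hle1)
  refine Prod.ext (Subtype.ext ?_) ?_
  · change g.1 * u.1 = k.1 * w.1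
    rw [huw, ← hk, mul_assoc]
  · change M.lift (M.quot (M.inf_le_right (M.compl g) e)) *
      (M.lift (M.quot (M.inf_le_right (M.compl h) a)) * m) =
      M.lift (M.quot (M.inf_le_right (M.compl k) a)) * m
    rw [← mul_assoc]
    congr 1
    apply M.lift_mul
    · change u.1⁻¹ * e.1 * (v.1⁻¹ * a.1) = w.1⁻¹ * a.1
      rw [huw, hev, mul_inv_rev]
      group
    · change PrefixLE M.len (u.1⁻¹ * e.1) (w.1⁻¹ * a.1)
      rw [huw, hev, mul_inv_rev, mul_assoc, inv_mul_cancel_left]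
      exact (M.inv_mul_le hwv (M.inf_le_right _ _)).2

theorem lift_atom (a : BraidGen t n) : M.lift (M.atom a) = braidOf a :=
  (M.eq_lift rfl (by rw [braidLength_of]; exact (M.len_atom a).symm)).symm

/-- Along a reduced word every suffix is a simple quotient, so `act_act` collapses the composite
letter by letter. As both sides of a defining relation are reduced words of one simple element, the
action descends to the braid monoid. -/
theorem freeLift_act (w : FreeMonoid (BraidGen t n)) (g : M.Simp)
    (hg : M.proj (PresentedMonoid.mk _ w) = g.1) (hl : M.len g.1 = w.length) :
    FreeMonoid.lift (fun a => M.act (M.atom a)) w = M.act g := by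
  induction w using FreeMonoid.inductionOn' generalizing g with
  | one =>
    have : g = M.unit := Subtype.ext (by rw [← hg, map_one, map_one]; rfl)
    rw [map_one, this, act_unit]
  | of_mul a w ih =>
    have hx : PresentedMonoid.mk (braidRel t n) (FreeMonoid.of a * w) =
        braidOf a * PresentedMonoid.mk _ w := map_mul _ _ _
    have hred : M.len (M.proj (braidOf a * PresentedMonoid.mk (braidRel t n) w)) =
        braidLength (braidOf a * PresentedMonoid.mk (braidRel t n) w) := by
      rw [← hx, hg, hl, braidLength_mk]
    have hag : M.atom a ≤ g := by
      have := (M.le_of_reduced hred).2.2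
      rwa [← hx, hg] at this
    have hq : M.proj (PresentedMonoid.mk _ w) = (M.quot hag).1 := by
      change _ = (M.proj (braidOf a))⁻¹ * g.1
      rw [← hg, hx, map_mul, inv_mul_cancel_left]
    rw [map_mul, FreeMonoid.lift_eval_of, ih (M.quot hag) hq (by
      rw [← hq, (M.le_of_reduced hred).2.1, braidLength_mk])]
    exact M.act_act (mul_inv_cancel_left _ _) hag

/-- The action of braids on pairs (head, tail). -/
noncomputable def actHom : Braid t n →* Function.End (M.Simp × Braid t n) :=
  PresentedMonoid.lift (fun a => M.act (M.atom a)) (by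
    intro u v huv
    obtain ⟨h1, h2⟩ := M.rel_reduced u v huv
    have hmk : PresentedMonoid.mk (braidRel t n) u = PresentedMonoid.mk _ v :=
      PresentedMonoid.mk_eq_mk_of_rel huv
    have hlen : u.length = v.length := by rw [← braidLength_mk u, hmk, braidLength_mk]
    rw [M.freeLift_act u ⟨_, h1⟩ rfl h2, M.freeLift_act v ⟨_, h1⟩ (congrArg M.proj hmk.symm) (h2.trans hlen)])

theorem actHom_lift (g : M.Simp) : M.actHom (M.lift g) = M.act g := by
  obtain ⟨w, hw⟩ := PresentedMonoid.surjective_mk (M.lift g)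
  rw [← hw]
  exact M.freeLift_act w g (by rw [hw, proj_lift]) (by rw [← length_lift, ← hw, braidLength_mk])

/-- Head and tail of a braid. -/
noncomputable def split (x : Braid t n) : M.Simp × Braid t n := M.actHom x (M.unit, 1)

theorem split_lift_mul (g : M.Simp) (x : Braid t n) :
    M.split (M.lift g * x) = M.act g (M.split x) := by
  rw [split, map_mul, actHom_lift]
  rfl

theorem lift_split (x : Braid t n) : M.lift (M.split x).1 * (M.split x).2 = x := by
  induction x using braid_induction with
  | one => rw [split, map_one]; exact (mul_one _).trans M.lift_unit
  | mul a x ih =>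
    rw [← M.lift_atom, split_lift_mul]
    conv_rhs => rw [← ih]
    change M.lift (M.extend (M.inf_le_left _ _)) * (M.lift (M.quot (M.inf_le_right _ _)) * _) = _
    rw [lift_extend, mul_assoc, ← mul_assoc (M.lift (M.inf _ _)), lift_mul_quot]

/-- The pair attached to `lift g * x` reveals the part of the head of `x` absorbed by `g` and the
product of everything left; multiplied together these give back `x`. -/
theorem lift_mul_left_cancel (g : M.Simp) (x y : Braid t n) (h : M.lift g * x = M.lift g * y) :
    x = y := by
  have h1 := congrArg M.split h
  rw [split_lift_mul, split_lift_mul] at h1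
  have h2 : M.inf (M.compl g) (M.split x).1 = M.inf (M.compl g) (M.split y).1 := by
    have := congrArg (fun p => p.1.1) h1
    exact Subtype.ext (mul_left_cancel this)
  have h3 : M.lift (M.quot (M.inf_le_right (M.compl g) (M.split x).1)) * (M.split x).2 =
      M.lift (M.quot (M.inf_le_right (M.compl g) (M.split y).1)) * (M.split y).2 :=
    congrArg (fun p => p.2) h1
  rw [← M.lift_split x, ← M.lift_split y, ← M.lift_mul_quot (M.inf_le_right (M.compl g) _),
    mul_assoc, h3, ← mul_assoc]
  simp only [h2]
  rw [lift_mul_quot]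

/-- This identifies the first component of `split x` with the greatest simple left divisor of `x`.
-/
theorem lift_dvd_iff (g : M.Simp) (x : Braid t n) : M.lift g ∣ x ↔ g ≤ (M.split x).1 := by
  constructor
  · rintro ⟨y, rfl⟩
    rw [split_lift_mul]
    exact M.le_extend (M.inf_le_left _ _)
  · intro h
    conv_rhs => rw [← M.lift_split x, ← M.lift_mul_quot h, mul_assoc]
    exact dvd_mul_right _ _

theorem split_lift (g : M.Simp) : (M.split (M.lift g)).1 = g := by
  refine _root_.le_antisymm ?_ ((M.lift_dvd_iff _ _).1 dvd_rfl)
  have h1 := braidLength_le_of_dvd ((M.lift_dvd_iff (M.split (M.lift g)).1 (M.lift g)).2 le_rfl)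
  have h2 : g ≤ (M.split (M.lift g)).1 := (M.lift_dvd_iff _ _).1 dvd_rfl
  rw [length_lift, length_lift] at h1
  rcases h2.eq_or_lt with h3 | h3
  · exact h3.ge
  · have : M.len g.1 < M.len (M.split (M.lift g)).1.1 := M.simp_strictMono h3
    omega

theorem lift_dvd_lift {g h : M.Simp} : M.lift g ∣ M.lift h ↔ g ≤ h := by
  rw [lift_dvd_iff, split_lift]

/-! ### Joins of generators, the Garside element and simple braids -/

theorem exists_isLUB_finset (X : Finset (BraidGen t n)) :
    ∃ w : M.Simp, ∀ u, w ≤ u ↔ ∀ a ∈ X, M.atom a ≤ u := by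
  classical
  induction X using Finset.induction_on with
  | empty => exact ⟨M.unit, fun u => by simpa using M.unit_le u⟩
  | insert a X _ ih =>
    obtain ⟨w, hw⟩ := ih
    obtain ⟨w', hw'⟩ := M.exists_isLUB (M.atom a) w
    refine ⟨w', fun u => ?_⟩
    rw [isLUB_le_iff hw']
    simp [hw]

/-- Divisibility by a simple braid depends on the head alone, so a join of atoms in the interval
remains a join in the whole monoid. -/
theorem exists_isGenJoin (M : GermModel t n G) (X : Finset (BraidGen t n)) : ∃ d : Braid t n, IsGenJoin X d := by
  obtain ⟨w, hw⟩ := M.exists_isLUB_finset X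
  have key : ∀ y : Braid t n, M.lift w ∣ y ↔ ∀ a ∈ X, braidOf a ∣ y := by
    intro y
    rw [lift_dvd_iff, hw]
    simp_rw [← M.lift_atom, lift_dvd_iff]
  exact ⟨M.lift w, (key _).1 dvd_rfl, fun y => (key y).2⟩

theorem garside_eq : garside t n = M.lift M.maxi := by
  refine deltaOf_eq ⟨fun a _ => ?_, fun y hy => ?_⟩
  · rw [← M.lift_atom, lift_dvd_lift]
    exact M.le_maxi _
  · rw [lift_dvd_iff]
    have : (M.split y).1 = M.maxi := Subtype.ext (M.eq_top _ (M.split y).1.2 fun a =>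
      (M.lift_dvd_iff (M.atom a) y).1 (by rw [lift_atom]; exact hy a (Finset.mem_univ a)))
    rw [this]

theorem isSimple_lift (g : M.Simp) : IsSimple (M.lift g) := by
  rw [IsSimple, M.garside_eq, lift_dvd_lift]
  exact M.le_maxi g

/-- A divisor of the lift of `top` begins a reduced decomposition of `top`, hence is itself reduced
and projects into the interval. -/
theorem exists_eq_lift {x : Braid t n} (hx : IsSimple x) : ∃ g, x = M.lift g := by
  rw [IsSimple, M.garside_eq] at hx
  obtain ⟨y, hy⟩ := hx
  have hred : M.len (M.proj (x * y)) = braidLength (x * y) := by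
    rw [← hy, proj_lift, length_lift]
  have h := M.le_of_reduced hred
  refine ⟨⟨M.proj x, ?_⟩, M.eq_lift rfl h.1.symm⟩
  have := h.2.2
  rw [← hy, proj_lift] at this
  exact this

end GermModel

/-- The properties of a Garside monoid that are used below. -/
structure GarsideFacts (t : BraidType) (n : ℕ) : Prop where
  mul_left_cancel : ∀ x y z : Braid t n, x * y = x * z → y = z
  exists_isGenJoin : ∀ X : Finset (BraidGen t n), ∃ d : Braid t n, IsGenJoin X d
  exists_head : ∀ x : Braid t n, ∃ a, IsSimple a ∧ a ∣ x ∧ ∀ s, IsSimple s → s ∣ x → s ∣ a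
  not_isSimple_sq : ∀ a : BraidGen t n, ¬ IsSimple (braidOf a * braidOf a)
  conj_of : ∀ a : BraidGen t n, ∃ b, braidOf a * garside t n = garside t n * braidOf b
  left_complement_unique : ∀ x y z : Braid t n, x * z = garside t n → y * z = garside t n → x = y

theorem GermModel.garsideFacts {t : BraidType} {n : ℕ} {G : Type*} [Group G]
    (M : GermModel t n G) : GarsideFacts t n where
  mul_left_cancel x y z h := by
    induction x using braid_induction with
    | one => simpa using h
    | mul a x ih =>
      rw [mul_assoc, mul_assoc, ← M.lift_atom] at h
      exact ih (M.lift_mul_left_cancel _ _ _ h)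
  exists_isGenJoin := M.exists_isGenJoin
  exists_head x := by
    refine ⟨M.lift (M.split x).1, M.isSimple_lift _, (M.lift_dvd_iff _ _).2 le_rfl, ?_⟩
    intro s hs hsx
    obtain ⟨g, rfl⟩ := M.exists_eq_lift hs
    rw [M.lift_dvd_lift]
    exact (M.lift_dvd_iff _ _).1 hsx
  not_isSimple_sq a h := by
    obtain ⟨g, hg⟩ := M.exists_eq_lift h
    have h1 := congrArg M.proj hg
    have h2 := congrArg braidLength hg
    rw [map_mul, M.atom_sq, M.proj_lift] at h1
    rw [braidLength_mul, braidLength_of, M.length_lift, ← h1, M.len_one] at h2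
    omega
  -- With `c` the complement of `a`, `a c = Δ = c b`, whence `a Δ = a c b = Δ b`.
  conj_of a := by
    obtain ⟨b, hb⟩ := M.conj_atom a
    refine ⟨b, ?_⟩
    have h1 : braidOf a * M.lift (M.compl (M.atom a)) = garside t n := by
      rw [← M.lift_atom, M.garside_eq]
      exact M.lift_mul_quot _
    have h2 : M.lift (M.compl (M.atom a)) * braidOf b = garside t n := by
      rw [← M.lift_atom b, M.garside_eq]
      have hm : (M.compl (M.atom a)).1 * (M.atom b).1 = M.maxi.1 := by
        change (M.proj (braidOf a))⁻¹ * M.top * M.proj (braidOf b) = M.top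
        rw [mul_assoc, ← hb, inv_mul_cancel_left]
      exact M.lift_mul hm (M.le_maxi _)
    conv_lhs => rw [← h2]
    rw [← mul_assoc, h1]
  left_complement_unique x y z hx hy := by
    obtain ⟨g, rfl⟩ := M.exists_eq_lift (x := x) ⟨z, hx.symm⟩
    obtain ⟨h, rfl⟩ := M.exists_eq_lift (x := y) ⟨z, hy.symm⟩
    have := congrArg M.proj (hx.trans hy.symm)
    rw [map_mul, map_mul, mul_left_inj, M.proj_lift, M.proj_lift] at this
    rw [Subtype.ext this]

/-! ### Normal forms -/

section NormalForm

variable {t : BraidType} {n : ℕ}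

/-- The greatest simple left divisor of a braid. -/
noncomputable def braidHead (x : Braid t n) : Braid t n :=
  Classical.epsilon fun a => IsSimple a ∧ a ∣ x ∧ ∀ s, IsSimple s → s ∣ x → s ∣ a

/-- The quotient of a braid by its head. -/
noncomputable def braidTail (x : Braid t n) : Braid t n :=
  Classical.epsilon fun y => x = braidHead x * y

/-- The product of the first `k` factors of the normal form of a braid. -/
noncomputable def braidPrefix : ℕ → Braid t n → Braid t n
  | 0, _ => 1
  | k + 1, x => braidHead x * braidPrefix k (braidTail x)

namespace GarsideFacts

variable (hG : GarsideFacts t n)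
include hG

theorem deltaOf_spec (X : Finset (BraidGen t n)) : IsGenJoin X (deltaOf X) :=
  Classical.epsilon_spec (hG.exists_isGenJoin X)

theorem deltaOf_dvd_iff (X : Finset (BraidGen t n)) (y : Braid t n) :
    deltaOf X ∣ y ↔ ∀ a ∈ X, braidOf a ∣ y :=
  ⟨fun h a ha => ((hG.deltaOf_spec X).1 a ha).trans h, (hG.deltaOf_spec X).2 y⟩

theorem isSimple_of (a : BraidGen t n) : IsSimple (braidOf a) :=
  (hG.deltaOf_spec Finset.univ).1 a (Finset.mem_univ a)

theorem eq_garside_of_forall_dvd {x : Braid t n} (hx : IsSimple x) (h : ∀ a, braidOf a ∣ x) :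
    x = garside t n :=
  braid_dvd_antisymm hx ((hG.deltaOf_spec Finset.univ).2 x fun a _ => h a)

theorem head_spec (x : Braid t n) : IsSimple (braidHead x) ∧ braidHead x ∣ x ∧
    ∀ s, IsSimple s → s ∣ x → s ∣ braidHead x :=
  Classical.epsilon_spec (hG.exists_head x)

theorem isSimple_head (x : Braid t n) : IsSimple (braidHead x) := (hG.head_spec x).1

theorem head_dvd (x : Braid t n) : braidHead x ∣ x := (hG.head_spec x).2.1

theorem dvd_head {s x : Braid t n} (hs : IsSimple s) (h : s ∣ x) : s ∣ braidHead x :=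
  (hG.head_spec x).2.2 s hs h

theorem head_eq {s x : Braid t n} (hs : IsSimple s) (h : s ∣ x)
    (h' : ∀ u, IsSimple u → u ∣ x → u ∣ s) : braidHead x = s :=
  braid_dvd_antisymm (h' _ (hG.isSimple_head x) (hG.head_dvd x)) (hG.dvd_head hs h)

theorem head_of_simple {s : Braid t n} (hs : IsSimple s) : braidHead s = s :=
  hG.head_eq hs dvd_rfl fun _ _ h => h

theorem head_mul_tail (x : Braid t n) : braidHead x * braidTail x = x :=
  (Classical.epsilon_spec (p := fun y => x = braidHead x * y) (hG.head_dvd x)).symm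

theorem tail_eq {x y : Braid t n} (h : x = braidHead x * y) : braidTail x = y :=
  hG.mul_left_cancel (braidHead x) _ _ (by rw [hG.head_mul_tail, ← h])

theorem dvd_of_mul_dvd_mul {x y z : Braid t n} (h : x * y ∣ x * z) : y ∣ z := by
  obtain ⟨w, hw⟩ := h
  exact ⟨w, hG.mul_left_cancel x _ _ (by rw [hw, mul_assoc])⟩

theorem exists_conj (x : Braid t n) : ∃ y, x * garside t n = garside t n * y := by
  induction x using braid_induction with
  | one => exact ⟨1, by simp⟩
  | mul a x ih =>
    obtain ⟨y, hy⟩ := ih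
    obtain ⟨b, hb⟩ := hG.conj_of a
    exact ⟨braidOf b * y, by rw [mul_assoc, hy, ← mul_assoc, hb, mul_assoc]⟩

/-- If `u v w = Δ` and `u Δ = Δ u'`, then `u Δ = u v w u'`, and cancelling `u` shows that `v`
divides `Δ`. -/
theorem isSimple_right {u v : Braid t n} (h : IsSimple (u * v)) : IsSimple v := by
  obtain ⟨w, hw⟩ := h
  obtain ⟨u', hu'⟩ := hG.exists_conj u
  refine ⟨w * u', hG.mul_left_cancel u _ _ ?_⟩
  rw [hu', hw]
  simp only [mul_assoc]

omit hG in
theorem isSimple_left {u v : Braid t n} (h : IsSimple (u * v)) : IsSimple u :=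
  (dvd_mul_right u v).trans h

theorem head_mul_dvd {s : Braid t n} (x : Braid t n) (hs : IsSimple s) :
    ∃ u, braidHead (s * x) = s * u ∧ IsSimple u ∧ u ∣ x := by
  obtain ⟨u, hu⟩ := hG.dvd_head hs (dvd_mul_right s x)
  refine ⟨u, hu, hG.isSimple_right (hu ▸ hG.isSimple_head _), hG.dvd_of_mul_dvd_mul (x := s) ?_⟩
  rw [← hu]
  exact hG.head_dvd _

/-- What the head of `s * x` adds to `s` is a simple divisor of `x`, hence divides the head of `x`.
This makes normality a condition on consecutive factors only. -/
theorem head_mul_head {s : Braid t n} (x : Braid t n) (hs : IsSimple s) :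
    braidHead (s * braidHead x) = braidHead (s * x) := by
  apply hG.head_eq (hG.isSimple_head _)
  · obtain ⟨u, hu, hus, hux⟩ := hG.head_mul_dvd x hs
    rw [hu]
    exact mul_dvd_mul_left s (hG.dvd_head hus hux)
  · intro u hu h
    exact hG.dvd_head hu (h.trans (mul_dvd_mul_left s (hG.head_dvd x)))

/-- `x * y` has head `x` if and only if no letter of `x` can be extended by a letter of `y`. -/
theorem head_mul_eq_iff {x y : Braid t n} (hx : IsSimple x) :
    braidHead (x * y) = x ↔ ∀ a, braidOf a ∣ y → ¬ IsSimple (x * braidOf a) := by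
  constructor
  · intro h a ha hs
    have := braidLength_le_of_dvd (hG.dvd_head hs (mul_dvd_mul_left x ha))
    rw [h, braidLength_mul, braidLength_of] at this
    omega
  · intro h
    obtain ⟨u, hu, hus, huy⟩ := hG.head_mul_dvd y hx
    by_contra hne
    obtain ⟨a, v, rfl⟩ := exists_braidOf_dvd (x := u) (by rintro rfl; simp_all)
    refine h a ((dvd_mul_right _ _).trans huy) ?_
    have := hG.isSimple_head (x * y)
    rw [hu, ← mul_assoc] at this
    exact isSimple_left this

/-- Paths in the graph are thus exactly the sequences in which each factor is the head of its
product with the next. -/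
theorem arrow_iff {x y : SimpleBraid t n} : Arrow x y ↔ braidHead (x.1 * y.1) = x.1 := by
  rw [hG.head_mul_eq_iff x.2]
  rfl

theorem head_one : braidHead (1 : Braid t n) = 1 := hG.head_of_simple (one_dvd _)

theorem tail_one : braidTail (1 : Braid t n) = 1 :=
  hG.tail_eq (by rw [hG.head_one, one_mul])

theorem head_ne_one {x : Braid t n} (hx : x ≠ 1) : braidHead x ≠ 1 := by
  intro h
  obtain ⟨a, ha⟩ := exists_braidOf_dvd hx
  have := braidLength_le_of_dvd (hG.dvd_head (hG.isSimple_of a) ha)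
  rw [h, braidLength_one, braidLength_of] at this
  omega

theorem length_tail_lt {x : Braid t n} (hx : x ≠ 1) :
    braidLength (braidTail x) < braidLength x := by
  have h1 : braidLength (braidHead x) ≠ 0 := fun h => hG.head_ne_one hx (eq_one_of_braidLength h)
  have h2 := congrArg braidLength (hG.head_mul_tail x)
  rw [braidLength_mul] at h2
  omega

theorem length_iterate_tail (k : ℕ) (x : Braid t n) :
    braidLength (braidTail^[k] x) ≤ braidLength x - k := by
  induction k with
  | zero => simp
  | succ k ih =>
    rw [Function.iterate_succ_apply']
    by_cases h : braidTail^[k] x = 1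
    · rw [h, hG.tail_one, braidLength_one]
      omega
    · have := hG.length_tail_lt h
      omega

theorem iterate_tail_eq_one {k : ℕ} {x : Braid t n} (h : braidLength x ≤ k) :
    braidTail^[k] x = 1 :=
  eq_one_of_braidLength (by have := hG.length_iterate_tail k x; omega)

theorem head_head_mul_head_tail (x : Braid t n) :
    braidHead (braidHead x * braidHead (braidTail x)) = braidHead x := by
  rw [hG.head_mul_head _ (hG.isSimple_head x), hG.head_mul_tail]

theorem prefix_mul_iterate_tail (k : ℕ) (x : Braid t n) :
    braidPrefix k x * braidTail^[k] x = x := by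
  induction k generalizing x with
  | zero => simp [braidPrefix]
  | succ k ih =>
    rw [braidPrefix, Function.iterate_succ_apply, mul_assoc, ih, hG.head_mul_tail]

theorem prefix_dvd (k : ℕ) (x : Braid t n) : braidPrefix k x ∣ x :=
  ⟨_, (hG.prefix_mul_iterate_tail k x).symm⟩

theorem prefix_eq_self {k : ℕ} {x : Braid t n} (h : braidLength x ≤ k) : braidPrefix k x = x := by
  have := hG.prefix_mul_iterate_tail k x
  rwa [hG.iterate_tail_eq_one h, mul_one] at this

/-- The head of `u * z` is `u * v` with `v` dividing the head `v * w` of `z`. The leftover `w` is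
simple and multiplies the tail of `z`, so the argument repeats with `w` in place of `u`. -/
theorem prefix_mul_dvd {u : Braid t n} (k : ℕ) (z : Braid t n) (hu : IsSimple u) :
    braidPrefix k (u * z) ∣ u * braidPrefix k z := by
  induction k generalizing u z with
  | zero => exact one_dvd _
  | succ k ih =>
    obtain ⟨v, hv, hvs, hvz⟩ := hG.head_mul_dvd z hu
    obtain ⟨w, hw⟩ := hG.dvd_head hvs hvz
    have hws : IsSimple w := hG.isSimple_right (hw ▸ hG.isSimple_head z)
    have htail : braidTail (u * z) = w * braidTail z := by
      apply hG.tail_eq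
      rw [hv]
      conv_lhs => rw [← hG.head_mul_tail z, hw]
      simp only [mul_assoc]
    rw [braidPrefix, braidPrefix, htail, hv, hw, mul_assoc, mul_assoc]
    exact mul_dvd_mul_left _ (mul_dvd_mul_left _ (ih _ hws))

/-- The product of the first `k` factors of `x` is divisible by all divisors of `x` whose normal
form has at most `k` factors. -/
theorem dvd_prefix_of_prefix_eq {k : ℕ} {x y : Braid t n} (hy : braidPrefix k y = y) (h : y ∣ x) :
    y ∣ braidPrefix k x := by
  induction k generalizing x y with
  | zero => rw [← hy]; exact one_dvd _
  | succ k ih =>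
    have hyt := hG.head_mul_tail y
    have hy' : braidPrefix k (braidTail y) = braidTail y :=
      hG.mul_left_cancel (braidHead y) _ _ (hyt.symm ▸ hy)
    obtain ⟨u, hu⟩ := hG.dvd_head (hG.isSimple_head y) ((hG.head_dvd y).trans h)
    have hus : IsSimple u := hG.isSimple_right (hu ▸ hG.isSimple_head x)
    have hyx : braidTail y ∣ u * braidTail x := by
      apply hG.dvd_of_mul_dvd_mul (x := braidHead y)
      rw [← mul_assoc, ← hu, hyt, hG.head_mul_tail]
      exact h
    rw [braidPrefix, hu, mul_assoc]
    exact hyt.symm.dvd.trans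
      (mul_dvd_mul_left _ ((ih hy' hyx).trans (hG.prefix_mul_dvd k _ hus)))

end GarsideFacts

/-! ### Paths as normal forms -/

/-- The product of the first `k` factors of a generalized braid. -/
noncomputable def pathPrefix (ξ : GenBraid t n) (k : ℕ) : Braid t n :=
  ((List.range k).map fun i => (ξ.1 i).1).prod

/-- The path without its first vertex. -/
def pathShift (ξ : GenBraid t n) : GenBraid t n := ⟨fun k => ξ.1 (k + 1), fun k => ξ.2 (k + 1)⟩

theorem pathPrefix_zero (ξ : GenBraid t n) : pathPrefix ξ 0 = 1 := rfl

theorem pathPrefix_succ (ξ : GenBraid t n) (k : ℕ) :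
    pathPrefix ξ (k + 1) = pathPrefix ξ k * (ξ.1 k).1 := by
  simp [pathPrefix, List.range_succ]

theorem pathPrefix_succ' (ξ : GenBraid t n) (k : ℕ) :
    pathPrefix ξ (k + 1) = (ξ.1 0).1 * pathPrefix (pathShift ξ) k := by
  simp [pathPrefix, List.range_succ_eq_map, pathShift, Function.comp_def]

theorem pathPrefix_dvd (ξ : GenBraid t n) {k m : ℕ} (h : k ≤ m) :
    pathPrefix ξ k ∣ pathPrefix ξ m := by
  induction m, h using Nat.le_induction with
  | base => exact dvd_rfl
  | succ m _ ih => rw [pathPrefix_succ]; exact ih.trans (dvd_mul_right _ _)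

namespace GarsideFacts

variable (hG : GarsideFacts t n)
include hG

/-- Local normality implies global normality: by `head_mul_head` the later factors influence the
head only through the second one. -/
theorem head_pathPrefix (ξ : GenBraid t n) (k : ℕ) :
    braidHead (pathPrefix ξ (k + 1)) = (ξ.1 0).1 := by
  induction k generalizing ξ with
  | zero =>
    rw [pathPrefix_succ, pathPrefix_zero, one_mul]
    exact hG.head_of_simple (ξ.1 0).2
  | succ k ih =>
    rw [pathPrefix_succ', ← hG.head_mul_head _ (ξ.1 0).2, ih]
    exact hG.arrow_iff.1 (ξ.2 0)

theorem tail_pathPrefix (ξ : GenBraid t n) (k : ℕ) :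
    braidTail (pathPrefix ξ (k + 1)) = pathPrefix (pathShift ξ) k :=
  hG.tail_eq (by rw [hG.head_pathPrefix, pathPrefix_succ'])

theorem prefix_pathPrefix (ξ : GenBraid t n) {k m : ℕ} (h : k ≤ m) :
    braidPrefix k (pathPrefix ξ m) = pathPrefix ξ k := by
  induction k generalizing ξ m with
  | zero => rfl
  | succ k ih =>
    obtain ⟨m, rfl⟩ : ∃ m', m = m' + 1 := ⟨m - 1, by omega⟩
    rw [braidPrefix, hG.head_pathPrefix, hG.tail_pathPrefix, ih _ (by omega), pathPrefix_succ']

/-- The factors of a path are determined by its prefixes. -/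
theorem eq_of_pathPrefix_eq {ξ η : GenBraid t n} {k : ℕ} (h : pathPrefix ξ k = pathPrefix η k)
    {i : ℕ} (hi : i < k) : ξ.1 i = η.1 i := by
  have h1 : ∀ j ≤ k, pathPrefix ξ j = pathPrefix η j := fun j hj => by
    rw [← hG.prefix_pathPrefix ξ hj, h, hG.prefix_pathPrefix η hj]
  have h2 := h1 (i + 1) hi
  rw [pathPrefix_succ, pathPrefix_succ, h1 i hi.le] at h2
  exact Subtype.ext (hG.mul_left_cancel _ _ _ h2)

/-- The extended normal form of a braid. -/
noncomputable def normalForm (x : Braid t n) : GenBraid t n :=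
  ⟨fun k => ⟨braidHead (braidTail^[k] x), hG.isSimple_head _⟩, fun k => hG.arrow_iff.2 <| by
    change braidHead (braidHead (braidTail^[k] x) * braidHead (braidTail^[k + 1] x)) = _
    rw [Function.iterate_succ_apply']
    exact hG.head_head_mul_head_tail _⟩

theorem pathPrefix_normalForm (x : Braid t n) (k : ℕ) :
    pathPrefix (hG.normalForm x) k = braidPrefix k x := by
  induction k generalizing x with
  | zero => rfl
  | succ k ih => rw [pathPrefix_succ', braidPrefix, ← ih]; rfl

theorem isExtDecomp_normalForm (x : Braid t n) : IsExtDecomp x (hG.normalForm x) := by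
  refine ⟨braidLength x, fun k hk => Subtype.ext ?_, ?_⟩
  · change braidHead (braidTail^[k] x) = 1
    rw [hG.iterate_tail_eq_one hk, hG.head_one]
  · exact (hG.pathPrefix_normalForm x _).trans (hG.prefix_eq_self le_rfl)

omit hG in
theorem pathPrefix_eq_of_eq_one {ξ : GenBraid t n} {N k : ℕ}
    (h : ∀ k, N ≤ k → ξ.1 k = simpleOne t n) (hk : N ≤ k) : pathPrefix ξ k = pathPrefix ξ N := by
  induction k, hk using Nat.le_induction with
  | base => rfl
  | succ k hk ih => rw [pathPrefix_succ, ih, h k hk]; exact mul_one _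

theorem isExtDecomp_unique {x : Braid t n} {ξ η : GenBraid t n} (hξ : IsExtDecomp x ξ)
    (hη : IsExtDecomp x η) : ξ = η := by
  obtain ⟨N, hN, hx⟩ := hξ
  obtain ⟨N', hN', hx'⟩ := hη
  apply Subtype.ext
  funext i
  refine hG.eq_of_pathPrefix_eq (k := N + N' + i + 1) ?_ (by omega)
  rw [pathPrefix_eq_of_eq_one hN (by omega), pathPrefix_eq_of_eq_one hN' (by omega)]
  exact hx.trans hx'.symm

theorem toGen_eq {x : Braid t n} {ξ : GenBraid t n} (h : IsExtDecomp x ξ) : toGen x = ξ :=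
  hG.isExtDecomp_unique (Classical.epsilon_spec (p := IsExtDecomp x) ⟨ξ, h⟩) h

theorem pathPrefix_toGen (x : Braid t n) (k : ℕ) : pathPrefix (toGen x) k = braidPrefix k x := by
  rw [hG.toGen_eq (hG.isExtDecomp_normalForm x), hG.pathPrefix_normalForm]

theorem toGen_injective : Function.Injective (toGen : Braid t n → GenBraid t n) := by
  intro x y h
  rw [← hG.prefix_eq_self (x := x) (k := braidLength x + braidLength y) (by omega),
    ← hG.pathPrefix_toGen, h, hG.pathPrefix_toGen, hG.prefix_eq_self (by omega)]

/-- The prefixes of a path, seen as finite braids, approximate the path. -/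
theorem toGen_pathPrefix_apply (ξ : GenBraid t n) {i k : ℕ} (h : i < k) :
    (toGen (pathPrefix ξ k)).1 i = ξ.1 i := by
  refine hG.eq_of_pathPrefix_eq (k := k) ?_ h
  rw [hG.pathPrefix_toGen, hG.prefix_pathPrefix ξ le_rfl]

/-- A path that meets the unit is a finite braid. -/
theorem eq_toGen_of_eq_one {ξ : GenBraid t n} {k : ℕ} (h : ξ.1 k = simpleOne t n) :
    ξ = toGen (pathPrefix ξ k) := by
  refine (hG.toGen_eq ⟨k, fun j hj => ?_, rfl⟩).symm
  induction j, hj using Nat.le_induction with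
  | base => exact h
  | succ j _ ih =>
    -- Nothing but the unit can follow the unit, since every generator is simple.
    have h1 := ξ.2 j
    by_contra hne
    obtain ⟨a, ha⟩ := exists_braidOf_dvd (x := (ξ.1 (j + 1)).1) fun h' => hne (Subtype.ext h')
    refine h1 ha ?_
    rw [ih]
    change IsSimple (1 * braidOf a)
    rw [one_mul]
    exact hG.isSimple_of a

end GarsideFacts

end NormalForm

/-! ### Power series inverses of polynomials -/

section PowerSeriesInverse

theorem tsum_powerSeries_mul {b c : ℕ → ℂ} {z : ℂ} (hb : Summable fun k => ‖b k‖ * ‖z‖ ^ k)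
    (hc : Summable fun k => ‖c k‖ * ‖z‖ ^ k) :
    (∑' k, b k * z ^ k) * (∑' k, c k * z ^ k) =
      ∑' k, PowerSeries.coeff k (PowerSeries.mk b * PowerSeries.mk c) * z ^ k := by
  rw [tsum_mul_tsum_eq_tsum_sum_antidiagonal_of_summable_norm (by simpa using hb)
    (by simpa using hc)]
  refine tsum_congr fun k => ?_
  rw [PowerSeries.coeff_mul, Finset.sum_mul]
  refine Finset.sum_congr rfl fun p hp => ?_
  rw [Finset.HasAntidiagonal.mem_antidiagonal] at hp
  rw [PowerSeries.coeff_mk, PowerSeries.coeff_mk, ← hp, pow_add]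
  ring

theorem summable_powerSeries_mul {b c : ℕ → ℂ} {r : ℝ} (hr : 0 ≤ r)
    (hb : Summable fun k => ‖b k‖ * r ^ k) (hc : Summable fun k => ‖c k‖ * r ^ k) :
    Summable fun k => ‖PowerSeries.coeff k (PowerSeries.mk b * PowerSeries.mk c)‖ * r ^ k := by
  have h := summable_norm_sum_mul_antidiagonal_of_summable_norm
    (f := fun k => ‖b k‖ * r ^ k) (g := fun k => ‖c k‖ * r ^ k) hb.norm hc.norm
  refine Summable.of_nonneg_of_le (fun k => by positivity) (fun k => ?_) h.of_norm
  rw [PowerSeries.coeff_mul]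
  calc _ ≤ (∑ p ∈ Finset.HasAntidiagonal.antidiagonal k, ‖b p.1‖ * ‖c p.2‖) * r ^ k := by
        gcongr
        refine (norm_sum_le _ _).trans (Finset.sum_le_sum fun p _ => ?_)
        simp
    _ = _ := by
        rw [Finset.sum_mul]
        refine Finset.sum_congr rfl fun p hp => ?_
        rw [Finset.HasAntidiagonal.mem_antidiagonal] at hp
        rw [← hp, pow_add]
        ring

theorem tsum_polynomial_coeff (P : ℂ[X]) (z : ℂ) : ∑' k, P.coeff k * z ^ k = P.eval z := by
  rw [Polynomial.eval_eq_sum_range]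
  refine tsum_eq_sum fun k hk => ?_
  rw [P.coeff_eq_zero_of_natDegree_lt (by simpa using hk), zero_mul]

theorem summable_polynomial_coeff (P : ℂ[X]) (r : ℝ) :
    Summable fun k => ‖P.coeff k‖ * r ^ k := by
  refine summable_of_ne_finset_zero (s := Finset.range (P.natDegree + 1)) fun k hk => ?_
  rw [P.coeff_eq_zero_of_natDegree_lt (by simpa using hk), norm_zero, zero_mul]

theorem coe_eq_mk_coeff (P : ℂ[X]) : (P : PowerSeries ℂ) = PowerSeries.mk P.coeff := by
  ext k
  simp

/-- A polynomial without roots in a closed disc has an inverse power series that converges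
absolutely on this disc. -/
theorem exists_powerSeries_inverse (P : ℂ[X]) {r : ℝ} (hr : 0 ≤ r)
    (hP : ∀ z : ℂ, ‖z‖ ≤ r → P.eval z ≠ 0) :
    ∃ b : ℕ → ℂ, PowerSeries.mk b * (P : PowerSeries ℂ) = 1 ∧
      Summable fun k => ‖b k‖ * r ^ k := by
  have hP0 : P ≠ 0 := by
    rintro rfl
    exact hP 0 (by simpa using hr) (by simp)
  have hfac := IsAlgClosed.splits P
  have hprod : P = Polynomial.C P.leadingCoeff * (P.roots.map fun a => X - Polynomial.C a).prod :=
    hfac.eq_prod_roots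
  have mul : ∀ A B : ℂ[X], (∃ b : ℕ → ℂ, PowerSeries.mk b * (A : PowerSeries ℂ) = 1 ∧
      Summable fun k => ‖b k‖ * r ^ k) → (∃ b : ℕ → ℂ, PowerSeries.mk b * (B : PowerSeries ℂ) = 1 ∧
      Summable fun k => ‖b k‖ * r ^ k) → ∃ b : ℕ → ℂ,
      PowerSeries.mk b * ((A * B : ℂ[X]) : PowerSeries ℂ) = 1 ∧
      Summable fun k => ‖b k‖ * r ^ k := by
    rintro A B ⟨b, hb, hbs⟩ ⟨c, hc, hcs⟩
    refine ⟨fun k => PowerSeries.coeff k (PowerSeries.mk b * PowerSeries.mk c), ?_,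
      summable_powerSeries_mul hr hbs hcs⟩
    have : PowerSeries.mk (fun k => PowerSeries.coeff k (PowerSeries.mk b * PowerSeries.mk c)) =
      PowerSeries.mk b * PowerSeries.mk c := by ext k; simp
    rw [this, Polynomial.coe_mul]
    calc _ = (PowerSeries.mk b * (A : PowerSeries ℂ)) * (PowerSeries.mk c * (B : PowerSeries ℂ)) := by
          ring
      _ = 1 := by rw [hb, hc, one_mul]
  -- The polynomial splits; each linear factor is inverted by a geometric series of ratio `r / ‖a‖ <
  -- 1`.
  have lin : ∀ s : Multiset ℂ, (∀ a ∈ s, r < ‖a‖) → ∃ b : ℕ → ℂ,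
      PowerSeries.mk b * (((s.map fun a => X - Polynomial.C a).prod : ℂ[X]) : PowerSeries ℂ) = 1 ∧
      Summable fun k => ‖b k‖ * r ^ k := by
    intro s
    induction s using Multiset.induction_on with
    | empty =>
      intro _
      refine ⟨fun k => if k = 0 then 1 else 0, ?_, ?_⟩
      · ext k
        simp [PowerSeries.coeff_one]
      · refine summable_of_ne_finset_zero (s := {0}) fun k hk => ?_
        have hk0 : k ≠ 0 := by simpa using hk
        simp [hk0]
    | cons a s ih =>
      intro hs
      rw [Multiset.map_cons, Multiset.prod_cons]
      refine mul _ _ ?_ (ih fun c hc => hs c (Multiset.mem_cons_of_mem hc))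
      have ha := hs a (Multiset.mem_cons_self a s)
      have ha0 : a ≠ 0 := norm_pos_iff.1 (hr.trans_lt ha)
      -- The expansion `1 / (X - a) = -∑ X ^ k / a ^ (k + 1)`.
      refine ⟨fun k => -(a⁻¹) ^ (k + 1), ?_, ?_⟩
      · rw [Polynomial.coe_sub, Polynomial.coe_X, Polynomial.coe_C]
        ext k
        rw [mul_sub, map_sub, mul_comm _ (PowerSeries.C a), PowerSeries.coeff_C_mul,
          PowerSeries.coeff_mk, PowerSeries.coeff_one]
        cases k with
        | zero => simp [ha0]
        | succ k =>
          rw [PowerSeries.coeff_succ_mul_X, PowerSeries.coeff_mk, if_neg (by omega)]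
          rw [pow_succ' _ (k + 1), mul_neg, ← mul_assoc, mul_inv_cancel₀ ha0, one_mul, sub_self]
      · have : (fun k => ‖-(a⁻¹) ^ (k + 1)‖ * r ^ k) = fun k => ‖a‖⁻¹ * (r / ‖a‖) ^ k := by
          funext k
          rw [norm_neg, norm_pow, norm_inv, div_pow, pow_succ, inv_pow]
          ring
        rw [this]
        exact (summable_geometric_of_lt_one (by positivity)
          ((div_lt_one (hr.trans_lt ha)).2 ha)).mul_left _
  rw [hprod]
  refine mul _ _ ?_ (lin _ fun a ha => ?_)
  · refine ⟨fun k => if k = 0 then P.leadingCoeff⁻¹ else 0, ?_, ?_⟩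
    · have : PowerSeries.mk (fun k => if k = 0 then P.leadingCoeff⁻¹ else 0) =
          PowerSeries.C (P.leadingCoeff⁻¹) := by
        ext k
        simp [PowerSeries.coeff_C]
      rw [this, Polynomial.coe_C, ← map_mul, inv_mul_cancel₀ (leadingCoeff_ne_zero.2 hP0), map_one]
    · refine summable_of_ne_finset_zero (s := {0}) fun k hk => ?_
      have hk0 : k ≠ 0 := by simpa using hk
      simp [hk0]
  · by_contra hle
    exact hP a (not_lt.1 hle) ((Polynomial.mem_roots hP0).1 ha)

end PowerSeriesInverse

/-! ### Dominant singularities of reciprocals of polynomials -/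

section Dominant

variable {a : ℕ → ℝ} {H : ℝ[X]} {q : ℝ}

theorem powerSeries_map_eq (hser : PowerSeries.mk a * (H : PowerSeries ℝ) = 1) :
    PowerSeries.mk (fun k => (a k : ℂ)) * (H.map (algebraMap ℝ ℂ) : PowerSeries ℂ) = 1 := by
  have h := congrArg (PowerSeries.map (algebraMap ℝ ℂ)) hser
  rw [map_mul, map_one] at h
  rw [← h]
  congr 1
  ext k
  simp

theorem tsum_mul_eval_eq_one (hser : PowerSeries.mk a * (H : PowerSeries ℝ) = 1)
    (hsum : ∀ r, 0 ≤ r → r < q → Summable fun k => |a k| * r ^ k) {z : ℂ} (hz : ‖z‖ < q) :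
    (∑' k, (a k : ℂ) * z ^ k) * aeval z H = 1 := by
  have hC := powerSeries_map_eq hser
  rw [coe_eq_mk_coeff] at hC
  have hs : Summable fun k => ‖(a k : ℂ)‖ * ‖z‖ ^ k := by
    simpa using hsum ‖z‖ (norm_nonneg z) hz
  have h := tsum_powerSeries_mul hs (summable_polynomial_coeff (H.map (algebraMap ℝ ℂ)) ‖z‖)
  rw [tsum_polynomial_coeff, hC, Polynomial.eval_map_algebraMap] at h
  rw [h, tsum_eq_single 0]
  · simp
  · intro k hk
    simp [PowerSeries.coeff_one, hk]

theorem radius_le_norm_root (hser : PowerSeries.mk a * (H : PowerSeries ℝ) = 1)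
    (hsum : ∀ r, 0 ≤ r → r < q → Summable fun k => |a k| * r ^ k) (z : ℂ) (hz : aeval z H = 0) :
    q ≤ ‖z‖ := by
  by_contra hlt
  have := tsum_mul_eval_eq_one hser hsum (not_le.1 hlt)
  rw [hz, mul_zero] at this
  exact zero_ne_one this

/-- If the circle carried no root, the finitely many roots would leave a gap beyond `q`, and the
inverse of `H` would converge on a larger disc. By uniqueness of inverses of formal series that
inverse is the original series, against `hnot`. -/
theorem exists_root_norm_eq (hq : 0 < q) (hser : PowerSeries.mk a * (H : PowerSeries ℝ) = 1)
    (hsum : ∀ r, 0 ≤ r → r < q → Summable fun k => |a k| * r ^ k)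
    (hnot : ∀ r, q < r → ¬ Summable fun k => |a k| * r ^ k) :
    ∃ z : ℂ, aeval z H = 0 ∧ ‖z‖ = q := by
  by_contra! hno
  set P := H.map (algebraMap ℝ ℂ) with hP
  have hP0 : P ≠ 0 := by
    rintro h
    have := powerSeries_map_eq hser
    rw [← hP, h] at this
    simp at this
  have heval : ∀ z : ℂ, P.eval z = aeval z H := fun z => by
    rw [hP, Polynomial.eval_map_algebraMap]
  have hroots : ∀ z ∈ P.roots.toFinset, q < ‖z‖ := by
    intro z hz
    rw [Multiset.mem_toFinset, Polynomial.mem_roots hP0, Polynomial.IsRoot, heval] at hz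
    exact lt_of_le_of_ne (radius_le_norm_root hser hsum z hz) (Ne.symm (hno z hz))
  obtain ⟨r, hqr, hr⟩ : ∃ r, q < r ∧ ∀ z ∈ P.roots.toFinset, r < ‖z‖ := by
    have h : ∀ᶠ r in 𝓝[>] q, ∀ z ∈ P.roots.toFinset, r < ‖z‖ := by
      rw [Filter.eventually_all_finset]
      exact fun z hz => nhdsWithin_le_nhds (eventually_lt_nhds (hroots z hz))
    obtain ⟨r, hr⟩ := (h.and self_mem_nhdsWithin).exists
    exact ⟨r, hr.2, hr.1⟩
  obtain ⟨b, hb, hbs⟩ := exists_powerSeries_inverse P (hq.le.trans hqr.le) (fun z hz h0 => by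
    have := hr z (by rw [Multiset.mem_toFinset, Polynomial.mem_roots hP0]; exact h0)
    linarith)
  have hab : PowerSeries.mk b = PowerSeries.mk (fun k => (a k : ℂ)) := by
    calc PowerSeries.mk b = PowerSeries.mk b * (PowerSeries.mk (fun k => (a k : ℂ)) * P) := by
          rw [powerSeries_map_eq hser, mul_one]
      _ = (PowerSeries.mk b * P) * PowerSeries.mk (fun k => (a k : ℂ)) := by ring
      _ = _ := by rw [hb, one_mul]
  refine hnot r hqr ?_
  convert hbs using 2 with k
  have := congrArg (PowerSeries.coeff k) hab
  rw [PowerSeries.coeff_mk, PowerSeries.coeff_mk] at this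
  rw [this]
  simp

/-- The radius of convergence of a series with nonnegative coefficients whose reciprocal is a
polynomial is a root of this polynomial. -/
theorem isRoot_radius (hq : 0 < q) (ha : ∀ k, 0 ≤ a k)
    (hser : PowerSeries.mk a * (H : PowerSeries ℝ) = 1)
    (hsum : ∀ r, 0 ≤ r → r < q → Summable fun k => |a k| * r ^ k)
    (hnot : ∀ r, q < r → ¬ Summable fun k => |a k| * r ^ k) : H.IsRoot q := by
  obtain ⟨z, hz, hzq⟩ := exists_root_norm_eq hq hser hsum hnot
  -- Pringsheim's argument: with nonnegative coefficients the sum of the series at `s z` is at most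
  -- its sum at `s q` in modulus. Passing to reciprocals reverses the inequality, and letting `s`
  -- tend to `1` transfers the zero from `z` to `q`.
  have key : ∀ s : ℝ, s ∈ Set.Ioo (0 : ℝ) 1 →
      ‖aeval ((s * q : ℝ) : ℂ) H‖ ≤ ‖aeval ((s : ℂ) * z) H‖ := by
    intro s hs
    have h1 : ‖((s * q : ℝ) : ℂ)‖ < q := by
      rw [Complex.norm_real, Real.norm_of_nonneg (by nlinarith [hs.1])]
      nlinarith [hs.2]
    have h2 : ‖(s : ℂ) * z‖ = s * q := by
      rw [norm_mul, Complex.norm_real, Real.norm_of_nonneg hs.1.le, hzq]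
    have h2' : ‖(s : ℂ) * z‖ < q := by rw [h2]; nlinarith [hs.2]
    have e1 := congrArg norm (tsum_mul_eval_eq_one hser hsum h1)
    have e2 := congrArg norm (tsum_mul_eval_eq_one hser hsum h2')
    rw [norm_mul, norm_one] at e1 e2
    have hle : ‖∑' k, (a k : ℂ) * ((s : ℂ) * z) ^ k‖ ≤
        ‖∑' k, (a k : ℂ) * ((s * q : ℝ) : ℂ) ^ k‖ := by
      have hs' : Summable fun k => a k * (s * q) ^ k := by
        simpa [abs_of_nonneg (ha _)] using hsum (s * q) (by nlinarith [hs.1]) (by nlinarith [hs.2])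
      have h3 : ∑' k, (a k : ℂ) * ((s * q : ℝ) : ℂ) ^ k = ((∑' k, a k * (s * q) ^ k : ℝ) : ℂ) := by
        rw [Complex.ofReal_tsum]
        exact tsum_congr fun k => by push_cast; ring
      have h4 : ∀ k, ‖(a k : ℂ) * ((s : ℂ) * z) ^ k‖ = a k * (s * q) ^ k := fun k => by
        rw [norm_mul, norm_pow, h2, Complex.norm_real, Real.norm_of_nonneg (ha k)]
      rw [h3, Complex.norm_real, Real.norm_of_nonneg
        (tsum_nonneg fun k => by have := ha k; have := hs.1; positivity)]
      refine (norm_tsum_le_tsum_norm (by simpa only [h4] using hs')).trans_eq ?_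
      simp only [h4]
    have hpos : 0 < ‖aeval ((s * q : ℝ) : ℂ) H‖ := by
      rw [norm_pos_iff]
      intro h0
      rw [h0] at e1
      simp at e1
    have hpos' : 0 < ‖aeval ((s : ℂ) * z) H‖ := by
      rw [norm_pos_iff]
      intro h0
      rw [h0] at e2
      simp at e2
    set A := ‖∑' k, (a k : ℂ) * ((s : ℂ) * z) ^ k‖
    set B := ‖∑' k, (a k : ℂ) * ((s * q : ℝ) : ℂ) ^ k‖
    have hA : A = 1 / ‖aeval ((s : ℂ) * z) H‖ := by rw [eq_div_iff hpos'.ne']; exact e2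
    have hB : B = 1 / ‖aeval ((s * q : ℝ) : ℂ) H‖ := by rw [eq_div_iff hpos.ne']; exact e1
    rw [hA, hB, one_div_le_one_div hpos' hpos] at hle
    exact hle
  have t1 : Tendsto (fun s : ℝ => ‖aeval ((s * q : ℝ) : ℂ) H‖) (𝓝[<] 1)
      (𝓝 ‖aeval ((1 * q : ℝ) : ℂ) H‖) := by
    have : Continuous fun s : ℝ => ‖aeval ((s * q : ℝ) : ℂ) H‖ := by fun_prop
    exact (this.tendsto 1).mono_left nhdsWithin_le_nhds
  have t2 : Tendsto (fun s : ℝ => ‖aeval ((s : ℂ) * z) H‖) (𝓝[<] 1)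
      (𝓝 ‖aeval (((1 : ℝ) : ℂ) * z) H‖) := by
    have : Continuous fun s : ℝ => ‖aeval ((s : ℂ) * z) H‖ := by fun_prop
    exact (this.tendsto 1).mono_left nhdsWithin_le_nhds
  have hle := le_of_tendsto_of_tendsto t1 t2 (by
    filter_upwards [Ioo_mem_nhdsLT (zero_lt_one' ℝ)] with s hs using key s hs)
  rw [Complex.ofReal_one, one_mul, one_mul, hz, norm_zero, norm_le_zero_iff] at hle
  rw [Polynomial.IsRoot]
  have h5 : aeval ((q : ℝ) : ℂ) H = ((H.eval q : ℝ) : ℂ) := by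
    have := Polynomial.aeval_algebraMap_apply ℂ q H
    rw [Polynomial.coe_aeval_eq_eval] at this
    exact this
  rw [h5] at hle
  exact_mod_cast hle

/-- If moreover the polynomial vanishes, on the closed disc, only at `q` and to first order,
then the coefficients are equivalent to a multiple of `q⁻¹ ^ k`. -/
theorem exists_tendsto_coeff (hq : 0 < q) (ha : ∀ k, 0 ≤ a k)
    (hser : PowerSeries.mk a * (H : PowerSeries ℝ) = 1)
    (hsum : ∀ r, 0 ≤ r → r < q → Summable fun k => |a k| * r ^ k)
    (hnot : ∀ r, q < r → ¬ Summable fun k => |a k| * r ^ k) (C : ℝ)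
    (hC : ∀ z : ℂ, ‖z‖ < q → ‖1 - z‖ - (1 - q) ≤ C * ‖aeval z H‖) :
    ∃ L, 0 < L ∧ Tendsto (fun k => a k * q ^ k) atTop (𝓝 L) := by
  have hroot : H.IsRoot q := isRoot_radius hq ha hser hsum hnot
  obtain ⟨K, hK⟩ := Polynomial.dvd_iff_isRoot.2 hroot
  -- The bound extends to the closed disc by radial limits.
  have hClosed : ∀ z : ℂ, ‖z‖ ≤ q → ‖1 - z‖ - (1 - q) ≤ C * ‖aeval z H‖ := by
    intro z hz
    have t1 : Tendsto (fun s : ℝ => ‖1 - (s : ℂ) * z‖ - (1 - q)) (𝓝[<] 1)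
        (𝓝 (‖1 - ((1 : ℝ) : ℂ) * z‖ - (1 - q))) := by
      have : Continuous fun s : ℝ => ‖1 - (s : ℂ) * z‖ - (1 - q) := by fun_prop
      exact (this.tendsto 1).mono_left nhdsWithin_le_nhds
    have t2 : Tendsto (fun s : ℝ => C * ‖aeval ((s : ℂ) * z) H‖) (𝓝[<] 1)
        (𝓝 (C * ‖aeval (((1 : ℝ) : ℂ) * z) H‖)) := by
      have : Continuous fun s : ℝ => C * ‖aeval ((s : ℂ) * z) H‖ := by fun_prop
      exact (this.tendsto 1).mono_left nhdsWithin_le_nhds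
    have := le_of_tendsto_of_tendsto t1 t2 (by
      filter_upwards [Ioo_mem_nhdsLT (zero_lt_one' ℝ)] with s hs
      refine hC _ ?_
      rw [norm_mul, Complex.norm_real, Real.norm_of_nonneg hs.1.le]
      nlinarith [hs.1, hs.2, norm_nonneg z])
    simpa using this
  -- The cofactor `K = H / (X - q)` has no root in the closed disc: such a root would have to be
  -- `q`, which would then be a double root of `H`.
  have hKroot : ∀ z : ℂ, ‖z‖ ≤ q → (K.map (algebraMap ℝ ℂ)).eval z ≠ 0 := by
    intro z hz hKz
    rw [Polynomial.eval_map_algebraMap] at hKz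
    have hHz : aeval z H = 0 := by rw [hK, map_mul, hKz, mul_zero]
    have h1 := hClosed z hz
    have h2 := radius_le_norm_root hser hsum z hHz
    have h3 : ‖z‖ = q := le_antisymm hz h2
    rw [hHz, norm_zero, mul_zero] at h1
    -- At a root, `‖1 - z‖ ≤ 1 - q` while `‖z‖ = q`: equality in the triangle inequality forces `z =
    -- q`.
    have hzq : z = (q : ℂ) := by
      have e1 : ‖1 - z‖ ^ 2 = (1 - z.re) ^ 2 + z.im ^ 2 := by
        rw [← Complex.normSq_eq_norm_sq, Complex.normSq_apply]
        simp
        ring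
      have e2 : ‖z‖ ^ 2 = z.re ^ 2 + z.im ^ 2 := by
        rw [← Complex.normSq_eq_norm_sq, Complex.normSq_apply]
        ring
      rw [h3] at e2
      have h4 : ‖1 - z‖ ^ 2 ≤ (1 - q) ^ 2 :=
        pow_le_pow_left₀ (norm_nonneg _) (by linarith) 2
      have h5 : q ≤ z.re := by nlinarith
      have h6 : z.im ^ 2 ≤ 0 := by nlinarith
      have h7 : z.im = 0 := by nlinarith [sq_nonneg z.im]
      have h8 : z.re = q := by nlinarith [sq_nonneg (z.re - q)]
      exact Complex.ext (by simpa using h8) (by simpa using h7)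
    have hKq : K.IsRoot q := by
      rw [hzq] at hKz
      have h5 : aeval ((q : ℝ) : ℂ) K = ((K.eval q : ℝ) : ℂ) := by
        have := Polynomial.aeval_algebraMap_apply ℂ q K
        rw [Polynomial.coe_aeval_eq_eval] at this
        exact this
      rw [h5] at hKz
      exact_mod_cast hKz
    obtain ⟨K₂, hK₂⟩ := Polynomial.dvd_iff_isRoot.2 hKq
    -- For real `s < q` the left side of the bound is at least `q - s`, whereas a double root makes
    -- the right side of order `(q - s) ^ 2`. Dividing by `q - s` and letting `s` tend to `q` gives
    -- `1 ≤ 0`.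
    have hs : ∀ s ∈ Set.Ioo 0 q, 1 ≤ C * ((q - s) * ‖aeval (s : ℂ) K₂‖) := by
      intro s hs
      have h9 := hClosed (s : ℂ) (by
        rw [Complex.norm_real, Real.norm_of_nonneg hs.1.le]
        exact hs.2.le)
      have h10 : ‖aeval (s : ℂ) H‖ = (q - s) * ((q - s) * ‖aeval (s : ℂ) K₂‖) := by
        have : ‖(s : ℂ) - (q : ℂ)‖ = q - s := by
          rw [← Complex.ofReal_sub, Complex.norm_real, Real.norm_of_nonpos (by linarith [hs.2])]
          ring
        rw [hK, hK₂]
        simp [this]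
      rw [h10] at h9
      have h11 : q - s ≤ ‖1 - (s : ℂ)‖ - (1 - q) := by
        have : 1 - s ≤ ‖1 - (s : ℂ)‖ := by
          rw [← Complex.ofReal_one, ← Complex.ofReal_sub, Complex.norm_real]
          exact le_abs_self _
        linarith
      have hpos : 0 < q - s := by linarith [hs.2]
      have h12 : (q - s) * 1 ≤ (q - s) * (C * ((q - s) * ‖aeval (s : ℂ) K₂‖)) := by
        linarith
      exact le_of_mul_le_mul_left h12 hpos
    have t1 : Tendsto (fun s : ℝ => C * ((q - s) * ‖aeval (s : ℂ) K₂‖)) (𝓝[<] q)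
        (𝓝 (C * ((q - q) * ‖aeval (q : ℂ) K₂‖))) := by
      have : Continuous fun s : ℝ => C * ((q - s) * ‖aeval (s : ℂ) K₂‖) := by fun_prop
      exact (this.tendsto q).mono_left nhdsWithin_le_nhds
    have := ge_of_tendsto t1 (by filter_upwards [Ioo_mem_nhdsLT hq] with s hs' using hs s hs')
    rw [sub_self, zero_mul, mul_zero] at this
    linarith
  obtain ⟨b, hb, hbs⟩ := exists_powerSeries_inverse _ hq.le hKroot
  have hab : PowerSeries.mk b =
      PowerSeries.mk (fun k => (a k : ℂ)) * (PowerSeries.X - PowerSeries.C (q : ℂ)) := by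
    have h1 := powerSeries_map_eq hser
    rw [hK, Polynomial.map_mul, Polynomial.coe_mul, Polynomial.map_sub, Polynomial.map_X,
      Polynomial.map_C, Polynomial.coe_sub, Polynomial.coe_X, Polynomial.coe_C] at h1
    calc PowerSeries.mk b = PowerSeries.mk b * 1 := (mul_one _).symm
      _ = PowerSeries.mk (fun k => (a k : ℂ)) * (PowerSeries.X - PowerSeries.C (q : ℂ)) *
          (PowerSeries.mk b * (K.map (algebraMap ℝ ℂ) : PowerSeries ℂ)) := by
          rw [← h1]
          simp only [Complex.coe_algebraMap]
          ring
      _ = _ := by rw [hb, mul_one]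
  -- The coefficients of `1 / K` are `b k = a (k - 1) - q * a k`, so the partial sums at `q`
  -- telescope.
  have hpart : ∀ k, ∑ j ∈ Finset.range (k + 1), b j * (q : ℂ) ^ j =
      -(q : ℂ) * ((a k * q ^ k : ℝ) : ℂ) := by
    have hcoeff : ∀ k, b k = PowerSeries.coeff k (PowerSeries.mk (fun k => (a k : ℂ)) *
        PowerSeries.X) - a k * q := fun k => by
      have := congrArg (PowerSeries.coeff k) hab
      rw [PowerSeries.coeff_mk, mul_sub, map_sub, PowerSeries.coeff_mul_C,
        PowerSeries.coeff_mk] at this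
      exact this
    intro k
    induction k with
    | zero =>
      rw [Finset.sum_range_one, hcoeff, PowerSeries.coeff_zero_mul_X]
      push_cast
      ring
    | succ k ih =>
      rw [Finset.sum_range_succ, ih, hcoeff (k + 1), PowerSeries.coeff_succ_mul_X,
        PowerSeries.coeff_mk]
      push_cast
      ring
  have hbs' : Summable fun k => b k * (q : ℂ) ^ k := by
    refine Summable.of_norm ?_
    simpa [abs_of_pos hq] using hbs
  have hlim : Tendsto (fun k => -(q : ℂ) * ((a k * q ^ k : ℝ) : ℂ)) atTop
      (𝓝 (∑' k, b k * (q : ℂ) ^ k)) := by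
    have := (hbs'.hasSum.tendsto_sum_nat).comp (tendsto_add_atTop_nat 1)
    refine this.congr fun k => ?_
    exact hpart k
  -- The sum is `1 / K(q)`, which makes the limit nonzero.
  have hne : ∑' k, b k * (q : ℂ) ^ k ≠ 0 := by
    intro h0
    have hnq : ‖(q : ℂ)‖ = q := by rw [Complex.norm_real, Real.norm_of_nonneg hq.le]
    have h := tsum_powerSeries_mul (b := b) (z := (q : ℂ)) (by rw [hnq]; exact hbs)
      (summable_polynomial_coeff (K.map (algebraMap ℝ ℂ)) ‖(q : ℂ)‖)
    rw [h0, zero_mul, ← coe_eq_mk_coeff, hb, tsum_eq_single 0] at h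
    · simp at h
    · intro k hk
      simp [PowerSeries.coeff_one, hk]
  refine ⟨‖∑' k, b k * (q : ℂ) ^ k‖ / q, by positivity, ?_⟩
  refine (hlim.norm.div_const q).congr fun k => ?_
  rw [norm_mul, norm_neg, Complex.norm_real, Complex.norm_real, Real.norm_of_nonneg hq.le,
    Real.norm_of_nonneg (mul_nonneg (ha k) (pow_nonneg hq.le k))]
  field_simp

end Dominant

/-! ### The growth series -/

section Growth

variable {t : BraidType} {n : ℕ}

/-- The number of braids of length `k`. -/
noncomputable def braidCount (t : BraidType) (n k : ℕ) : ℕ := (braidSphere t n k).ncard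

/-- The braids of length `k`, as a finite set. -/
noncomputable def sphereFinset (t : BraidType) (n k : ℕ) : Finset (Braid t n) :=
  (braidSphere_finite t n k).toFinset

theorem mem_sphereFinset {k : ℕ} {x : Braid t n} : x ∈ sphereFinset t n k ↔ braidLength x = k := by
  rw [sphereFinset, Set.Finite.mem_toFinset]
  rfl

theorem card_sphereFinset (k : ℕ) : (sphereFinset t n k).card = braidCount t n k :=
  (Set.ncard_eq_toFinset_card _ _).symm

theorem braidCount_pos (t : BraidType) (hn : 2 ≤ n) (k : ℕ) : 0 < braidCount t n k := by
  rw [braidCount, Set.ncard_pos (braidSphere_finite t n k)]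
  exact braidSphere_nonempty t hn k

theorem braidCount_zero : braidCount t n 0 = 1 := by
  rw [← card_sphereFinset, Finset.card_eq_one]
  refine ⟨1, ?_⟩
  ext x
  rw [mem_sphereFinset, Finset.mem_singleton]
  exact ⟨eq_one_of_braidLength, fun h => h ▸ braidLength_one⟩

theorem braidCount_le_pow (k : ℕ) : braidCount t n k ≤ Fintype.card (BraidGen t n) ^ k := by
  classical
  induction k with
  | zero => rw [braidCount_zero, pow_zero]
  | succ k ih =>
    have hsub : sphereFinset t n (k + 1) ⊆
        Finset.univ.biUnion fun a => (sphereFinset t n k).image fun x => braidOf a * x := by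
      intro x hx
      rw [mem_sphereFinset] at hx
      rcases braid_cases x with rfl | ⟨a, y, rfl⟩
      · rw [braidLength_one] at hx
        omega
      · rw [braidLength_mul, braidLength_of] at hx
        rw [Finset.mem_biUnion]
        exact ⟨a, Finset.mem_univ _, Finset.mem_image_of_mem _ (mem_sphereFinset.2 (by omega))⟩
    rw [← card_sphereFinset]
    calc _ ≤ _ := Finset.card_le_card hsub
      _ ≤ Fintype.card (BraidGen t n) * braidCount t n k :=
        Finset.card_biUnion_le_card_mul _ _ _ fun a _ =>
          Finset.card_image_le.trans_eq (card_sphereFinset k)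
      _ ≤ _ := by rw [pow_succ']; gcongr

theorem GarsideFacts.card_filter_dvd (hG : GarsideFacts t n) (d : Braid t n) (k : ℕ)
    [DecidablePred fun x : Braid t n => d ∣ x] :
    ((sphereFinset t n k).filter fun x => d ∣ x).card =
      if braidLength d ≤ k then braidCount t n (k - braidLength d) else 0 := by
  classical
  split_ifs with h
  · rw [← card_sphereFinset, ← Finset.card_image_of_injective (sphereFinset t n _)
      (f := fun x => d * x) (fun x y h => hG.mul_left_cancel d x y h)]
    congr 1
    ext x
    simp only [Finset.mem_filter, Finset.mem_image, mem_sphereFinset]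
    constructor
    · rintro ⟨hx, y, rfl⟩
      rw [braidLength_mul] at hx
      exact ⟨y, by omega, rfl⟩
    · rintro ⟨y, hy, rfl⟩
      exact ⟨by rw [braidLength_mul]; omega, dvd_mul_right _ _⟩
  · rw [Finset.card_eq_zero, Finset.filter_eq_empty_iff]
    intro x hx hd
    have := braidLength_le_of_dvd hd
    rw [mem_sphereFinset.1 hx] at this
    omega

/-- After exchanging the sums, a braid `x` is counted with weight `∑ (-1) ^ |X|` over all sets `X`
of generators dividing it. This vanishes unless no generator divides `x`, that is, unless `x = 1`.
-/
theorem GarsideFacts.moebius_sum (hG : GarsideFacts t n) (k : ℕ) :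
    ∑ X : Finset (BraidGen t n), (-1 : ℤ) ^ X.card *
      (if braidLength (deltaOf X) ≤ k then (braidCount t n (k - braidLength (deltaOf X)) : ℤ)
        else 0) = if k = 0 then 1 else 0 := by
  classical
  have h1 : ∀ X : Finset (BraidGen t n), (if braidLength (deltaOf X) ≤ k then
      (braidCount t n (k - braidLength (deltaOf X)) : ℤ) else 0) =
      ∑ x ∈ sphereFinset t n k, if deltaOf X ∣ x then 1 else 0 := by
    intro X
    rw [Finset.sum_boole, hG.card_filter_dvd]
    split_ifs <;> simp
  simp_rw [h1, Finset.mul_sum]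
  rw [Finset.sum_comm]
  have h2 : ∀ x ∈ sphereFinset t n k, ∑ X : Finset (BraidGen t n), (-1 : ℤ) ^ X.card *
      (if deltaOf X ∣ x then 1 else 0) = if k = 0 then 1 else 0 := by
    intro x hx
    have h3 : ∀ X : Finset (BraidGen t n), deltaOf X ∣ x ↔
        X ∈ (Finset.univ.filter fun a => braidOf a ∣ x).powerset := by
      intro X
      rw [hG.deltaOf_dvd_iff, Finset.mem_powerset]
      exact ⟨fun h a ha => by simp [h a ha], fun h a ha => by simpa using h ha⟩
    simp_rw [mul_ite, mul_one, mul_zero, h3]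
    rw [Finset.sum_ite_mem, Finset.univ_inter, Finset.sum_powerset_neg_one_pow_card]
    rw [mem_sphereFinset] at hx
    congr 1
    rw [Finset.filter_eq_empty_iff, eq_iff_iff, ← hx]
    constructor
    · intro h
      by_contra h0
      obtain ⟨a, ha⟩ := exists_braidOf_dvd (x := x) (by rintro rfl; exact h0 braidLength_one)
      exact h (Finset.mem_univ a) ha
    · intro h a _ ha
      have := braidLength_le_of_dvd ha
      rw [h, braidLength_of] at this
      omega
  rw [Finset.sum_congr rfl h2, Finset.sum_const, card_sphereFinset]
  split_ifs with h0
  · rw [h0, braidCount_zero]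
    simp
  · simp

theorem GarsideFacts.growthSeries_mul (hG : GarsideFacts t n) :
    PowerSeries.mk (fun k => (braidCount t n k : ℝ)) * (moebiusPoly t n : PowerSeries ℝ) = 1 := by
  ext k
  have hcoe : (moebiusPoly t n : PowerSeries ℝ) =
      ∑ X : Finset (BraidGen t n), PowerSeries.C ((-1 : ℝ) ^ X.card) *
        PowerSeries.X ^ braidLength (deltaOf X) := by
    rw [moebiusPoly]
    rw [← Polynomial.coeToPowerSeries.ringHom_apply, map_sum]
    refine Finset.sum_congr rfl fun X _ => ?_
    simp [map_mul, map_pow]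
  rw [hcoe, Finset.mul_sum, map_sum, PowerSeries.coeff_one]
  have h := hG.moebius_sum k
  have h' := congrArg (fun m : ℤ => (m : ℝ)) h
  push_cast at h'
  rw [← h']
  refine Finset.sum_congr rfl fun X _ => ?_
  rw [mul_left_comm, PowerSeries.coeff_C_mul, PowerSeries.coeff_mul_X_pow', PowerSeries.coeff_mk]

/-- Every coefficient of the series is at least one. -/
theorem radius_growth_le_one (t : BraidType) (hn : 2 ≤ n) :
    (FormalMultilinearSeries.ofScalars ℝ
      (fun k => ((braidSphere t n k).ncard : ℝ))).radius ≤ 1 := by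
  by_contra! h
  have h1 := FormalMultilinearSeries.summable_norm_mul_pow _ (r := 1) (by simpa using h)
  simp only [FormalMultilinearSeries.ofScalars_norm, NNReal.coe_one, one_pow, mul_one] at h1
  have h2 := h1.tendsto_atTop_zero
  have h3 : (1 : ℝ) ≤ 0 := ge_of_tendsto h2 (Eventually.of_forall fun k => by
    have : 1 ≤ (braidSphere t n k).ncard := braidCount_pos t hn k
    simpa using this)
  linarith

theorem radius_growth_pos (t : BraidType) (n : ℕ) :
    0 < (FormalMultilinearSeries.ofScalars ℝ
      (fun k => ((braidSphere t n k).ncard : ℝ))).radius := by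
  set c := Fintype.card (BraidGen t n)
  -- There are at most `c ^ k` braids of length `k`; the summand `1` keeps the inverse nonzero even
  -- if `c = 0`.
  have h := FormalMultilinearSeries.le_radius_of_bound (FormalMultilinearSeries.ofScalars ℝ
      (fun k => ((braidSphere t n k).ncard : ℝ))) 1 (r := ((c : NNReal) + 1)⁻¹) (fun k => by
    rw [FormalMultilinearSeries.ofScalars_norm]
    have h1 : ((braidSphere t n k).ncard : ℝ) ≤ (c : ℝ) ^ k := by
      exact_mod_cast braidCount_le_pow (t := t) (n := n) k
    push_cast
    rw [Real.norm_of_nonneg (by positivity), inv_pow, mul_inv_le_iff₀ (by positivity), one_mul]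
    exact h1.trans (pow_le_pow_left₀ (by positivity) (by linarith) k))
  refine lt_of_lt_of_le ?_ h
  simp

theorem braidRadius_pos (t : BraidType) (hn : 2 ≤ n) : 0 < braidRadius t n :=
  ENNReal.toReal_pos (radius_growth_pos t n).ne'
    ((radius_growth_le_one t hn).trans_lt ENNReal.one_lt_top).ne

theorem braidRadius_le_one (t : BraidType) (hn : 2 ≤ n) : braidRadius t n ≤ 1 := by
  have := ENNReal.toReal_mono ENNReal.one_ne_top (radius_growth_le_one t hn)
  simpa [braidRadius] using this

theorem summable_braidCount (t : BraidType) (hn : 2 ≤ n) (r : ℝ) (hr : 0 ≤ r)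
    (h : r < braidRadius t n) : Summable fun k => |(braidCount t n k : ℝ)| * r ^ k := by
  lift r to NNReal using hr
  have h1 := FormalMultilinearSeries.summable_norm_mul_pow (FormalMultilinearSeries.ofScalars ℝ
      (fun k => ((braidSphere t n k).ncard : ℝ))) (r := r) (by
    rw [← ENNReal.toReal_lt_toReal ENNReal.coe_ne_top
      ((radius_growth_le_one t hn).trans_lt ENNReal.one_lt_top).ne]
    exact h)
  simp only [FormalMultilinearSeries.ofScalars_norm] at h1
  exact h1

theorem not_summable_braidCount (t : BraidType) (hn : 2 ≤ n) (r : ℝ) (h : braidRadius t n < r) :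
    ¬ Summable fun k => |(braidCount t n k : ℝ)| * r ^ k := by
  intro hs
  lift r to NNReal using (braidRadius_pos t hn).le.trans h.le
  have h1 := FormalMultilinearSeries.le_radius_of_summable_norm
    (FormalMultilinearSeries.ofScalars ℝ (fun k => ((braidSphere t n k).ncard : ℝ))) (r := r) (by
      simp only [FormalMultilinearSeries.ofScalars_norm]
      exact hs)
  have h2 := ENNReal.toReal_mono ((radius_growth_le_one t hn).trans_lt ENNReal.one_lt_top).ne h1
  exact absurd h2 (not_le.2 h)

end Growth

/-! ### Path counting in strongly connected weighted graphs -/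

section Perron

variable {V : Type*} [Fintype V] [DecidableEq V] {M : V → V → ℝ} {σ : V}

/-- A nonnegative matrix, with the column of `σ` deleted. -/
def deletedMul (M : V → V → ℝ) (σ : V) (u : V → ℝ) (x : V) : ℝ :=
  ∑ y ∈ Finset.univ.erase σ, M x y * u y

theorem sum_eq_deletedMul_add (M : V → V → ℝ) (σ : V) (u : V → ℝ) (x : V) :
    ∑ y, M x y * u y = M x σ * u σ + deletedMul M σ u x :=
  (Finset.add_sum_erase _ _ (Finset.mem_univ σ)).symm

theorem deletedMul_nonneg (hM : ∀ x y, 0 ≤ M x y) {u : V → ℝ} (hu : ∀ x, 0 ≤ u x) (x : V) :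
    0 ≤ deletedMul M σ u x :=
  Finset.sum_nonneg fun y _ => mul_nonneg (hM x y) (hu y)

omit [DecidableEq V] in
-- Positivity holds somewhere and propagates backwards along paths through the stationarity
-- equation.
theorem pos_of_stationary (hM : ∀ x y, 0 ≤ M x y)
    (hconn : ∀ x y, Relation.ReflTransGen (fun a b => 0 < M a b) x y) {f : V → ℝ}
    (hf : ∀ x, 0 ≤ f x) (hsum : 0 < ∑ x, f x) (hfM : ∀ x, f x = ∑ y, M x y * f y) (x : V) :
    0 < f x := by
  obtain ⟨y, -, hy⟩ := Finset.exists_lt_of_sum_lt (s := Finset.univ) (f := fun _ => (0 : ℝ))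
    (g := f) (by simpa using hsum)
  induction hconn x y using Relation.ReflTransGen.head_induction_on with
  | refl => exact hy
  | @head a b h _ ih =>
    rw [hfM a]
    exact Finset.sum_pos' (fun c _ => mul_nonneg (hM a c) (hf c))
      ⟨b, Finset.mem_univ b, mul_pos h ih⟩

/-- A strict supersolution for the matrix with one deleted column. -/
theorem exists_strict_supersolution (hM : ∀ x y, 0 ≤ M x y)
    (hconn : ∀ x y, Relation.ReflTransGen (fun a b => 0 < M a b) x y) (hσ : 0 < M σ σ)
    {f : V → ℝ} (hf : ∀ x, 0 < f x) (hfM : ∀ x, f x = ∑ y, M x y * f y) :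
    ∃ v : V → ℝ, (∀ x, 0 ≤ v x) ∧ ∀ x, 1 + deletedMul M σ v x ≤ v x := by
  -- For each `x`, a supersolution that is strict at `x`. The stationary vector is strict at the
  -- predecessors of `σ`, where the deleted column removes a positive amount; applying the deleted
  -- matrix moves strictness one step back along a path.
  have hloc : ∀ x, ∃ v : V → ℝ, (∀ y, 0 ≤ v y) ∧ (∀ y, deletedMul M σ v y ≤ v y) ∧
      deletedMul M σ v x < v x := by
    have base : ∀ x, 0 < M x σ → ∃ v : V → ℝ, (∀ y, 0 ≤ v y) ∧
        (∀ y, deletedMul M σ v y ≤ v y) ∧ deletedMul M σ v x < v x := by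
      intro x hx
      refine ⟨f, fun y => (hf y).le, fun y => ?_, ?_⟩
      · rw [hfM y, sum_eq_deletedMul_add M σ]
        have := mul_nonneg (hM y σ) (hf σ).le
        linarith
      · rw [hfM x, sum_eq_deletedMul_add M σ]
        have := mul_pos hx (hf σ)
        linarith
    intro x
    induction hconn x σ using Relation.ReflTransGen.head_induction_on with
    | refl => exact base σ hσ
    | @head a b h _ ih =>
      by_cases hb : b = σ
      · exact base a (hb ▸ h)
      obtain ⟨v, hv0, hv, hvb⟩ := ih
      refine ⟨deletedMul M σ v, deletedMul_nonneg hM hv0, fun y => ?_, ?_⟩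
      · exact Finset.sum_le_sum fun c _ => mul_le_mul_of_nonneg_left (hv c) (hM y c)
      · exact Finset.sum_lt_sum (fun c _ => mul_le_mul_of_nonneg_left (hv c) (hM a c))
          ⟨b, by simp [hb], mul_lt_mul_of_pos_left hvb h⟩
  choose v hv0 hv hvx using hloc
  have hlin : ∀ x, deletedMul M σ (fun y => ∑ c, v c y) x = ∑ c, deletedMul M σ (v c) x := by
    intro x
    simp only [deletedMul, Finset.mul_sum]
    exact Finset.sum_comm
  have hgap : ∀ x, 0 < (∑ c, v c x) - deletedMul M σ (fun y => ∑ c, v c y) x := by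
    intro x
    rw [hlin, sub_pos]
    exact Finset.sum_lt_sum (fun c _ => hv c x) ⟨x, Finset.mem_univ x, hvx x⟩
  set g : V → ℝ := fun x => (∑ c, v c x) - deletedMul M σ (fun y => ∑ c, v c y) x with hg
  -- The sum of these supersolutions is strict everywhere, with gap `g`; scaling by `∑ 1 / g` makes
  -- every gap at least `1`.
  refine ⟨fun x => (∑ c, (g c)⁻¹) * ∑ c, v c x, fun x => ?_, fun x => ?_⟩
  · exact mul_nonneg (Finset.sum_nonneg fun c _ => (inv_pos.2 (hgap c)).le)
      (Finset.sum_nonneg fun c _ => hv0 c x)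
  · have h1 : deletedMul M σ (fun x => (∑ c, (g c)⁻¹) * ∑ c, v c x) x =
        (∑ c, (g c)⁻¹) * deletedMul M σ (fun y => ∑ c, v c y) x := by
      simp only [deletedMul, Finset.mul_sum]
      refine Finset.sum_congr rfl fun y _ => Finset.sum_congr rfl fun c _ => ?_
      ring
    have h2 : (g x)⁻¹ ≤ ∑ c, (g c)⁻¹ :=
      Finset.single_le_sum (f := fun c => (g c)⁻¹) (fun c _ => (inv_pos.2 (hgap c)).le)
        (Finset.mem_univ x)
    have h3 : 1 ≤ (∑ c, (g c)⁻¹) * g x := by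
      calc 1 = (g x)⁻¹ * g x := (inv_mul_cancel₀ (hgap x).ne').symm
        _ ≤ _ := mul_le_mul_of_nonneg_right h2 (hgap x).le
    rw [h1]
    have h4 : (∑ c, (g c)⁻¹) * g x = (∑ c, (g c)⁻¹) * (∑ c, v c x) -
        (∑ c, (g c)⁻¹) * deletedMul M σ (fun y => ∑ c, v c y) x := by
      rw [← mul_sub]
    linarith

/-- The maximum principle. -/
theorem nonpos_of_le_deletedMul (hM : ∀ x y, 0 ≤ M x y) {v : V → ℝ}
    (hv0 : ∀ x, 0 ≤ v x) (hv : ∀ x, 1 + deletedMul M σ v x ≤ v x) {u : V → ℝ}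
    (hu : ∀ x, u x ≤ deletedMul M σ u x) (x : V) : u x ≤ 0 := by
  have hvpos : ∀ y, 0 < v y := fun y => by
    have := hv y
    have := deletedMul_nonneg (σ := σ) hM hv0 y
    linarith
  -- At a point `m` maximising `u / v`, a positive maximum `ρ` would give `u m ≤ ρ * (v m - 1) < u
  -- m`.
  obtain ⟨m, -, hm⟩ := Finset.exists_max_image Finset.univ (fun y => u y / v y)
    ⟨x, Finset.mem_univ x⟩
  have hmle : u m / v m ≤ 0 := by
    by_contra! hpos
    have h1 : deletedMul M σ u m ≤ (u m / v m) * deletedMul M σ v m := by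
      simp only [deletedMul, Finset.mul_sum]
      refine Finset.sum_le_sum fun y _ => ?_
      have h2 : u y ≤ (u m / v m) * v y := by
        rw [← div_le_iff₀ (hvpos y)]
        exact hm y (Finset.mem_univ y)
      calc M m y * u y ≤ M m y * ((u m / v m) * v y) := mul_le_mul_of_nonneg_left h2 (hM m y)
        _ = _ := by ring
    have h3 : (u m / v m) * deletedMul M σ v m ≤ (u m / v m) * (v m - 1) :=
      mul_le_mul_of_nonneg_left (by linarith [hv m]) hpos.le
    have h4 : (u m / v m) * (v m - 1) = u m - u m / v m := by
      have := (hvpos m).ne'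
      field_simp
    linarith [hu m]
  have h5 := (hm x (Finset.mem_univ x)).trans hmle
  rw [div_le_iff₀ (hvpos x), zero_mul] at h5
  exact h5

omit [DecidableEq V] in
/-- A stationary vector, obtained as a limit of normalized solutions. -/
theorem exists_stationary {q : ℝ} {N : ℝ → V → V → ℝ}
    (hN : ∀ x y, Tendsto (fun s => N s x y) (𝓝[<] q) (𝓝 (M x y))) {p : ℝ → V → ℝ}
    (hp0 : ∀ᶠ s in 𝓝[<] q, ∀ x, 0 ≤ p s x)
    (hp : ∀ᶠ s in 𝓝[<] q, ∀ x, p s x = 1 + ∑ y, N s x y * p s y)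
    (hblow : Tendsto (fun s => ∑ x, p s x) (𝓝[<] q) atTop) :
    ∃ f : V → ℝ, (∀ x, 0 ≤ f x) ∧ 0 < ∑ x, f x ∧ ∀ x, f x = ∑ y, M x y * f y := by
  -- The normalised solutions stay in a compact cube. Along an ultrafilter they converge, and the
  -- constant term of the equation, divided by the diverging total, disappears.
  set U := Ultrafilter.of (𝓝[<] q)
  have hU : (U : Filter ℝ) ≤ 𝓝[<] q := Ultrafilter.of_le _
  set g : ℝ → V → ℝ := fun s x => p s x / ∑ y, p s y with hg
  have hpos : ∀ᶠ s in 𝓝[<] q, 0 < ∑ x, p s x := hblow.eventually_gt_atTop 0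
  have hmem : ∀ᶠ s in 𝓝[<] q, g s ∈ Set.univ.pi fun _ : V => Set.Icc (0 : ℝ) 1 := by
    filter_upwards [hp0, hpos] with s h0 hs
    intro x _
    refine ⟨div_nonneg (h0 x) hs.le, (div_le_one hs).2 ?_⟩
    exact Finset.single_le_sum (f := p s) (fun c _ => h0 c) (Finset.mem_univ x)
  obtain ⟨f, hfK, hf⟩ := (isCompact_univ_pi fun _ : V => isCompact_Icc (a := (0 : ℝ)) (b := 1))
    |>.ultrafilter_le_nhds (U.map g) (le_principal_iff.2 (hU hmem))
  have hlim : ∀ x, Tendsto (fun s => g s x) U (𝓝 (f x)) := fun x =>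
    ((continuous_apply x).tendsto f).comp hf
  have hsum1 : ∑ x, f x = 1 := by
    refine tendsto_nhds_unique (tendsto_finsetSum Finset.univ fun x _ => hlim x) ?_
    refine tendsto_const_nhds.congr' (hU ?_)
    filter_upwards [hpos] with s hs
    rw [← Finset.sum_div, div_self hs.ne']
  refine ⟨f, fun x => (hfK x (Set.mem_univ x)).1, by rw [hsum1]; exact one_pos, fun x => ?_⟩
  have h1 : Tendsto (fun s => (∑ y, p s y)⁻¹ + ∑ y, N s x y * g s y) U
      (𝓝 (0 + ∑ y, M x y * f y)) :=
    ((tendsto_inv_atTop_zero.comp hblow).mono_left hU).add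
      (tendsto_finsetSum _ fun y _ => ((hN x y).mono_left hU).mul (hlim y))
  rw [zero_add] at h1
  refine tendsto_nhds_unique ((hlim x).congr' (hU ?_)) h1
  filter_upwards [hp] with s hs
  change p s x / _ = _
  rw [hs x, add_div, one_div, Finset.sum_div]
  simp only [hg, mul_div_assoc]

/-- Resolvent bound for the path counting series of a strongly connected graph with a loop of
weight one. -/
theorem exists_resolvent_bound {E : V → V → Prop} [DecidableRel E] {w : V → ℕ}
    (hconn : ∀ x y, Relation.ReflTransGen E x y) (hloop : E σ σ) (hwσ : w σ = 1)
    (hother : ∃ y, y ≠ σ) {q : ℝ} (hq : 0 < q) {p : ℝ → V → ℝ}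
    (hp0 : ∀ s, 0 < s → s < q → ∀ x, 0 ≤ p s x)
    (hp : ∀ s, 0 < s → s < q → ∀ x, p s x = 1 + ∑ y, (if E x y then s ^ w y else 0) * p s y)
    (hblow : Tendsto (fun s => ∑ x, p s x) (𝓝[<] q) atTop) :
    q < 1 ∧ ∃ C, ∀ (z : ℂ) (W : V → ℂ), ‖z‖ < q →
      (∀ x, W x = 1 + ∑ y, (if E x y then z ^ w y else 0) * W y) →
      ∀ x, ‖W x‖ * (‖1 - z‖ - (1 - q)) ≤ C := by
  set M : V → V → ℝ := fun x y => if E x y then q ^ w y else 0 with hMdef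
  have hM : ∀ x y, 0 ≤ M x y := fun x y => by
    simp only [hMdef]
    split_ifs <;> positivity
  have hMpos : ∀ {x y}, E x y → 0 < M x y := fun {x y} h => by
    simp only [hMdef, if_pos h]
    positivity
  have hconn' : ∀ x y, Relation.ReflTransGen (fun a b => 0 < M a b) x y := fun x y =>
    Relation.ReflTransGen.mono (fun _ _ h => hMpos h) x y (hconn x y)
  have hIoo : ∀ᶠ s in 𝓝[<] q, 0 < s ∧ s < q := Ioo_mem_nhdsLT hq
  obtain ⟨f₀, hf₀0, hf₀s, hf₀⟩ := exists_stationary (M := M)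
    (N := fun s x y => if E x y then s ^ w y else 0) (q := q) (p := p)
    (fun x y => by
      simp only [hMdef]
      split_ifs
      · exact ((continuous_pow (w y)).tendsto q).mono_left nhdsWithin_le_nhds
      · exact tendsto_const_nhds)
    (hIoo.mono fun s hs => hp0 s hs.1 hs.2) (hIoo.mono fun s hs => hp s hs.1 hs.2) hblow
  have hf₀p := pos_of_stationary hM hconn' hf₀0 hf₀s hf₀
  set f : V → ℝ := fun x => f₀ x / f₀ σ with hfdef
  have hfp : ∀ x, 0 < f x := fun x => div_pos (hf₀p x) (hf₀p σ)
  have hfσ : f σ = 1 := div_self (hf₀p σ).ne'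
  have hf : ∀ x, f x = ∑ y, M x y * f y := fun x => by
    simp only [hfdef, ← mul_div_assoc, ← Finset.sum_div]
    rw [← hf₀]
  have hMσ : M σ σ = q := by simp [hMdef, hloop, hwσ]
  -- The normalisation `f σ = 1` and the loop of weight `q` turn stationarity at `σ` into this exact
  -- value.
  have hdel : deletedMul M σ f σ = 1 - q := by
    have := hf σ
    rw [sum_eq_deletedMul_add M σ, hfσ, hMσ] at this
    linarith
  obtain ⟨v, hv0, hv⟩ := exists_strict_supersolution hM hconn' (hMσ ▸ hq) hfp hf
  refine ⟨?_, ?_⟩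
  -- Some edge leaves `σ` for another vertex, so the quantity `1 - q` above is positive.
  · obtain ⟨y, hy⟩ := hother
    obtain ⟨c, hcσ, hc⟩ : ∃ c, c ≠ σ ∧ E σ c := by
      by_contra! hno
      have : ∀ y, Relation.ReflTransGen E σ y → y = σ := by
        intro y h
        induction h with
        | refl => rfl
        | tail _ h ih =>
          by_contra hne
          exact hno _ hne (ih ▸ h)
      exact hy (this y (hconn σ y))
    have : 0 < deletedMul M σ f σ :=
      Finset.sum_pos' (fun y _ => mul_nonneg (hM _ _) (hfp y).le)
        ⟨c, by simp [hcσ], mul_pos (hMpos hc) (hfp c)⟩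
    linarith
  · refine ⟨∑ x, (f x * v σ + v x * (1 + q + |1 - q|)), ?_⟩
    intro z W hz hW
    have hterm : ∀ x y, ‖(if E x y then z ^ w y else 0) * W y‖ ≤ M x y * ‖W y‖ := by
      intro x y
      rw [norm_mul]
      refine mul_le_mul_of_nonneg_right ?_ (norm_nonneg _)
      simp only [hMdef]
      split_ifs
      · rw [norm_pow]
        exact pow_le_pow_left₀ (norm_nonneg _) hz.le _
      · simp
    have hnorm : ∀ x, ‖W x‖ ≤ 1 + (M x σ * ‖W σ‖ + deletedMul M σ (fun y => ‖W y‖) x) := by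
      intro x
      rw [← sum_eq_deletedMul_add M σ (fun y => ‖W y‖)]
      conv_lhs => rw [hW x]
      refine (norm_add_le _ _).trans ?_
      rw [norm_one]
      gcongr
      exact (norm_sum_le _ _).trans (Finset.sum_le_sum fun y _ => hterm x y)
    have hdl : ∀ (a b : ℝ) x, deletedMul M σ (fun y => ‖W y‖ - a * f y - b * v y) x =
        deletedMul M σ (fun y => ‖W y‖) x - a * deletedMul M σ f x - b * deletedMul M σ v x := by
      intro a b x
      simp only [deletedMul, Finset.mul_sum, ← Finset.sum_sub_distrib]
      refine Finset.sum_congr rfl fun y _ => ?_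
      ring
    -- The maximum principle applied to `‖W‖ - ‖W σ‖ f - v`: the term in `f` absorbs the deleted
    -- column, the term in `v` the constant `1`.
    have hmax : ∀ x, ‖W x‖ ≤ f x * ‖W σ‖ + v x := by
      intro x
      have := nonpos_of_le_deletedMul hM hv0 hv (u := fun y => ‖W y‖ - ‖W σ‖ * f y - 1 * v y)
        (fun y => by
          rw [hdl]
          have h1 := hnorm y
          have h2 := hf y
          rw [sum_eq_deletedMul_add M σ, hfσ] at h2
          have h3 := hv y
          have h4 : ‖W σ‖ * f y = M y σ * ‖W σ‖ + ‖W σ‖ * deletedMul M σ f y := by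
            rw [h2]; ring
          linarith) x
      linarith
    -- Isolating the loop gives `W σ * (1 - z)` on the left. By `hmax` and `hdel` the remaining
    -- terms contribute at most `(1 - q) * ‖W σ‖` plus a constant.
    have hσb : ‖W σ‖ * (‖1 - z‖ - (1 - q)) ≤ v σ := by
      have h1 : W σ * (1 - z) = 1 + ∑ y ∈ Finset.univ.erase σ,
          (if E σ y then z ^ w y else 0) * W y := by
        have := hW σ
        rw [← Finset.add_sum_erase _ _ (Finset.mem_univ σ), if_pos hloop, hwσ, pow_one] at this
        linear_combination this
      have h2 : ‖W σ‖ * ‖1 - z‖ ≤ 1 + deletedMul M σ (fun y => f y * ‖W σ‖ + v y) σ := by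
        rw [← norm_mul, h1]
        refine (norm_add_le _ _).trans ?_
        rw [norm_one]
        gcongr
        refine (norm_sum_le _ _).trans (Finset.sum_le_sum fun y _ => (hterm σ y).trans ?_)
        exact mul_le_mul_of_nonneg_left (hmax y) (hM σ y)
      have h3 : deletedMul M σ (fun y => f y * ‖W σ‖ + v y) σ =
          (1 - q) * ‖W σ‖ + deletedMul M σ v σ := by
        rw [← hdel]
        simp only [deletedMul, Finset.sum_mul, ← Finset.sum_add_distrib]
        refine Finset.sum_congr rfl fun y _ => ?_
        ring
      have := hv σ
      linarith
    intro x
    have hD : ‖1 - z‖ - (1 - q) ≤ 1 + q + |1 - q| := by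
      have := norm_sub_le (1 : ℂ) z
      rw [norm_one] at this
      have := neg_abs_le (1 - q)
      linarith
    have hD0 : 0 ≤ ‖1 - z‖ - (1 - q) := by
      have := norm_sub_norm_le (1 : ℂ) z
      rw [norm_one] at this
      linarith
    calc ‖W x‖ * (‖1 - z‖ - (1 - q)) ≤ (f x * ‖W σ‖ + v x) * (‖1 - z‖ - (1 - q)) :=
          mul_le_mul_of_nonneg_right (hmax x) hD0
      _ = f x * (‖W σ‖ * (‖1 - z‖ - (1 - q))) + v x * (‖1 - z‖ - (1 - q)) := by ring
      _ ≤ f x * v σ + v x * (1 + q + |1 - q|) :=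
          add_le_add (mul_le_mul_of_nonneg_left hσb (hfp x).le)
            (mul_le_mul_of_nonneg_left hD (hv0 x))
      _ ≤ _ := Finset.single_le_sum (f := fun x => f x * v σ + v x * (1 + q + |1 - q|))
          (fun y _ => add_nonneg (mul_nonneg (hfp y).le (hv0 σ))
            (mul_nonneg (hv0 y) (by positivity))) (Finset.mem_univ x)

end Perron

/-! ### Counting braids through the graph of simple braids -/

section GraphCounting

variable {t : BraidType} {n : ℕ}

instance instFiniteSimpleBraid (t : BraidType) (n : ℕ) : Finite (SimpleBraid t n) := by
  have h : {x : Braid t n | IsSimple x} ⊆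
      ⋃ k ∈ Finset.range (braidLength (garside t n) + 1), braidSphere t n k := by
    intro x hx
    have := braidLength_le_of_dvd hx
    simp only [Set.mem_iUnion]
    exact ⟨braidLength x, by simp; omega, rfl⟩
  exact (Set.Finite.subset (Set.Finite.biUnion (Finset.finite_toSet _)
    fun k _ => braidSphere_finite t n k) h).to_subtype

noncomputable instance instFintypeSimpleBraid (t : BraidType) (n : ℕ) :
    Fintype (SimpleBraid t n) := Fintype.ofFinite _

/-- The number of braids of length `k` that may follow the simple braid `x` in a normal form. -/
noncomputable def followCount (x : Braid t n) (k : ℕ) : ℕ :=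
  {y ∈ braidSphere t n k | braidHead (x * y) = x}.ncard

open Classical in
theorem followCount_eq_card (x : Braid t n) (k : ℕ) :
    followCount x k = ((sphereFinset t n k).filter fun y => braidHead (x * y) = x).card := by
  rw [followCount, ← Set.ncard_coe_finset]
  congr 1
  ext y
  simp [mem_sphereFinset, braidSphere]

theorem followCount_le (x : Braid t n) (k : ℕ) : followCount x k ≤ braidCount t n k :=
  Set.ncard_le_ncard (Set.sep_subset _ _) (braidSphere_finite t n k)

namespace GarsideFacts

variable (hG : GarsideFacts t n)
include hG

open Classical in
theorem card_head_eq (s : SimpleBraid t n) (k : ℕ) :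
    ((sphereFinset t n k).filter fun y => braidHead y = s.1).card =
      if braidLength s.1 ≤ k then followCount s.1 (k - braidLength s.1) else 0 := by
  split_ifs with h
  · rw [followCount_eq_card]
    rw [← Finset.card_image_of_injective ((sphereFinset t n (k - braidLength s.1)).filter
      fun y => braidHead (s.1 * y) = s.1)
      (f := fun x => s.1 * x) (fun x y h => hG.mul_left_cancel s.1 x y h)]
    congr 1
    ext x
    simp only [Finset.mem_filter, Finset.mem_image, mem_sphereFinset]
    constructor
    · rintro ⟨hx, hs⟩
      have h1 := hG.head_mul_tail x
      rw [hs] at h1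
      have h2 := congrArg braidLength h1
      rw [braidLength_mul] at h2
      exact ⟨braidTail x, ⟨by omega, by rw [h1, hs]⟩, h1⟩
    · rintro ⟨y, ⟨hy, hs⟩, rfl⟩
      exact ⟨by rw [braidLength_mul]; omega, hs⟩
  · rw [Finset.card_eq_zero, Finset.filter_eq_empty_iff]
    intro x hx hd
    have := braidLength_le_of_dvd (hG.head_dvd x)
    rw [mem_sphereFinset.1 hx, hd] at this
    omega

/-- The head of a braid, as a simple braid. -/
noncomputable def headSimple (y : Braid t n) : SimpleBraid t n :=
  ⟨braidHead y, hG.isSimple_head y⟩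

theorem headSimple_eq_iff {y : Braid t n} {s : SimpleBraid t n} :
    hG.headSimple y = s ↔ braidHead y = s.1 := Subtype.ext_iff

open Classical in
-- The braids following `x` are sorted by their head `s`: by `head_mul_head`, whether they may
-- follow `x` depends on `s` alone.
theorem followCount_recursion (x : SimpleBraid t n) (k : ℕ) :
    followCount x.1 k = ∑ s : SimpleBraid t n, if Arrow x s then
      (if braidLength s.1 ≤ k then followCount s.1 (k - braidLength s.1) else 0) else 0 := by
  rw [followCount_eq_card, Finset.card_eq_sum_card_fiberwise
    (f := hG.headSimple) (t := Finset.univ)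
    (fun _ _ => Finset.mem_coe.2 (Finset.mem_univ _))]
  refine Finset.sum_congr rfl fun s _ => ?_
  rw [← hG.card_head_eq s k, Finset.filter_filter]
  split_ifs with hA
  · congr 1
    refine Finset.filter_congr fun y _ => ?_
    rw [hG.headSimple_eq_iff]
    refine ⟨fun h => h.2, fun h => ⟨?_, h⟩⟩
    rw [← hG.head_mul_head _ x.2, h]
    exact hG.arrow_iff.1 hA
  · rw [Finset.card_eq_zero, Finset.filter_eq_empty_iff]
    rintro y - ⟨h1, h2⟩
    rw [hG.headSimple_eq_iff] at h2
    refine hA (hG.arrow_iff.2 ?_)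
    rw [← h2, hG.head_mul_head _ x.2, h1]

theorem followCount_one (k : ℕ) : followCount (1 : Braid t n) k = if k = 0 then 1 else 0 := by
  classical
  rw [followCount_eq_card]
  have h1 : ∀ y : Braid t n, braidHead (1 * y) = 1 ↔ y = 1 := fun y => by
    rw [one_mul]
    exact ⟨fun h => by_contra fun hy => hG.head_ne_one hy h, fun h => h ▸ hG.head_one⟩
  simp_rw [h1]
  split_ifs with h
  · rw [Finset.card_eq_one]
    refine ⟨1, ?_⟩
    ext y
    simp only [Finset.mem_filter, mem_sphereFinset, Finset.mem_singleton, and_iff_right_iff_imp]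
    rintro rfl
    rw [braidLength_one, h]
  · rw [Finset.card_eq_zero, Finset.filter_eq_empty_iff]
    rintro y hy rfl
    rw [mem_sphereFinset, braidLength_one] at hy
    omega

theorem head_garside_mul (y : Braid t n) : braidHead (garside t n * y) = garside t n :=
  hG.head_eq dvd_rfl (dvd_mul_right _ _) fun _ h _ => h

/-- Any braid may follow `Δ`, so the growth series is one of the path counting series. -/
theorem followCount_garside (k : ℕ) : followCount (garside t n) k = braidCount t n k := by
  rw [followCount, braidCount]
  congr 1
  ext y
  simp [hG.head_garside_mul]

theorem arrow_garside_left {x s : SimpleBraid t n} (hx : x.1 = garside t n) : Arrow x s := by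
  rw [hG.arrow_iff, hx, hG.head_garside_mul]

/-- Since every generator divides `Δ`, a predecessor of `Δ` cannot be extended by any generator.
Hence proper simple braids form a closed linear system, without feedback from `Δ`. -/
theorem eq_garside_of_arrow {x s : SimpleBraid t n} (hs : s.1 = garside t n) (h : Arrow x s) :
    x.1 = garside t n := by
  obtain ⟨y, hy⟩ := x.2
  by_cases hy1 : y = 1
  · rw [hy, hy1, mul_one]
  obtain ⟨a, z, rfl⟩ := exists_braidOf_dvd hy1
  refine absurd ?_ (h (show braidOf a ∣ s.1 by rw [hs]; exact hG.isSimple_of a))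
  exact ⟨z, by rw [hy, mul_assoc]⟩

theorem arrow_of_self (a : BraidGen t n) :
    Arrow (⟨braidOf a, hG.isSimple_of a⟩ : SimpleBraid t n) ⟨braidOf a, hG.isSimple_of a⟩ := by
  intro b hb
  have : braidOf b = braidOf a := braid_eq_of_dvd hb (by rw [braidLength_of, braidLength_of])
  change ¬ IsSimple (braidOf a * braidOf b)
  rw [this]
  exact hG.not_isSimple_sq a

end GarsideFacts

/-- The Garside element as a simple braid. -/
noncomputable def simpleTop (t : BraidType) (n : ℕ) : SimpleBraid t n := ⟨garside t n, dvd_rfl⟩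

theorem simpleOne_val : (simpleOne t n).1 = 1 := rfl

theorem simpleTop_val : (simpleTop t n).1 = garside t n := rfl

theorem simpleBraid_ext_iff {x y : SimpleBraid t n} : x = y ↔ x.1 = y.1 := Subtype.ext_iff

/-- The simple braids other than the unit and the Garside element. -/
abbrev ProperSimple (t : BraidType) (n : ℕ) : Type :=
  {s : SimpleBraid t n // s.1 ≠ 1 ∧ s.1 ≠ garside t n}

theorem sum_simpleBraid {𝕜 : Type*} [AddCommMonoid 𝕜] (h1 : (1 : Braid t n) ≠ garside t n)
    [Fintype (ProperSimple t n)] (F : SimpleBraid t n → 𝕜) :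
    ∑ s, F s = F (simpleOne t n) + F (simpleTop t n) + ∑ v : ProperSimple t n, F v.1 := by
  classical
  rw [← Finset.add_sum_erase _ _ (Finset.mem_univ (simpleOne t n)),
    ← Finset.add_sum_erase (Finset.univ.erase (simpleOne t n)) _
      (a := simpleTop t n)
      (Finset.mem_erase.2 ⟨fun h => h1 (congrArg Subtype.val h).symm, Finset.mem_univ _⟩),
    ← add_assoc]
  congr 1
  refine Finset.sum_subtype _ (fun s => ?_) F
  rw [Finset.mem_erase, Finset.mem_erase, ne_eq, ne_eq, simpleBraid_ext_iff, simpleBraid_ext_iff,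
    simpleOne_val, simpleTop_val]
  simp [and_comm]

/-- The generating function of the braids that may follow `x`. -/
noncomputable def followSeries {𝕜 : Type*} [RCLike 𝕜] (x : Braid t n) (z : 𝕜) : 𝕜 :=
  ∑' k, (followCount x k : 𝕜) * z ^ k

theorem tsum_shift {𝕜 : Type*} [RCLike 𝕜] (c : ℕ → ℕ) (d : ℕ) (z : 𝕜) :
    ∑' k, ((if d ≤ k then c (k - d) else 0 : ℕ) : 𝕜) * z ^ k = z ^ d * ∑' k, (c k : 𝕜) * z ^ k := by
  rw [← (add_left_injective d).tsum_eq, ← tsum_mul_left]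
  · refine tsum_congr fun k => ?_
    simp only [le_add_iff_nonneg_left, zero_le, if_true, Nat.add_sub_cancel, pow_add]
    ring
  · intro k hk
    by_contra h
    refine hk ?_
    have : ¬ d ≤ k := fun hd => h ⟨k - d, Nat.sub_add_cancel hd⟩
    simp [this]

theorem summable_followCount {𝕜 : Type*} [RCLike 𝕜] (hn : 2 ≤ n) (x : Braid t n) {z : 𝕜}
    (hz : ‖z‖ < braidRadius t n) : Summable fun k => (followCount x k : 𝕜) * z ^ k := by
  refine Summable.of_norm_bounded (summable_braidCount t hn ‖z‖ (norm_nonneg z) hz) fun k => ?_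
  rw [norm_mul, norm_pow, RCLike.norm_natCast]
  gcongr
  rw [abs_of_nonneg (by positivity)]
  exact_mod_cast followCount_le x k

theorem summable_shift {𝕜 : Type*} [RCLike 𝕜] (hn : 2 ≤ n) (x : Braid t n) (d : ℕ) {z : 𝕜}
    (hz : ‖z‖ < braidRadius t n) :
    Summable fun k => ((if d ≤ k then followCount x (k - d) else 0 : ℕ) : 𝕜) * z ^ k := by
  refine (Function.Injective.summable_iff (add_left_injective d) (fun k hk => ?_)).1 ?_
  · have : ¬ d ≤ k := fun hd => hk ⟨k - d, Nat.sub_add_cancel hd⟩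
    simp [this]
  · refine ((summable_followCount hn x hz).mul_left (z ^ d)).congr fun k => ?_
    simp only [Function.comp_apply, le_add_iff_nonneg_left, zero_le, if_true, Nat.add_sub_cancel,
      pow_add]
    ring

namespace GarsideFacts

variable (hG : GarsideFacts t n)
include hG

open Classical in
theorem followSeries_recursion {𝕜 : Type*} [RCLike 𝕜] (hn : 2 ≤ n) (x : SimpleBraid t n) {z : 𝕜}
    (hz : ‖z‖ < braidRadius t n) : followSeries x.1 z =
      ∑ s : SimpleBraid t n, (if Arrow x s then z ^ braidLength s.1 else 0) *
        followSeries s.1 z := by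
  have h1 : ∀ k, (followCount x.1 k : 𝕜) * z ^ k = ∑ s : SimpleBraid t n, (if Arrow x s then
      ((if braidLength s.1 ≤ k then followCount s.1 (k - braidLength s.1) else 0 : ℕ) : 𝕜) * z ^ k
        else 0) := by
    intro k
    rw [hG.followCount_recursion x k]
    push_cast
    rw [Finset.sum_mul]
    refine Finset.sum_congr rfl fun s _ => ?_
    split_ifs <;> simp
  rw [followSeries]
  simp_rw [h1]
  rw [Summable.tsum_finsetSum]
  · refine Finset.sum_congr rfl fun s _ => ?_
    split_ifs
    · exact tsum_shift _ _ _
    · simp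
  · intro s _
    split_ifs
    · exact summable_shift hn _ _ hz
    · exact summable_zero

theorem followSeries_one {𝕜 : Type*} [RCLike 𝕜] (z : 𝕜) :
    followSeries (1 : Braid t n) z = 1 := by
  rw [followSeries, tsum_eq_single 0]
  · simp [hG.followCount_one]
  · intro k hk
    simp [hG.followCount_one, hk]

theorem arrow_one (x : SimpleBraid t n) : Arrow x (simpleOne t n) := by
  rw [hG.arrow_iff]
  exact (congrArg braidHead (mul_one _)).trans (hG.head_of_simple x.2)

open Classical in
-- The unit contributes the constant `1` and `Δ` contributes nothing.
theorem followSeries_proper {𝕜 : Type*} [RCLike 𝕜] (hn : 2 ≤ n)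
    (h1 : (1 : Braid t n) ≠ garside t n) (x : ProperSimple t n) {z : 𝕜}
    (hz : ‖z‖ < braidRadius t n) : followSeries x.1.1 z =
      1 + ∑ v : ProperSimple t n, (if Arrow x.1 v.1 then z ^ braidLength v.1.1 else 0) *
        followSeries v.1.1 z := by
  rw [hG.followSeries_recursion hn x.1 hz, sum_simpleBraid h1]
  congr 1
  have hno : ¬ Arrow x.1 (simpleTop t n) := fun h =>
    x.2.2 (hG.eq_garside_of_arrow simpleTop_val h)
  rw [if_pos (hG.arrow_one _), if_neg hno, zero_mul, add_zero, simpleOne_val,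
    hG.followSeries_one, braidLength_one, pow_zero, mul_one]

/-- Every vertex follows `Δ`, including `Δ` itself; that loop accounts for the factor on the left.
-/
theorem followSeries_garside {𝕜 : Type*} [RCLike 𝕜] (hn : 2 ≤ n)
    (h1 : (1 : Braid t n) ≠ garside t n) [Fintype (ProperSimple t n)] {z : 𝕜}
    (hz : ‖z‖ < braidRadius t n) :
    (1 - z ^ braidLength (garside t n)) * followSeries (garside t n) z =
      1 + ∑ v : ProperSimple t n, z ^ braidLength v.1.1 * followSeries v.1.1 z := by
  classical
  have h := hG.followSeries_recursion hn (simpleTop t n) hz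
  rw [sum_simpleBraid h1] at h
  have harr : ∀ s, Arrow (simpleTop t n) s := fun s => hG.arrow_garside_left simpleTop_val
  simp only [harr, if_true] at h
  rw [simpleOne_val, simpleTop_val, hG.followSeries_one, braidLength_one, pow_zero, mul_one] at h
  linear_combination h

theorem followSeries_garside_mul_moebius (hn : 2 ≤ n) {z : ℂ} (hz : ‖z‖ < braidRadius t n) :
    followSeries (garside t n) z * aeval z (moebiusPoly t n) = 1 := by
  rw [← tsum_mul_eval_eq_one hG.growthSeries_mul (summable_braidCount t hn) hz, followSeries]
  simp [hG.followCount_garside]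

theorem isRoot_braidRadius (hn : 2 ≤ n) : (moebiusPoly t n).IsRoot (braidRadius t n) :=
  isRoot_radius (braidRadius_pos t hn) (fun _ => Nat.cast_nonneg _) hG.growthSeries_mul
    (summable_braidCount t hn) (not_summable_braidCount t hn)

end GarsideFacts

theorem followSeries_ofReal (x : Braid t n) (s : ℝ) :
    followSeries x (s : ℂ) = ((followSeries x s : ℝ) : ℂ) := by
  rw [followSeries, followSeries, Complex.ofReal_tsum]
  exact tsum_congr fun k => by push_cast; rfl

theorem followSeries_nonneg (x : Braid t n) {s : ℝ} (hs : 0 ≤ s) : 0 ≤ followSeries x s :=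
  tsum_nonneg fun k => by positivity

namespace GarsideFacts

variable (hG : GarsideFacts t n)
include hG

/-- The series equals `1 / H(s)`, and `H(s)` tends to `0` through positive values because the series
is nonnegative. -/
theorem tendsto_followSeries_garside (hn : 2 ≤ n) :
    Tendsto (fun s : ℝ => followSeries (garside t n) s) (𝓝[<] (braidRadius t n)) atTop := by
  have hq := braidRadius_pos t hn
  have hIoo : ∀ᶠ s in 𝓝[<] (braidRadius t n), 0 < s ∧ s < braidRadius t n := Ioo_mem_nhdsLT hq
  have hmul : ∀ s : ℝ, 0 < s ∧ s < braidRadius t n →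
      followSeries (garside t n) s * (moebiusPoly t n).eval s = 1 := by
    intro s hs
    have h := hG.followSeries_garside_mul_moebius hn (z := (s : ℂ)) (by
      rw [Complex.norm_real, Real.norm_of_nonneg hs.1.le]; exact hs.2)
    have h5 : aeval ((s : ℝ) : ℂ) (moebiusPoly t n) = (((moebiusPoly t n).eval s : ℝ) : ℂ) := by
      have := Polynomial.aeval_algebraMap_apply ℂ s (moebiusPoly t n)
      rw [Polynomial.coe_aeval_eq_eval] at this
      exact this
    rw [h5, followSeries_ofReal] at h
    exact_mod_cast h
  have hlim : Tendsto (fun s => (moebiusPoly t n).eval s) (𝓝[<] (braidRadius t n)) (𝓝[>] 0) := by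
    refine tendsto_nhdsWithin_iff.2 ⟨?_, ?_⟩
    · have := ((moebiusPoly t n).continuous.tendsto (braidRadius t n)).mono_left
        (nhdsWithin_le_nhds (s := Set.Iio (braidRadius t n)))
      rwa [(hG.isRoot_braidRadius hn).eq_zero] at this
    · filter_upwards [hIoo] with s hs
      have h1 := hmul s hs
      have h2 := followSeries_nonneg (garside t n) hs.1.le
      by_contra hle
      have : followSeries (garside t n) s * (moebiusPoly t n).eval s ≤ 0 :=
        mul_nonpos_of_nonneg_of_nonpos h2 (not_lt.1 hle)
      linarith
  refine (tendsto_inv_nhdsGT_zero.comp hlim).congr' ?_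
  filter_upwards [hIoo] with s hs
  exact (eq_inv_of_mul_eq_one_left (hmul s hs)).symm

/-- The bound on the Möbius polynomial that excludes other roots of smallest modulus. -/
theorem exists_moebius_bound_of_connected (hn : 2 ≤ n)
    (hconn : ∀ x y : ProperSimple t n,
      Relation.ReflTransGen (fun a b : ProperSimple t n => Arrow a.1 b.1) x y)
    (hab : ∃ a b : BraidGen t n, braidOf a ≠ braidOf b) :
    ∃ C, ∀ z : ℂ, ‖z‖ < braidRadius t n →
      ‖1 - z‖ - (1 - braidRadius t n) ≤ C * ‖aeval z (moebiusPoly t n)‖ := by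
  classical
  obtain ⟨a, b, hab⟩ := hab
  set q := braidRadius t n with hqdef
  have hq := braidRadius_pos t hn
  have hlen : ∀ c : BraidGen t n, braidOf c ≠ garside t n := by
    have key : ∀ c d : BraidGen t n, braidOf c = garside t n → braidOf d = braidOf c := by
      intro c d h
      refine braid_eq_of_dvd ?_ (by rw [braidLength_of, braidLength_of])
      rw [h]
      exact hG.isSimple_of d
    intro c hc
    exact hab ((key c a hc).trans (key c b hc).symm)
  have hne1 : ∀ c : BraidGen t n, braidOf c ≠ 1 := fun c h => by
    have := congrArg braidLength h
    rw [braidLength_of, braidLength_one] at this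
    omega
  have h1 : (1 : Braid t n) ≠ garside t n := by
    intro h
    have := braidLength_le_of_dvd (hG.isSimple_of a)
    rw [← h, braidLength_one, braidLength_of] at this
    omega
  let σ : ProperSimple t n := ⟨⟨braidOf a, hG.isSimple_of a⟩, hne1 a, hlen a⟩
  let τ : ProperSimple t n := ⟨⟨braidOf b, hG.isSimple_of b⟩, hne1 b, hlen b⟩
  have hτσ : τ ≠ σ := fun h => hab (congrArg (fun v : ProperSimple t n => v.1.1) h).symm
  have hnorm : ∀ {s : ℝ}, 0 < s → s < q → ‖s‖ < braidRadius t n := fun {s} h0 hs => by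
    rwa [Real.norm_of_nonneg h0.le]
  have hIoo : ∀ᶠ s in 𝓝[<] q, 0 < s ∧ s < q := Ioo_mem_nhdsLT hq
  have hrec : ∀ s : ℝ, 0 < s → s < q → ∀ x : ProperSimple t n, followSeries x.1.1 s =
      1 + ∑ v : ProperSimple t n, (if Arrow x.1 v.1 then s ^ braidLength v.1.1 else 0) *
        followSeries v.1.1 s := fun s h0 hs x =>
    hG.followSeries_proper hn h1 x (hnorm h0 hs)
  -- That `q < 1` is not yet known. If it holds, `1 - s ^ |Δ|` stays away from `0` and the
  -- divergence of the series of `Δ` passes to the proper vertices.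
  have hblow : Tendsto (fun s : ℝ => ∑ x : ProperSimple t n, followSeries x.1.1 s) (𝓝[<] q)
      atTop := by
    rcases (braidRadius_le_one t hn).lt_or_eq with hlt | heq
    · have hgar := hG.tendsto_followSeries_garside hn
      have hd : 0 < 1 - q ^ braidLength (garside t n) := by
        have h0 : braidLength (garside t n) ≠ 0 := fun h => h1 (eq_one_of_braidLength h).symm
        have := pow_lt_one₀ hq.le hlt h0
        linarith
      refine tendsto_atTop_mono' _ ?_ (tendsto_atTop_add_const_right _ (-1)
        (hgar.const_mul_atTop hd))
      filter_upwards [hIoo] with s hs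
      have h2 := hG.followSeries_garside hn h1 (hnorm hs.1 hs.2)
      have h3 : ∑ v : ProperSimple t n, s ^ braidLength v.1.1 * followSeries v.1.1 s ≤
          ∑ v : ProperSimple t n, followSeries v.1.1 s := by
        refine Finset.sum_le_sum fun v _ => ?_
        refine mul_le_of_le_one_left (followSeries_nonneg _ hs.1.le) ?_
        exact pow_le_one₀ hs.1.le (hs.2.le.trans hlt.le)
      have h4 : (1 - q ^ braidLength (garside t n)) * followSeries (garside t n) s ≤
          (1 - s ^ braidLength (garside t n)) * followSeries (garside t n) s := by
        refine mul_le_mul_of_nonneg_right ?_ (followSeries_nonneg _ hs.1.le)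
        have := pow_le_pow_left₀ hs.1.le hs.2.le (braidLength (garside t n))
        linarith
      linarith
    -- If `q = 1`, the loop at `σ` alone forces the series of `σ` to be at least `1 / (1 - s)`.
    · have hlim : Tendsto (fun s : ℝ => (1 - s)⁻¹) (𝓝[<] q) atTop := by
        refine tendsto_inv_nhdsGT_zero.comp (tendsto_nhdsWithin_iff.2 ⟨?_, ?_⟩)
        · have : Tendsto (fun s : ℝ => 1 - s) (𝓝 q) (𝓝 (1 - q)) :=
            (continuous_const.sub continuous_id).tendsto q
          rw [show (1 : ℝ) - q = 0 by rw [hqdef, heq, sub_self]] at this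
          exact this.mono_left nhdsWithin_le_nhds
        · filter_upwards [hIoo] with s hs
          have := hs.2
          simp only [Set.mem_Ioi]
          linarith
      refine tendsto_atTop_mono' _ ?_ hlim
      filter_upwards [hIoo] with s hs
      have hs1 : 0 < 1 - s := by linarith [hs.2]
      have hnn : ∀ v : ProperSimple t n, 0 ≤ followSeries v.1.1 s := fun v =>
        followSeries_nonneg _ hs.1.le
      have h2 : 1 + s * followSeries σ.1.1 s ≤ followSeries σ.1.1 s := by
        conv_rhs => rw [hrec s hs.1 hs.2 σ]
        gcongr
        have h3 := Finset.single_le_sum (f := fun v : ProperSimple t n =>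
          (if Arrow σ.1 v.1 then s ^ braidLength v.1.1 else 0) * followSeries v.1.1 s)
          (fun v _ => mul_nonneg (by have := hs.1; split_ifs <;> positivity) (hnn v))
          (Finset.mem_univ σ)
        refine le_trans (le_of_eq ?_) h3
        simp only [if_pos (hG.arrow_of_self a), σ, braidLength_of, pow_one]
      have h4 : (1 - s)⁻¹ ≤ followSeries σ.1.1 s := by
        rw [inv_le_iff_one_le_mul₀ hs1]
        nlinarith
      exact h4.trans (Finset.single_le_sum (f := fun v : ProperSimple t n => followSeries v.1.1 s)
        (fun v _ => hnn v) (Finset.mem_univ σ))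
  obtain ⟨hq1, C, hC⟩ := exists_resolvent_bound (V := ProperSimple t n) (σ := σ)
    (E := fun x y => Arrow x.1 y.1) (w := fun v => braidLength v.1.1) hconn
    (hG.arrow_of_self a) (braidLength_of a) ⟨τ, hτσ⟩ hq
    (p := fun s v => followSeries v.1.1 s) (fun s h0 _ v => followSeries_nonneg _ h0.le)
    hrec hblow
  set d := 1 - q ^ braidLength (garside t n) with hddef
  have hd : 0 < d := by
    have h0 : braidLength (garside t n) ≠ 0 := fun h => h1 (eq_one_of_braidLength h).symm
    have := pow_lt_one₀ hq.le hq1 h0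
    linarith
  -- The number `2` bounds `‖1 - z‖ - (1 - q)`, each `C` bounds a proper vertex, and `d` bounds `‖1
  -- - z ^ |Δ|‖` from below. The identity `series of Δ * H = 1` converts the estimate into one for
  -- `H`.
  refine ⟨(2 + ∑ _v : ProperSimple t n, C) / d, fun z hz => ?_⟩
  have hG1 := hG.followSeries_garside_mul_moebius hn hz
  have hD0 : 0 ≤ ‖1 - z‖ - (1 - q) := by
    have := norm_sub_norm_le (1 : ℂ) z
    rw [norm_one] at this
    linarith
  have hD2 : ‖1 - z‖ - (1 - q) ≤ 2 := by
    have := norm_sub_le (1 : ℂ) z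
    rw [norm_one] at this
    linarith
  have hW := hC z (fun v => followSeries v.1.1 z) hz fun x => hG.followSeries_proper hn h1 x hz
  have h2 := hG.followSeries_garside hn h1 hz
  have h3 : d * ‖followSeries (garside t n) z‖ ≤
      1 + ∑ v : ProperSimple t n, ‖followSeries v.1.1 z‖ := by
    have h4 : d ≤ ‖1 - z ^ braidLength (garside t n)‖ := by
      have h5 := norm_sub_norm_le (1 : ℂ) (z ^ braidLength (garside t n))
      rw [norm_one, norm_pow] at h5
      have := pow_le_pow_left₀ (norm_nonneg z) hz.le (braidLength (garside t n))
      linarith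
    calc _ ≤ ‖1 - z ^ braidLength (garside t n)‖ * ‖followSeries (garside t n) z‖ := by gcongr
      _ = ‖1 + ∑ v : ProperSimple t n, z ^ braidLength v.1.1 * followSeries v.1.1 z‖ := by
          rw [← norm_mul, h2]
      _ ≤ _ := by
          refine (norm_add_le _ _).trans ?_
          rw [norm_one]
          gcongr
          refine (norm_sum_le _ _).trans (Finset.sum_le_sum fun v _ => ?_)
          rw [norm_mul, norm_pow]
          exact mul_le_of_le_one_left (norm_nonneg _)
            (pow_le_one₀ (norm_nonneg _) (hz.le.trans hq1.le))
  have h6 : d * ‖followSeries (garside t n) z‖ * (‖1 - z‖ - (1 - q)) ≤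
      2 + ∑ _v : ProperSimple t n, C := by
    calc _ ≤ (1 + ∑ v : ProperSimple t n, ‖followSeries v.1.1 z‖) * (‖1 - z‖ - (1 - q)) := by
          gcongr
      _ = (‖1 - z‖ - (1 - q)) +
          ∑ v : ProperSimple t n, ‖followSeries v.1.1 z‖ * (‖1 - z‖ - (1 - q)) := by
          rw [add_mul, one_mul, Finset.sum_mul]
      _ ≤ _ := add_le_add hD2 (Finset.sum_le_sum fun v _ => hW v)
  have h7 := congrArg norm hG1
  rw [norm_mul, norm_one] at h7
  calc ‖1 - z‖ - (1 - q) = (d * ‖followSeries (garside t n) z‖ * (‖1 - z‖ - (1 - q))) / d *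
        ‖aeval z (moebiusPoly t n)‖ := by
        rw [mul_assoc d, mul_div_cancel_left₀ _ hd.ne', mul_right_comm, h7, one_mul]
    _ ≤ _ := by gcongr

/-- The case of a single generator. -/
theorem exists_moebius_bound_of_subsingleton (hn : 2 ≤ n) [Subsingleton (BraidGen t n)] :
    ∃ C, ∀ z : ℂ, ‖z‖ < braidRadius t n →
      ‖1 - z‖ - (1 - braidRadius t n) ≤ C * ‖aeval z (moebiusPoly t n)‖ := by
  classical
  obtain ⟨x, hx⟩ := braidSphere_nonempty t hn 1
  obtain ⟨a, -⟩ := exists_braidOf_dvd (x := x) (by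
    rintro rfl
    have h : braidLength (1 : Braid t n) = 1 := hx
    rw [braidLength_one] at h
    omega)
  have hgar : garside t n = braidOf a := by
    refine braid_dvd_antisymm ((hG.deltaOf_spec Finset.univ).2 _ fun b _ => ?_) (hG.isSimple_of a)
    rw [Subsingleton.elim b a]
  have h1 : (1 : Braid t n) ≠ garside t n := by
    intro h
    have := congrArg braidLength h
    rw [hgar, braidLength_one, braidLength_of] at this
    omega
  have : IsEmpty (ProperSimple t n) := by
    refine ⟨fun v => ?_⟩
    have h2 := v.1.2
    have h3 : braidLength v.1.1 ≠ 0 := fun h => v.2.1 (eq_one_of_braidLength h)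
    refine v.2.2 (braid_eq_of_dvd h2 ?_)
    have h4 : braidLength (garside t n) = 1 := by rw [hgar, braidLength_of]
    omega
  -- With one generator the Möbius polynomial is `1 - z`, so `C = 1` works since `q ≤ 1`.
  refine ⟨1, fun z hz => ?_⟩
  have h2 := hG.followSeries_garside hn h1 hz
  rw [Finset.univ_eq_empty, Finset.sum_empty, add_zero, hgar, braidLength_of, pow_one] at h2
  have h3 := hG.followSeries_garside_mul_moebius hn hz
  rw [hgar] at h3
  have h4 : aeval z (moebiusPoly t n) = 1 - z := by
    calc aeval z (moebiusPoly t n) = ((1 - z) * followSeries (braidOf a) z) *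
          aeval z (moebiusPoly t n) := by rw [h2, one_mul]
      _ = _ := by rw [mul_assoc, h3, mul_one]
  rw [h4, one_mul]
  have := braidRadius_le_one t hn
  linarith

end GarsideFacts

end GraphCounting

/-! ### Strong connectivity through duality -/

section Duality

variable {V : Type*} {E : V → V → Prop}

/-- There is a path with exactly `m` steps. -/
def ReachIn (E : V → V → Prop) : ℕ → V → V → Prop
  | 0, x, y => x = y
  | m + 1, x, y => ∃ z, E x z ∧ ReachIn E m z y

theorem ReachIn.snoc {m : ℕ} {x y z : V} (h : ReachIn E m x y) (hz : E y z) :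
    ReachIn E (m + 1) x z := by
  induction m generalizing x with
  | zero =>
    obtain rfl : x = y := h
    exact ⟨z, hz, rfl⟩
  | succ m ih =>
    obtain ⟨u, hu, h⟩ := h
    exact ⟨u, hu, ih h⟩

theorem ReachIn.reflTransGen {m : ℕ} {x y : V} (h : ReachIn E m x y) :
    Relation.ReflTransGen E x y := by
  induction m generalizing x with
  | zero =>
    obtain rfl : x = y := h
    exact .refl
  | succ m ih =>
    obtain ⟨u, hu, h⟩ := h
    exact .head hu (ih h)

/-- Waiting on the loop at `x` lengthens a path of `m` steps to one of `N * m` steps. -/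
theorem exists_reachIn_dvd {x y : V} (hx : E x x) (h : Relation.ReflTransGen E x y) {N : ℕ}
    (hN : 0 < N) : ∃ m, N ∣ m ∧ ReachIn E m x y := by
  have h1 : ∃ m, ReachIn E m x y := by
    induction h with
    | refl => exact ⟨0, rfl⟩
    | tail _ h ih =>
      obtain ⟨m, hm⟩ := ih
      exact ⟨m + 1, hm.snoc h⟩
  obtain ⟨m, hm⟩ := h1
  have h2 : ∀ j, ReachIn E (m + j) x y := by
    intro j
    induction j with
    | zero => exact hm
    | succ j ih => exact ⟨x, hx, ih⟩
  refine ⟨m + (N * m - m), ?_, h2 _⟩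
  have : m ≤ N * m := Nat.le_mul_of_pos_left m hN
  rw [Nat.add_sub_cancel' this]
  exact dvd_mul_right _ _

variable (st : Equiv.Perm V)

theorem ReachIn.shift (hshift : ∀ x y, E (st (st x)) (st (st y)) → E x y) {m : ℕ} {x y : V}
    (h : ReachIn E m (st (st x)) (st (st y))) : ReachIn E m x y := by
  induction m generalizing x with
  | zero => exact st.injective (st.injective h)
  | succ m ih =>
    obtain ⟨u, hu, h⟩ := h
    obtain ⟨v, rfl⟩ : ∃ v, st (st v) = u := ⟨st.symm (st.symm u), by simp⟩
    exact ⟨v, hshift _ _ hu, ih h⟩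

/-- The complement reverses paths. -/
theorem ReachIn.dual (hsymm : ∀ x w, E x (st w) → E w (st x))
    (hshift : ∀ x y, E (st (st x)) (st (st y)) → E x y) {m : ℕ} {x y : V}
    (h : ReachIn E m x y) : ReachIn E m ((st ^ (1 - 2 * m : ℤ)) y) (st x) := by
  induction m generalizing x with
  | zero =>
    obtain rfl : x = y := h
    simp [ReachIn]
  | succ m ih =>
    obtain ⟨u, hu, h⟩ := h
    have h1 := ih h
    obtain ⟨w, rfl⟩ := st.surjective u
    -- The reversed path ends at `st (st w)`; shifting it back by two complements makes it end at
    -- `w`, from which the reversed first edge leads to `st x`.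
    have h2 : ReachIn E m ((st ^ (1 - 2 * (m + 1 : ℕ) : ℤ)) y) w := by
      apply ReachIn.shift st hshift
      convert h1 using 1
      rw [← Equiv.Perm.mul_apply, ← Equiv.Perm.mul_apply, ← pow_two, ← zpow_natCast, ← zpow_add]
      congr 2
      push_cast
      ring
    exact h2.snoc (hsymm _ _ hu)

/-- The path from `x` to `y = st w` is `x → c ⇝ a ⇝ y₁ → st y₂ ⇝ st e → st w`. Here `x → c` and `w →
st (st e)` come from `hA`, the last arrow is the reversal of the latter, and `st y₂ ⇝ st e` is the
reversal of a path from `e` to `y₂` through `b`. -/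
theorem reflTransGen_of_dual [Finite V] (hsymm : ∀ x w, E x (st w) → E w (st x))
    (hshift : ∀ x y, E (st (st x)) (st (st y)) → E x y) {A : Set V}
    (hA : ∀ x, ∃ a ∈ A, E x a) (hloop : ∀ a ∈ A, E a a)
    (hAst : ∀ a ∈ A, ∃ b ∈ A, st (st b) = a)
    (hconn : ∀ a ∈ A, ∀ b ∈ A, Relation.ReflTransGen E a b) {a b y₁ y₂ : V} (ha : a ∈ A)
    (hb : b ∈ A) (h₁ : Relation.ReflTransGen E a y₁) (h₂ : Relation.ReflTransGen E b y₂)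
    (h₁₂ : E y₁ (st y₂)) (x y : V) : Relation.ReflTransGen E x y := by
  obtain ⟨c, hc, hxc⟩ := hA x
  obtain ⟨w, rfl⟩ := st.surjective y
  obtain ⟨d, hd, hwd⟩ := hA w
  obtain ⟨e, he, rfl⟩ := hAst d hd
  have hey : E (st e) (st w) := hsymm _ _ hwd
  -- Reversing a path of `m` steps twists its origin by `st ^ (1 - 2 * m)`; a length divisible by
  -- the order of `st` reduces the twist to `st`.
  obtain ⟨m, ⟨k, rfl⟩, hm⟩ := exists_reachIn_dvd (hloop e he) ((hconn e he b hb).trans h₂)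
    (orderOf_pos st)
  have h3 := hm.dual st hsymm hshift
  have h4 : st ^ (1 - 2 * (orderOf st * k : ℕ) : ℤ) = st := by
    rw [sub_eq_add_neg, zpow_add, zpow_one, zpow_neg]
    have : st ^ (2 * (orderOf st * k : ℕ) : ℤ) = 1 := by
      rw [mul_comm, Nat.cast_mul, mul_assoc, zpow_mul, zpow_natCast, pow_orderOf_eq_one, one_zpow]
    rw [this, inv_one, mul_one]
  rw [h4] at h3
  exact (Relation.ReflTransGen.head hxc (hconn c hc a ha)).trans
    (h₁.trans (.head h₁₂ (h3.reflTransGen.tail hey)))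

end Duality

/-! ### Complements in the Garside element, and reduction of connectivity to explicit simple
elements -/

section Complement

variable {t : BraidType} {n : ℕ}

namespace GarsideFacts

variable (hG : GarsideFacts t n)
include hG

theorem exists_complement (x : ProperSimple t n) :
    ∃ y : ProperSimple t n, x.1.1 * y.1.1 = garside t n := by
  obtain ⟨y, hy⟩ := x.1.2
  refine ⟨⟨⟨y, hG.isSimple_right (u := x.1.1) (hy ▸ dvd_rfl)⟩, ?_, ?_⟩, hy.symm⟩
  · rintro (rfl : y = 1)
    rw [mul_one] at hy
    exact x.2.2 hy.symm
  · rintro (rfl : y = garside t n)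
    have := congrArg braidLength hy
    rw [braidLength_mul] at this
    exact x.2.1 (eq_one_of_braidLength (by omega))

/-- The right complement of a simple braid with respect to the Garside element. -/
noncomputable def complement (x : ProperSimple t n) : ProperSimple t n :=
  Classical.choose (hG.exists_complement x)

theorem mul_complement (x : ProperSimple t n) : x.1.1 * (hG.complement x).1.1 = garside t n :=
  Classical.choose_spec (hG.exists_complement x)

theorem complement_bijective : Function.Bijective hG.complement := by
  refine (Finite.injective_iff_bijective).1 fun x y h => ?_
  have h1 := hG.mul_complement x
  rw [h] at h1
  exact Subtype.ext (Subtype.ext (hG.left_complement_unique _ _ _ h1 (hG.mul_complement y)))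

/-- The right complement as a permutation. -/
noncomputable def complementPerm : Equiv.Perm (ProperSimple t n) :=
  Equiv.ofBijective _ hG.complement_bijective

theorem complementPerm_apply (x : ProperSimple t n) : hG.complementPerm x = hG.complement x := rfl

theorem isSimple_mul_of_iff (x : ProperSimple t n) (a : BraidGen t n) :
    IsSimple (x.1.1 * braidOf a) ↔ braidOf a ∣ (hG.complement x).1.1 := by
  refine ⟨fun h => ?_, fun h => ?_⟩
  · exact hG.dvd_of_mul_dvd_mul (h.trans (hG.mul_complement x).symm.dvd)
  · exact (mul_dvd_mul_left _ h).trans (hG.mul_complement x).dvd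

/-- In this form an arrow says that `y` and the complement of `x` share no left divisor among the
generators. The condition is symmetric, which is why complements reverse arrows. -/
theorem arrow_iff_complement {x y : ProperSimple t n} :
    Arrow x.1 y.1 ↔ ∀ a, braidOf a ∣ y.1.1 → ¬ braidOf a ∣ (hG.complement x).1.1 := by
  simp_rw [← hG.isSimple_mul_of_iff]
  rfl

/-- Conjugation by the Garside element. -/
theorem garside_mul_complement_complement (x : ProperSimple t n) :
    x.1.1 * garside t n = garside t n * (hG.complement (hG.complement x)).1.1 := by
  calc x.1.1 * garside t n
      = x.1.1 * ((hG.complement x).1.1 * (hG.complement (hG.complement x)).1.1) :=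
        congrArg (x.1.1 * ·) (hG.mul_complement (hG.complement x)).symm
    _ = x.1.1 * (hG.complement x).1.1 * (hG.complement (hG.complement x)).1.1 :=
        (mul_assoc _ _ _).symm
    _ = _ := congrArg (· * (hG.complement (hG.complement x)).1.1) (hG.mul_complement x)

theorem dvd_complement_complement {x : ProperSimple t n} {a b : BraidGen t n}
    (hab : braidOf a * garside t n = garside t n * braidOf b) (h : braidOf a ∣ x.1.1) :
    braidOf b ∣ (hG.complement (hG.complement x)).1.1 := by
  obtain ⟨z, hz⟩ := h
  obtain ⟨z', hz'⟩ := hG.exists_conj z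
  refine ⟨z', hG.mul_left_cancel (garside t n) _ _ ?_⟩
  rw [← hG.garside_mul_complement_complement, hz, mul_assoc, hz', ← mul_assoc, hab, mul_assoc]

/-- The double complement is conjugation by `Δ`, which sends generators to generators. -/
theorem arrow_shift {x y : ProperSimple t n}
    (h : Arrow (hG.complement (hG.complement x)).1 (hG.complement (hG.complement y)).1) :
    Arrow x.1 y.1 := by
  rw [hG.arrow_iff_complement] at h ⊢
  intro a hy hx
  obtain ⟨b, hb⟩ := hG.conj_of a
  exact h b (hG.dvd_complement_complement hb hy) (hG.dvd_complement_complement hb hx)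

/-- The complement of `x` is not `Δ`, so some generator fails to divide it, and that generator may
follow `x`. -/
theorem exists_arrow_of {x : ProperSimple t n} :
    ∃ a : BraidGen t n, Arrow x.1 ⟨braidOf a, hG.isSimple_of a⟩ := by
  by_contra! hno
  refine (hG.complement x).2.2 (hG.eq_garside_of_forall_dvd (hG.complement x).1.2 fun a => ?_)
  rw [← hG.isSimple_mul_of_iff]
  by_contra hs
  refine hno a fun b hb => ?_
  have : braidOf b = braidOf a := braid_eq_of_dvd hb (by rw [braidLength_of, braidLength_of])
  change ¬ IsSimple (x.1.1 * braidOf b)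
  rwa [this]

theorem connected_of_dual (hproper : ∀ a : BraidGen t n, braidOf a ≠ garside t n)
    (hconn : ∀ x y : ProperSimple t n, braidLength x.1.1 = 1 → braidLength y.1.1 = 1 →
      Relation.ReflTransGen (fun a b : ProperSimple t n => Arrow a.1 b.1) x y)
    {a b y₁ y₂ : ProperSimple t n} (ha : braidLength a.1.1 = 1) (hb : braidLength b.1.1 = 1)
    (h₁ : Relation.ReflTransGen (fun a b : ProperSimple t n => Arrow a.1 b.1) a y₁)
    (h₂ : Relation.ReflTransGen (fun a b : ProperSimple t n => Arrow a.1 b.1) b y₂)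
    (h₁₂ : Arrow y₁.1 (hG.complement y₂).1) (x y : ProperSimple t n) :
    Relation.ReflTransGen (fun a b : ProperSimple t n => Arrow a.1 b.1) x y := by
  have hatom : ∀ x : ProperSimple t n, braidLength x.1.1 = 1 → ∃ a, x.1.1 = braidOf a := by
    intro x hx
    obtain ⟨a, ha⟩ := exists_braidOf_dvd x.2.1
    exact ⟨a, (braid_eq_of_dvd ha (by rw [hx, braidLength_of])).symm⟩
  have hne1 : ∀ c : BraidGen t n, braidOf c ≠ 1 := fun c h => by
    have := congrArg braidLength h
    rw [braidLength_of, braidLength_one] at this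
    omega
  have hlen : ∀ x : ProperSimple t n,
      braidLength (hG.complement (hG.complement x)).1.1 = braidLength x.1.1 := by
    intro x
    have := congrArg braidLength (hG.garside_mul_complement_complement x)
    rw [braidLength_mul, braidLength_mul] at this
    omega
  refine reflTransGen_of_dual hG.complementPerm (A := {x | braidLength x.1.1 = 1})
    ?_ ?_ ?_ ?_ ?_ ?_ ha hb h₁ h₂ h₁₂ x y
  · intro x w h
    rw [hG.arrow_iff_complement] at h ⊢
    exact fun a hx hw => h a hw hx
  · exact fun x y h => hG.arrow_shift h
  · intro x
    obtain ⟨a, ha⟩ := hG.exists_arrow_of (x := x)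
    exact ⟨⟨⟨braidOf a, hG.isSimple_of a⟩, hne1 a, hproper a⟩, braidLength_of a, ha⟩
  · intro x hx
    obtain ⟨a, ha⟩ := hatom x hx
    have : x.1 = ⟨braidOf a, hG.isSimple_of a⟩ := Subtype.ext ha
    rw [this]
    exact hG.arrow_of_self a
  · intro x hx
    refine ⟨hG.complementPerm.symm (hG.complementPerm.symm x), ?_, by simp⟩
    rw [Set.mem_ofPred_eq, ← hlen, ← complementPerm_apply, ← complementPerm_apply,
      Equiv.apply_symm_apply, Equiv.apply_symm_apply]
    exact hx
  · exact fun x hx y hy => hconn x y hx hy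

end GarsideFacts

namespace GermModel

variable {G : Type*} [Group G] (M : GermModel t n G)

/-- The arrows between simple elements of the germ. -/
def Step (g h : M.Simp) : Prop := h ≠ M.unit ∧ ∀ a, M.atom a ≤ h → ¬ M.atom a ≤ M.compl g

theorem lift_injective : Function.Injective M.lift := fun g h hgh =>
  Subtype.ext (by rw [← M.proj_lift, hgh, M.proj_lift])

theorem lift_ne_one {g : M.Simp} (h : g ≠ M.unit) : M.lift g ≠ 1 := fun h' =>
  h (M.lift_injective (h'.trans M.lift_unit.symm))

/-- The simple braid of a simple element. -/
noncomputable def simple (g : M.Simp) : SimpleBraid t n := ⟨M.lift g, M.isSimple_lift g⟩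

theorem isSimple_lift_mul_of {g : M.Simp} {a : BraidGen t n}
    (h : IsSimple (M.lift g * braidOf a)) : M.atom a ≤ M.compl g := by
  rw [IsSimple, M.garside_eq, ← M.lift_mul_quot (M.le_maxi g), ← M.lift_atom] at h
  exact M.lift_dvd_lift.1 (M.garsideFacts.dvd_of_mul_dvd_mul h)

theorem arrow_of_step {g h : M.Simp} (hs : M.Step g h) : Arrow (M.simple g) (M.simple h) := by
  intro a ha hsim
  refine hs.2 a ?_ (M.isSimple_lift_mul_of hsim)
  rw [← M.lift_dvd_lift, M.lift_atom]
  exact ha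

theorem proper_of_step {g h : M.Simp} (hg : M.lift g ≠ garside t n) (hs : M.Step g h) :
    M.lift h ≠ 1 ∧ M.lift h ≠ garside t n :=
  ⟨M.lift_ne_one hs.1, fun h' => hg (M.garsideFacts.eq_garside_of_arrow (x := M.simple g)
    (s := M.simple h) h' (M.arrow_of_step hs))⟩

theorem reflTransGen_of_step {g h : M.Simp} (hg : M.lift g ≠ 1 ∧ M.lift g ≠ garside t n)
    (hgh : Relation.ReflTransGen M.Step g h) :
    ∃ hh : M.lift h ≠ 1 ∧ M.lift h ≠ garside t n,
      Relation.ReflTransGen (fun a b : ProperSimple t n => Arrow a.1 b.1)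
        ⟨M.simple g, hg⟩ ⟨M.simple h, hh⟩ := by
  induction hgh with
  | refl => exact ⟨hg, .refl⟩
  | tail _ hs ih =>
    obtain ⟨hb, hp⟩ := ih
    exact ⟨M.proper_of_step hb.2 hs, hp.tail (M.arrow_of_step hs)⟩

/-- This leaves only computations with group elements: paths between atoms, paths from atoms to `g₁`
and `g₂`, and one arrow from `g₁` to the complement of `g₂`. -/
theorem connected (hproper : ∀ a : BraidGen t n, M.atom a ≠ M.maxi)
    (hatoms : ∀ a b, Relation.ReflTransGen M.Step (M.atom a) (M.atom b)) {a b : BraidGen t n}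
    {g₁ g₂ : M.Simp} (h₁ : Relation.ReflTransGen M.Step (M.atom a) g₁)
    (h₂ : Relation.ReflTransGen M.Step (M.atom b) g₂) (h₁₂ : M.Step g₁ (M.compl g₂))
    (x y : ProperSimple t n) :
    Relation.ReflTransGen (fun a b : ProperSimple t n => Arrow a.1 b.1) x y := by
  have hpa : ∀ a, M.lift (M.atom a) ≠ 1 ∧ M.lift (M.atom a) ≠ garside t n := by
    intro a
    refine ⟨fun h => ?_, fun h => hproper a (M.lift_injective (h.trans M.garside_eq))⟩
    have := congrArg braidLength h
    rw [M.lift_atom, braidLength_of, braidLength_one] at this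
    omega
  obtain ⟨hg₁, hr₁⟩ := M.reflTransGen_of_step (hpa a) h₁
  obtain ⟨hg₂, hr₂⟩ := M.reflTransGen_of_step (hpa b) h₂
  have hlen : ∀ a, braidLength (M.lift (M.atom a)) = 1 := fun a => by
    rw [M.lift_atom, braidLength_of]
  have hcompl : (M.garsideFacts.complement ⟨M.simple g₂, hg₂⟩).1 = M.simple (M.compl g₂) := by
    apply Subtype.ext
    apply M.garsideFacts.mul_left_cancel (M.lift g₂)
    refine (M.garsideFacts.mul_complement ⟨M.simple g₂, hg₂⟩).trans ?_
    rw [M.garside_eq]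
    exact (M.lift_mul_quot (M.le_maxi g₂)).symm
  refine M.garsideFacts.connected_of_dual (fun a => ?_) (fun x y hx hy => ?_)
    (hlen a) (hlen b) hr₁ hr₂ ?_ x y
  · rw [← M.lift_atom]
    exact (hpa a).2
  · have hatom : ∀ x : ProperSimple t n, braidLength x.1.1 = 1 →
        ∃ a, x = ⟨M.simple (M.atom a), hpa a⟩ := by
      intro x hx
      obtain ⟨a, ha⟩ := exists_braidOf_dvd x.2.1
      refine ⟨a, Subtype.ext (Subtype.ext ?_)⟩
      change x.1.1 = M.lift (M.atom a)
      rw [M.lift_atom]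
      exact (braid_eq_of_dvd ha (by rw [hx, braidLength_of])).symm
    obtain ⟨c, rfl⟩ := hatom x hx
    obtain ⟨d, rfl⟩ := hatom y hy
    exact (M.reflTransGen_of_step (hpa c) (hatoms c d)).2
  · rw [hcompl]
    exact M.arrow_of_step h₁₂

end GermModel

end Complement

/-! ### The symmetric group as a model of the simple positive braids -/

section Inversions

variable {n : ℕ}

/-- The pairs whose relative order is changed by a permutation. -/
def crossings (g : Equiv.Perm (Fin n)) : Finset (Fin n × Fin n) :=
  Finset.univ.filter fun p => ¬(p.1 < p.2 ↔ g⁻¹ p.1 < g⁻¹ p.2)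

/-- The number of inversions of a permutation. -/
def inversionLength (g : Equiv.Perm (Fin n)) : ℕ :=
  (Finset.univ.filter fun p : Fin n × Fin n => p.1 < p.2 ∧ g⁻¹ p.2 < g⁻¹ p.1).card

/-- Crossings are ordered pairs and form a symmetric set, so each inversion is counted twice. This
avoids tracking the order of the images in the next lemma. -/
theorem card_crossings (g : Equiv.Perm (Fin n)) :
    (crossings g).card = 2 * inversionLength g := by
  classical
  have h : crossings g =
      (Finset.univ.filter fun p : Fin n × Fin n => p.1 < p.2 ∧ g⁻¹ p.2 < g⁻¹ p.1) ∪
      (Finset.univ.filter fun p : Fin n × Fin n => p.1 < p.2 ∧ g⁻¹ p.2 < g⁻¹ p.1).map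
        (Equiv.prodComm _ _).toEmbedding := by
    ext ⟨i, j⟩
    simp only [crossings, Finset.mem_filter, Finset.mem_univ, true_and, Finset.mem_union,
      Finset.mem_map_equiv, Equiv.prodComm_symm, Equiv.prodComm_apply, Prod.swap_prod_mk]
    rcases lt_trichotomy i j with h | rfl | h
    · have : g⁻¹ i ≠ g⁻¹ j := fun h' => h.ne (g⁻¹.injective h')
      have := lt_or_gt_of_ne this
      have h1 := h.not_gt
      simp only [h, h1, true_iff, true_and, false_and, or_false, not_lt]
      exact ⟨fun h => by omega, fun h => h.le⟩
    · simp
    · have : g⁻¹ i ≠ g⁻¹ j := fun h' => h.ne' (g⁻¹.injective h')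
      have := lt_or_gt_of_ne this
      have h1 := h.not_gt
      simp only [h, h1, false_iff, true_and, false_and, false_or, not_not]
  rw [h, Finset.card_union_of_disjoint, Finset.card_map, inversionLength, two_mul]
  rw [Finset.disjoint_left]
  rintro ⟨i, j⟩ h1 h2
  simp only [Finset.mem_filter, Finset.mem_univ, true_and, Finset.mem_map_equiv,
    Equiv.prodComm_symm, Equiv.prodComm_apply, Prod.swap_prod_mk] at h1 h2
  exact h1.1.not_gt h2.1

/-- The bijection applies `g` to both coordinates: a pair changes order under exactly one of `g⁻¹`,
`h⁻¹` when the two images are ordered differently. -/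
theorem card_crossings_inv_mul (g h : Equiv.Perm (Fin n)) :
    (crossings (g⁻¹ * h)).card = (symmDiff (crossings g) (crossings h)).card := by
  classical
  refine Finset.card_equiv (Equiv.prodCongr g g) fun ⟨i, j⟩ => ?_
  simp only [crossings, Finset.mem_filter, Finset.mem_univ, true_and, Finset.mem_symmDiff,
    Equiv.prodCongr_apply, Prod.map_apply, mul_inv_rev, inv_inv, Equiv.Perm.mul_apply]
  have e : ∀ x, g⁻¹ (g x) = x := fun x => g.symm_apply_apply x
  rw [e, e]
  tauto

theorem inversionLength_mul_le (g h : Equiv.Perm (Fin n)) :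
    inversionLength (g * h) ≤ inversionLength g + inversionLength h := by
  classical
  have h1 := card_crossings_inv_mul g (g * h)
  rw [inv_mul_cancel_left] at h1
  have h2 : crossings (g * h) ⊆ crossings g ∪ symmDiff (crossings g) (crossings (g * h)) := by
    intro p hp
    simp only [Finset.mem_union, Finset.mem_symmDiff]
    tauto
  have h3 := (Finset.card_le_card h2).trans (Finset.card_union_le _ _)
  rw [← h1, card_crossings, card_crossings, card_crossings] at h3
  omega

/-- Lengths add exactly when the symmetric difference of the crossing sets is as small as their
sizes allow, that is, when one contains the other. -/
theorem prefixLE_inversionLength_iff {g h : Equiv.Perm (Fin n)} :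
    PrefixLE inversionLength g h ↔ ∀ i j, i < j → g⁻¹ j < g⁻¹ i → h⁻¹ j < h⁻¹ i := by
  classical
  have h1 := card_crossings_inv_mul g h
  have h2 : (symmDiff (crossings g) (crossings h)).card =
      (crossings g \ crossings h).card + (crossings h \ crossings g).card := by
    rw [symmDiff_def, Finset.sup_eq_union, Finset.card_union_of_disjoint]
    exact disjoint_sdiff_sdiff
  have h3 := Finset.card_sdiff_add_card_inter (crossings g) (crossings h)
  have h4 := Finset.card_sdiff_add_card_inter (crossings h) (crossings g)
  rw [Finset.inter_comm] at h4
  rw [card_crossings] at h1 h3 h4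
  have h5 : PrefixLE inversionLength g h ↔ crossings g \ crossings h = ∅ := by
    rw [← Finset.card_eq_zero, PrefixLE]
    omega
  rw [h5, Finset.sdiff_eq_empty_iff_subset]
  refine ⟨fun hs i j hij hg => ?_, ?_⟩
  · have : (i, j) ∈ crossings h := hs (by
      simp only [crossings, Finset.mem_filter, Finset.mem_univ, true_and]
      omega)
    have hne : h⁻¹ i ≠ h⁻¹ j := fun h' => hij.ne (h⁻¹.injective h')
    simp only [crossings, Finset.mem_filter, Finset.mem_univ, true_and] at this
    omega
  · rintro hs ⟨i, j⟩ hp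
    simp only [crossings, Finset.mem_filter, Finset.mem_univ, true_and] at hp ⊢
    rcases lt_trichotomy i j with h | rfl | h
    · have := hs i j h
      have hne : g⁻¹ i ≠ g⁻¹ j := fun h' => h.ne (g⁻¹.injective h')
      omega
    · simp at hp
    · have := hs j i h
      omega

theorem perm_eq_one_of_strictMono {g : Equiv.Perm (Fin n)} (h : StrictMono ⇑g⁻¹) :
    g = 1 := by
  have h1 : (StrictMono.orderIsoOfSurjective _ h g⁻¹.surjective) = OrderIso.refl _ :=
    Subsingleton.elim _ _
  rw [← inv_inj, inv_one]
  ext i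
  exact congrArg Fin.val (congrArg (fun e : Fin n ≃o Fin n => e i) h1)

/-- The left endpoint of an Artin generator. -/
def artinLeft (a : Fin (n - 1)) : Fin n := ⟨a, by omega⟩

/-- The right endpoint of an Artin generator. -/
def artinRight (a : Fin (n - 1)) : Fin n := ⟨a + 1, by omega⟩

/-- The simple transposition of an Artin generator. -/
def artinSwap (a : Fin (n - 1)) : Equiv.Perm (Fin n) := Equiv.swap (artinLeft a) (artinRight a)

theorem artinSwap_inv (a : Fin (n - 1)) : (artinSwap a)⁻¹ = artinSwap a := Equiv.swap_inv _ _

theorem artinSwap_mul_self (a : Fin (n - 1)) : artinSwap a * artinSwap a = 1 :=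
  Equiv.swap_mul_self _ _

theorem artinSwap_val (a : Fin (n - 1)) (x : Fin n) :
    ((artinSwap a x : Fin n) : ℕ) =
      if (x : ℕ) = a then (a : ℕ) + 1 else if (x : ℕ) = a + 1 then (a : ℕ) else x := by
  simp only [artinSwap, Equiv.swap_apply_def, artinLeft, artinRight, Fin.ext_iff]
  split_ifs <;> rfl

theorem artinSwap_of_ne (a : Fin (n - 1)) {x : Fin n} (h : (x : ℕ) ≠ a) (h' : (x : ℕ) ≠ a + 1) :
    artinSwap a x = x :=
  Fin.ext (by rw [artinSwap_val, if_neg h, if_neg h'])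

theorem artinSwap_left (a : Fin (n - 1)) : artinSwap a (artinLeft a) = artinRight a :=
  Equiv.swap_apply_left _ _

theorem artinSwap_right (a : Fin (n - 1)) : artinSwap a (artinRight a) = artinLeft a :=
  Equiv.swap_apply_right _ _

theorem artinLeft_lt_right (a : Fin (n - 1)) : artinLeft a < artinRight a := Nat.lt_succ_self _

theorem artinSwap_lt {a : Fin (n - 1)} {i j : Fin n} (hij : i < j)
    (h : artinSwap a j < artinSwap a i) : i = artinLeft a ∧ j = artinRight a := by
  rw [Fin.lt_def] at hij h
  rw [artinSwap_val, artinSwap_val] at h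
  constructor <;> ext <;> simp only [artinLeft, artinRight] <;> split_ifs at h <;> omega

theorem prefixLE_artinSwap_iff {a : Fin (n - 1)} {g : Equiv.Perm (Fin n)} :
    PrefixLE inversionLength (artinSwap a) g ↔ g⁻¹ (artinRight a) < g⁻¹ (artinLeft a) := by
  rw [prefixLE_inversionLength_iff, artinSwap_inv]
  refine ⟨fun h => h _ _ (artinLeft_lt_right a) ?_, fun h i j hij ha => ?_⟩
  · rw [artinSwap_left, artinSwap_right]
    exact artinLeft_lt_right a
  · obtain ⟨rfl, rfl⟩ := artinSwap_lt hij ha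
    exact h

theorem inversionLength_artinSwap (a : Fin (n - 1)) : inversionLength (artinSwap a) = 1 := by
  rw [inversionLength, Finset.card_eq_one]
  refine ⟨(artinLeft a, artinRight a), ?_⟩
  ext ⟨i, j⟩
  simp only [Finset.mem_filter, Finset.mem_univ, true_and, Finset.mem_singleton, Prod.mk.injEq,
    artinSwap_inv]
  refine ⟨fun h => artinSwap_lt h.1 h.2, ?_⟩
  rintro ⟨rfl, rfl⟩
  rw [artinSwap_left, artinSwap_right]
  exact ⟨artinLeft_lt_right a, artinLeft_lt_right a⟩

theorem strictMono_of_artin {f : Fin n → Fin n}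
    (h : ∀ a : Fin (n - 1), f (artinLeft a) < f (artinRight a)) : StrictMono f := by
  cases n with
  | zero => exact fun i => i.elim0
  | succ m => exact Fin.strictMono_iff_lt_succ.2 fun i => h i

theorem prefixLE_revPerm (g : Equiv.Perm (Fin n)) : PrefixLE inversionLength g Fin.revPerm := by
  rw [prefixLE_inversionLength_iff]
  intro i j hij _
  exact Fin.rev_lt_rev.2 hij

theorem artinSwap_comm {a b : Fin (n - 1)} (h : (a : ℕ) + 2 ≤ b) :
    artinSwap a * artinSwap b = artinSwap b * artinSwap a := by
  ext x
  simp only [Equiv.Perm.mul_apply, artinSwap_val]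
  split_ifs <;> omega

theorem artinSwap_braid {a b : Fin (n - 1)} (h : (a : ℕ) + 1 = b) :
    artinSwap a * artinSwap b * artinSwap a = artinSwap b * artinSwap a * artinSwap b := by
  have e : artinRight a = artinLeft b := Fin.ext h
  have h1 := artinLeft_lt_right a
  have h2 := artinLeft_lt_right b
  rw [artinSwap, artinSwap, e, Equiv.swap_mul_swap_mul_swap (e ▸ h1.ne) ((e ▸ h1).trans h2).ne,
    Equiv.swap_comm (artinLeft a) (artinLeft b), Equiv.swap_comm (artinLeft b) (artinRight b),
    Equiv.swap_mul_swap_mul_swap h2.ne' ((e ▸ h1).trans h2).ne', Equiv.swap_comm]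

theorem prefixLE_artinSwap_mul_comm {a b : Fin (n - 1)} {u : Equiv.Perm (Fin n)}
    (h : (a : ℕ) + 2 ≤ b ∨ (b : ℕ) + 2 ≤ a) (ha : PrefixLE inversionLength (artinSwap a) u)
    (hb : PrefixLE inversionLength (artinSwap b) u) :
    PrefixLE inversionLength (artinSwap a * artinSwap b) u ∧
      inversionLength (artinSwap a * artinSwap b) = 2 := by
  have h1 := ha.mul (a := artinSwap b) inversionLength_mul_le (by
    rw [prefixLE_artinSwap_iff] at hb ⊢
    rw [mul_inv_rev, inv_inv, Equiv.Perm.mul_apply, Equiv.Perm.mul_apply,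
      artinSwap_of_ne _ (by simp only [artinRight]; omega) (by simp only [artinRight]; omega),
      artinSwap_of_ne _ (by simp only [artinLeft]; omega) (by simp only [artinLeft]; omega)]
    exact hb)
  rw [inversionLength_artinSwap, inversionLength_artinSwap] at h1
  exact h1

/-- The permutation `u⁻¹` reverses three consecutive points, so each of the three transpositions is
still a prefix of what remains of `u`. -/
theorem prefixLE_artinSwap_mul_braid {a b : Fin (n - 1)} {u : Equiv.Perm (Fin n)}
    (h : (a : ℕ) + 1 = b) (ha : PrefixLE inversionLength (artinSwap a) u)
    (hb : PrefixLE inversionLength (artinSwap b) u) :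
    PrefixLE inversionLength (artinSwap a * artinSwap b * artinSwap a) u ∧
      inversionLength (artinSwap a * artinSwap b * artinSwap a) = 3 := by
  have e1 : artinRight a = artinLeft b := Fin.ext h
  have e2 : artinSwap a (artinRight b) = artinRight b :=
    artinSwap_of_ne _ (by simp only [artinRight]; omega) (by simp only [artinRight]; omega)
  have e3 : artinSwap b (artinLeft a) = artinLeft a :=
    artinSwap_of_ne _ (by simp only [artinLeft]; omega) (by simp only [artinLeft]; omega)
  have ha' := prefixLE_artinSwap_iff.1 ha
  have hb' := prefixLE_artinSwap_iff.1 hb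
  have h1 := ha.mul (a := artinSwap b) inversionLength_mul_le (by
    rw [prefixLE_artinSwap_iff, mul_inv_rev, inv_inv, Equiv.Perm.mul_apply, Equiv.Perm.mul_apply,
      e2, ← e1, artinSwap_right]
    exact (hb'.trans_eq (by rw [e1])).trans ha')
  have h2 := h1.1.mul (a := artinSwap a) inversionLength_mul_le (by
    rw [prefixLE_artinSwap_iff, mul_inv_rev, inv_inv, Equiv.Perm.mul_apply, Equiv.Perm.mul_apply,
      Equiv.Perm.mul_apply, Equiv.Perm.mul_apply, e3, artinSwap_left, e1, artinSwap_left, e2]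
    exact hb')
  rw [h1.2, inversionLength_artinSwap, inversionLength_artinSwap] at h2
  exact h2

theorem artinSwap_mul_revPerm (a : Fin (n - 1)) :
    ∃ b : Fin (n - 1), artinSwap a * Fin.revPerm = Fin.revPerm * artinSwap b := by
  have ha := a.2
  refine ⟨⟨n - 2 - a, by omega⟩, ?_⟩
  ext x
  have := x.2
  simp only [Equiv.Perm.mul_apply, artinSwap_val, Fin.revPerm_apply, Fin.val_rev]
  split_ifs <;> omega

end Inversions

/-! ### The weak order as a germ model of the positive braids -/

/-- The projection of positive braids to permutations. -/
noncomputable def artinProj (n : ℕ) : Braid .artin n →* Equiv.Perm (Fin n) :=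
  PresentedMonoid.lift (fun a : Fin (n - 1) => artinSwap a) (by
    intro u v h
    cases h with
    | comm i j h => simpa using artinSwap_comm h
    | braid i j h => simpa using artinSwap_braid h)

theorem artinProj_of {n : ℕ} (a : BraidGen .artin n) : artinProj n (braidOf a) = artinSwap a := rfl

theorem braidOf_artin_comm {n : ℕ} {a b : BraidGen .artin n} (h : (a : Fin (n - 1)).val + 2 ≤
    (b : Fin (n - 1)).val) : braidOf a * braidOf b = braidOf b * braidOf a :=
  PresentedMonoid.mk_eq_mk_of_rel (rels := braidRel .artin n) (ArtinRel.comm a b h)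

theorem braidOf_artin_braid {n : ℕ} {a b : BraidGen .artin n} (h : (a : Fin (n - 1)).val + 1 =
    (b : Fin (n - 1)).val) :
    braidOf a * braidOf b * braidOf a = braidOf b * braidOf a * braidOf b :=
  PresentedMonoid.mk_eq_mk_of_rel (rels := braidRel .artin n) (ArtinRel.braid a b h)

theorem AtomsLinked.symm {t : BraidType} {n : ℕ} {G : Type*} [Group G] {len : G → ℕ} {top : G}
    {proj : Braid t n →* G} {a b : BraidGen t n} (h : AtomsLinked len top proj a b) :
    AtomsLinked len top proj b a := by
  obtain ⟨p, r, hpr, hlen, hle, hlub⟩ := h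
  exact ⟨r, p, hpr.symm, hpr ▸ hlen, hpr ▸ hle, fun u hu hb ha => hpr ▸ hlub u hu ha hb⟩

theorem atomsLinked_self {t : BraidType} {n : ℕ} {G : Type*} [Group G] {len : G → ℕ} {top : G}
    {proj : Braid t n →* G} {a : BraidGen t n} (h1 : len (proj (braidOf a)) = 1)
    (h2 : PrefixLE len (proj (braidOf a)) top) : AtomsLinked len top proj a a := by
  refine ⟨1, 1, rfl, ?_⟩
  rw [mul_one]
  exact ⟨h1, h2, fun u _ hu _ => hu⟩

theorem atomsLinked_artin_of_lt {n : ℕ} {a b : BraidGen .artin n} (h : (a : Fin (n - 1)).val <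
    (b : Fin (n - 1)).val) : AtomsLinked inversionLength Fin.revPerm (artinProj n) a b := by
  have ht := fun g : Equiv.Perm (Fin n) => prefixLE_revPerm g
  rcases Nat.lt_or_ge ((a : Fin (n - 1)).val + 1) (b : Fin (n - 1)).val with h' | h'
  · refine ⟨braidOf b, braidOf a, braidOf_artin_comm h', ?_, ht _, fun u _ ha hb => ?_⟩
    · rw [map_mul, artinProj_of, artinProj_of, braidLength_mul, braidLength_of, braidLength_of]
      exact (prefixLE_artinSwap_mul_comm (Or.inl h') (ht _) (ht _)).2
    · rw [map_mul]
      exact (prefixLE_artinSwap_mul_comm (Or.inl h') ha hb).1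
  · have h'' : (a : Fin (n - 1)).val + 1 = (b : Fin (n - 1)).val := le_antisymm h h'
    refine ⟨braidOf b * braidOf a, braidOf a * braidOf b, ?_, ?_, ht _, fun u _ ha hb => ?_⟩
    · rw [← mul_assoc, ← mul_assoc]
      exact braidOf_artin_braid h''
    · rw [← mul_assoc, map_mul, map_mul, artinProj_of, artinProj_of, braidLength_mul,
        braidLength_mul, braidLength_of, braidLength_of]
      exact (prefixLE_artinSwap_mul_braid h'' (ht _) (ht _)).2
    · rw [← mul_assoc, map_mul, map_mul]
      exact (prefixLE_artinSwap_mul_braid h'' ha hb).1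

theorem atomsLinked_artin {n : ℕ} (a b : BraidGen .artin n) :
    AtomsLinked inversionLength Fin.revPerm (artinProj n) a b := by
  rcases lt_trichotomy (a : Fin (n - 1)).val (b : Fin (n - 1)).val with h | h | h
  · exact atomsLinked_artin_of_lt h
  · obtain rfl : a = b := Fin.ext h
    exact atomsLinked_self (inversionLength_artinSwap _) (prefixLE_revPerm _)
  · exact (atomsLinked_artin_of_lt h).symm

/-- The permutations model the simple positive braids. -/
noncomputable def artinModel (n : ℕ) : GermModel .artin n (Equiv.Perm (Fin n)) where
  len := inversionLength
  top := Fin.revPerm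
  proj := artinProj n
  len_one := by
    rw [inversionLength, Finset.card_eq_zero, Finset.filter_eq_empty_iff]
    rintro p - ⟨h1, h2⟩
    exact h1.not_gt h2
  len_mul_le := inversionLength_mul_le
  eq_one_of_len g hg := by
    rw [inversionLength, Finset.card_eq_zero, Finset.filter_eq_empty_iff] at hg
    refine perm_eq_one_of_strictMono fun i j hij => ?_
    have h1 := hg (Finset.mem_univ (i, j))
    have h2 : g⁻¹ i ≠ g⁻¹ j := fun h => hij.ne (g⁻¹.injective h)
    simp only [hij, true_and, not_lt] at h1
    exact lt_of_le_of_ne h1 h2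
  len_atom := inversionLength_artinSwap
  balanced _ _ _ _ := prefixLE_revPerm _
  exists_atom g _ hg := by
    by_contra! hno
    refine hg (perm_eq_one_of_strictMono (strictMono_of_artin fun a => ?_))
    have h1 := not_lt.1 (mt prefixLE_artinSwap_iff.2 (hno a))
    exact lt_of_le_of_ne h1 fun h => (artinLeft_lt_right a).ne (g⁻¹.injective h)
  linked a b := ⟨b, atomsLinked_artin a b, atomsLinked_artin b b, fun _ _ _ hb => hb⟩
  rel_reduced u v h := by
    refine ⟨prefixLE_revPerm _, ?_⟩
    cases h with
    | comm i j h =>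
      exact (prefixLE_artinSwap_mul_comm (Or.inl h) (prefixLE_revPerm _) (prefixLE_revPerm _)).2
    | braid i j h =>
      exact (prefixLE_artinSwap_mul_braid h (prefixLE_revPerm _) (prefixLE_revPerm _)).2
  atom_le_top _ := prefixLE_revPerm _
  -- If `u` has all atoms below it, then `u⁻¹` decreases at every step; composed with the reversal
  -- it is increasing, hence trivial.
  eq_top u _ hu := by
    have h1 : u * Fin.revPerm = 1 := by
      refine perm_eq_one_of_strictMono (strictMono_of_artin fun a => ?_)
      rw [mul_inv_rev, Equiv.Perm.mul_apply, Equiv.Perm.mul_apply]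
      exact Fin.rev_lt_rev.2 (prefixLE_artinSwap_iff.1 (hu a))
    rw [mul_eq_one_iff_eq_inv] at h1
    exact h1
  atom_sq := artinSwap_mul_self
  conj_atom a := artinSwap_mul_revPerm a

/-! ### Connectivity for positive braids -/

section Artin

variable {n : ℕ}

/-- A permutation as a simple element of the model of positive braids. -/
noncomputable def artinSimp (g : Equiv.Perm (Fin n)) : (artinModel n).Simp := ⟨g, prefixLE_revPerm g⟩

theorem artin_atom_le_compl_iff {a : Fin (n - 1)} {g : Equiv.Perm (Fin n)} :
    (artinModel n).atom a ≤ (artinModel n).compl (artinSimp g) ↔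
      g (artinLeft a) < g (artinRight a) := by
  refine (prefixLE_artinSwap_iff (a := a) (g := g⁻¹ * Fin.revPerm)).trans ?_
  rw [mul_inv_rev, inv_inv]
  exact Fin.rev_lt_rev

/-- Arrows compare descents: those of `h⁻¹` must be among those of `g`. -/
theorem artin_step_iff {g h : Equiv.Perm (Fin n)} :
    (artinModel n).Step (artinSimp g) (artinSimp h) ↔ h ≠ 1 ∧ ∀ a : Fin (n - 1),
      h⁻¹ (artinRight a) < h⁻¹ (artinLeft a) → g (artinRight a) < g (artinLeft a) := by
  refine and_congr (not_congr Subtype.ext_iff) (forall_congr' fun a => ?_)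
  refine imp_congr (prefixLE_artinSwap_iff (a := a) (g := h)) ?_
  refine (not_congr artin_atom_le_compl_iff).trans ?_
  have : g (artinLeft a) ≠ g (artinRight a) := fun h => (artinLeft_lt_right a).ne (g.injective h)
  omega

theorem artin_step_of_descent {a : Fin (n - 1)} {g h : Equiv.Perm (Fin n)} (hne : h ≠ 1)
    (hg : g (artinRight a) < g (artinLeft a))
    (h1 : ∀ b : Fin (n - 1), b ≠ a → h⁻¹ (artinLeft b) < h⁻¹ (artinRight b)) :
    (artinModel n).Step (artinSimp g) (artinSimp h) := by
  refine artin_step_iff.2 ⟨hne, fun b hb => ?_⟩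
  rcases eq_or_ne b a with rfl | hba
  · exact hg
  · exact absurd hb (h1 b hba).not_gt

/-- The path is `σ_a → σ_a σ_b → σ_b`: the middle element starts only with `σ_a` and ends with
`σ_b`. -/
theorem artin_reach_neighbour {a b : Fin (n - 1)} (hab : (a : ℕ) + 1 = b ∨ (b : ℕ) + 1 = a) :
    Relation.ReflTransGen (artinModel n).Step ((artinModel n).atom a) ((artinModel n).atom b) := by
  have hsr : ∀ c : Fin (n - 1), artinSwap c (artinRight c) < artinSwap c (artinLeft c) := by
    intro c
    rw [artinSwap_left, artinSwap_right]
    exact artinLeft_lt_right c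
  have hne : artinSwap b ≠ 1 := fun h => by
    have := hsr b
    rw [h] at this
    exact (artinLeft_lt_right b).not_gt this
  refine .head (b := artinSimp (artinSwap a * artinSwap b))
    (artin_step_of_descent (a := a) ?_ (hsr a) ?_) (.single
      (artin_step_of_descent (a := b) (h := artinSwap b) hne ?_ ?_))
  · intro h
    have h1 := congrArg (fun g => ((g (artinLeft b) : Fin n) : ℕ)) h
    simp only [Equiv.Perm.mul_apply, artinSwap_val, artinLeft, Equiv.Perm.one_apply] at h1
    split_ifs at h1 <;> omega
  · intro c hc
    have hc' : (c : ℕ) ≠ a := fun h => hc (Fin.ext h)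
    rw [mul_inv_rev, artinSwap_inv, artinSwap_inv, Fin.lt_def]
    simp only [Equiv.Perm.mul_apply, artinSwap_val, artinLeft, artinRight]
    split_ifs <;> omega
  · rw [Fin.lt_def]
    simp only [Equiv.Perm.mul_apply, artinSwap_val, artinLeft, artinRight]
    split_ifs <;> omega
  · intro c hc
    have hc' : (c : ℕ) ≠ b := fun h => hc (Fin.ext h)
    rw [artinSwap_inv, Fin.lt_def]
    simp only [artinSwap_val, artinLeft, artinRight]
    split_ifs <;> omega

theorem artin_reach_atom (a b : BraidGen .artin n) :
    Relation.ReflTransGen (artinModel n).Step ((artinModel n).atom a) ((artinModel n).atom b) := by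
  have h0 : 0 < n - 1 := (a : Fin (n - 1)).pos
  have key : ∀ k (hk : k < n - 1),
      Relation.ReflTransGen (artinModel n).Step ((artinModel n).atom (⟨k, hk⟩ : Fin (n - 1)))
        ((artinModel n).atom (⟨0, h0⟩ : Fin (n - 1))) ∧
      Relation.ReflTransGen (artinModel n).Step ((artinModel n).atom (⟨0, h0⟩ : Fin (n - 1)))
        ((artinModel n).atom (⟨k, hk⟩ : Fin (n - 1))) := by
    intro k
    induction k with
    | zero => exact fun hk => ⟨.refl, .refl⟩
    | succ k ih =>
      intro hk
      obtain ⟨h1, h2⟩ := ih (by omega)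
      exact ⟨(artin_reach_neighbour (Or.inr rfl)).trans h1,
        h2.trans (artin_reach_neighbour (Or.inl rfl))⟩
  exact (key _ (a : Fin (n - 1)).2).1.trans (key _ (b : Fin (n - 1)).2).2

/-- The riffle shuffle that keeps the outer cards in place. -/
def outShuffle (n : ℕ) : Equiv.Perm (Fin n) where
  toFun x := ⟨if (x : ℕ) % 2 = 0 then x / 2 else (n + 1) / 2 + x / 2, by
    have := x.2
    split_ifs <;> omega⟩
  invFun v := ⟨if (v : ℕ) < (n + 1) / 2 then 2 * v else 2 * (v - (n + 1) / 2) + 1, by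
    have := v.2
    split_ifs <;> omega⟩
  left_inv x := by
    have := x.2
    ext
    simp only
    split_ifs <;> omega
  right_inv v := by
    have := v.2
    ext
    simp only
    split_ifs <;> omega

/-- The riffle shuffle that moves the outer cards. -/
def inShuffle (n : ℕ) : Equiv.Perm (Fin n) where
  toFun x := ⟨if (x : ℕ) % 2 = 0 then n / 2 + x / 2 else x / 2, by
    have := x.2
    split_ifs <;> omega⟩
  invFun v := ⟨if (v : ℕ) < n / 2 then 2 * v + 1 else 2 * (v - n / 2), by
    have := v.2
    split_ifs <;> omega⟩
  left_inv x := by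
    have := x.2
    ext
    simp only
    split_ifs <;> omega
  right_inv v := by
    have := v.2
    ext
    simp only
    split_ifs <;> omega

theorem outShuffle_val (x : Fin n) : ((outShuffle n x : Fin n) : ℕ) =
    if (x : ℕ) % 2 = 0 then (x : ℕ) / 2 else (n + 1) / 2 + x / 2 := rfl

theorem outShuffle_inv_val (v : Fin n) : (((outShuffle n)⁻¹ v : Fin n) : ℕ) =
    if (v : ℕ) < (n + 1) / 2 then 2 * (v : ℕ) else 2 * (v - (n + 1) / 2) + 1 := rfl

theorem inShuffle_val (x : Fin n) : ((inShuffle n x : Fin n) : ℕ) =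
    if (x : ℕ) % 2 = 0 then n / 2 + (x : ℕ) / 2 else x / 2 := rfl

theorem inShuffle_inv_val (v : Fin n) : (((inShuffle n)⁻¹ v : Fin n) : ℕ) =
    if (v : ℕ) < n / 2 then 2 * (v : ℕ) + 1 else 2 * (v - n / 2) := rfl

theorem outShuffle_inv_lt {c : Fin (n - 1)} (hc : (c : ℕ) ≠ (n + 1) / 2 - 1) :
    (outShuffle n)⁻¹ (artinLeft c) < (outShuffle n)⁻¹ (artinRight c) := by
  have := c.2
  rw [Fin.lt_def, outShuffle_inv_val, outShuffle_inv_val]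
  simp only [artinLeft, artinRight]
  grind

theorem inShuffle_inv_lt {c : Fin (n - 1)} (hc : (c : ℕ) ≠ n / 2 - 1) :
    (inShuffle n)⁻¹ (artinLeft c) < (inShuffle n)⁻¹ (artinRight c) := by
  have := c.2
  rw [Fin.lt_def, inShuffle_inv_val, inShuffle_inv_val]
  simp only [artinLeft, artinRight]
  grind

theorem artinSwap_ne_revPerm (hn : 3 ≤ n) (a : Fin (n - 1)) : artinSwap a ≠ Fin.revPerm := by
  intro h
  have h2 := congrArg (fun g => ((g (⟨0, by omega⟩ : Fin n) : Fin n) : ℕ)) h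
  simp only [artinSwap_val, Fin.revPerm_apply, Fin.val_rev] at h2
  split_ifs at h2 <;> omega

/-- The inverse of a riffle shuffle has a single descent, so each shuffle can follow a single
generator. The out-shuffle ascends exactly at even positions and the in-shuffle exactly at odd ones,
which yields the arrow from the former to the complement of the latter. -/
theorem connected_artin (hn : 3 ≤ n) (x y : ProperSimple .artin n) :
    Relation.ReflTransGen (fun a b : ProperSimple .artin n => Arrow a.1 b.1) x y := by
  have hsr : ∀ c : Fin (n - 1), artinSwap c (artinRight c) < artinSwap c (artinLeft c) := by
    intro c
    rw [artinSwap_left, artinSwap_right]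
    exact artinLeft_lt_right c
  refine (artinModel n).connected ?_ artin_reach_atom
    (a := (⟨(n + 1) / 2 - 1, by omega⟩ : Fin (n - 1)))
    (b := (⟨n / 2 - 1, by omega⟩ : Fin (n - 1)))
    (g₁ := artinSimp (outShuffle n)) (g₂ := artinSimp (inShuffle n)) ?_ ?_ ?_ x y
  · intro a h
    have h1 : artinSwap (n := n) a = Fin.revPerm := congrArg Subtype.val h
    exact artinSwap_ne_revPerm hn _ h1
  · refine .single (artin_step_of_descent (a := ⟨(n + 1) / 2 - 1, by omega⟩) ?_ (hsr _) ?_)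
    · intro h
      have h1 := congrArg (fun g => ((g (⟨1, by omega⟩ : Fin n) : Fin n) : ℕ)) h
      simp only [outShuffle_val, Equiv.Perm.one_apply] at h1
      split_ifs at h1 <;> omega
    · intro c hc
      have hc' : (c : ℕ) ≠ (n + 1) / 2 - 1 := fun h => hc (Fin.ext h)
      exact outShuffle_inv_lt hc'
  · refine .single (artin_step_of_descent (a := ⟨n / 2 - 1, by omega⟩) ?_ (hsr _) ?_)
    · intro h
      have h1 := congrArg (fun g => ((g (⟨0, by omega⟩ : Fin n) : Fin n) : ℕ)) h
      simp only [inShuffle_val, Equiv.Perm.one_apply] at h1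
      split_ifs at h1 <;> omega
    · intro c hc
      have hc' : (c : ℕ) ≠ n / 2 - 1 := fun h => hc (Fin.ext h)
      exact inShuffle_inv_lt hc'
  · refine ⟨fun h => ?_, fun a h1 h2 => ?_⟩
    · have h1 : (inShuffle n)⁻¹ * Fin.revPerm = 1 := congrArg Subtype.val h
      rw [inv_mul_eq_one] at h1
      have h2 := congrArg (fun g => ((g (⟨0, by omega⟩ : Fin n) : Fin n) : ℕ)) h1
      simp only [inShuffle_val, Fin.revPerm_apply, Fin.val_rev] at h2
      split_ifs at h2 <;> omega
    · have h1 := artin_atom_le_compl_iff.1 h1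
      have h2 := artin_atom_le_compl_iff.1 h2
      rw [Fin.lt_def, inShuffle_val, inShuffle_val] at h1
      rw [Fin.lt_def, outShuffle_val, outShuffle_val] at h2
      have := (artinLeft (n := n) a).2
      have h3 : ((artinRight (n := n) a : Fin n) : ℕ) = (artinLeft (n := n) a : Fin n) + 1 := rfl
      have := (artinRight (n := n) a).2
      rw [h3] at h1 h2 this
      split_ifs at h1 h2 <;> omega

end Artin

/-! ### The absolute order on permutations -/

section AbsoluteOrder

variable {n : ℕ}

/-- The functions that are constant on the cycles of a permutation. -/
def fixSpace (g : Equiv.Perm (Fin n)) : Submodule ℝ (Fin n → ℝ) where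
  carrier := {v | ∀ x, v (g x) = v x}
  add_mem' {v w} hv hw x := by simp only [Pi.add_apply, hv x, hw x]
  zero_mem' _ := rfl
  smul_mem' a v hv x := by simp only [Pi.smul_apply, hv x]

theorem mem_fixSpace {g : Equiv.Perm (Fin n)} {v : Fin n → ℝ} :
    v ∈ fixSpace g ↔ ∀ x, v (g x) = v x := Iff.rfl

/-- The absolute length of a permutation: `n` minus its number of cycles. -/
noncomputable def reflLength (g : Equiv.Perm (Fin n)) : ℕ := n - Module.finrank ℝ (fixSpace g)

theorem reflLength_add_finrank (g : Equiv.Perm (Fin n)) :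
    reflLength g + Module.finrank ℝ (fixSpace g) = n := by
  have h := Submodule.finrank_le (fixSpace g)
  rw [Module.finrank_fin_fun] at h
  exact Nat.sub_add_cancel h

theorem fixSpace_inf_le (g h : Equiv.Perm (Fin n)) : fixSpace g ⊓ fixSpace h ≤ fixSpace (g * h) :=
  fun _ hv x => (hv.1 (h x)).trans (hv.2 x)

theorem fixSpace_inv (g : Equiv.Perm (Fin n)) : fixSpace g⁻¹ = fixSpace g := by
  ext v
  refine ⟨fun h x => ?_, fun h x => ?_⟩
  · have := h (g x)
    rw [show g⁻¹ (g x) = x from g.symm_apply_apply x] at this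
    exact this.symm
  · have := h (g⁻¹ x)
    rw [show g (g⁻¹ x) = x from g.apply_symm_apply x] at this
    exact this.symm

theorem finrank_sup_add_inf_fixSpace (g h : Equiv.Perm (Fin n)) :
    Module.finrank ℝ ↥(fixSpace g ⊔ fixSpace h) + Module.finrank ℝ ↥(fixSpace g ⊓ fixSpace h) =
      Module.finrank ℝ (fixSpace g) + Module.finrank ℝ (fixSpace h) :=
  Submodule.finrank_sup_add_finrank_inf_eq _ _

theorem finrank_le_n (W : Submodule ℝ (Fin n → ℝ)) : Module.finrank ℝ W ≤ n := by
  have h := Submodule.finrank_le W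
  rwa [Module.finrank_fin_fun] at h

/-- The length is the codimension of the fixed space, and codimension is subadditive under
intersection. -/
theorem reflLength_mul_le (g h : Equiv.Perm (Fin n)) :
    reflLength (g * h) ≤ reflLength g + reflLength h := by
  have h1 := Submodule.finrank_mono (fixSpace_inf_le g h)
  have h2 := finrank_sup_add_inf_fixSpace g h
  have h3 := finrank_le_n (fixSpace g ⊔ fixSpace h)
  have h4 := reflLength_add_finrank g
  have h5 := reflLength_add_finrank h
  have h6 := reflLength_add_finrank (g * h)
  omega

theorem reflLength_one : reflLength (1 : Equiv.Perm (Fin n)) = 0 := by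
  have h : fixSpace (1 : Equiv.Perm (Fin n)) = ⊤ := eq_top_iff.2 fun v _ x => rfl
  rw [reflLength, h, finrank_top, Module.finrank_fin_fun, Nat.sub_self]

theorem eq_one_of_reflLength {g : Equiv.Perm (Fin n)} (h : reflLength g = 0) : g = 1 := by
  have h1 : fixSpace g = ⊤ := by
    apply Submodule.eq_top_of_finrank_eq
    have := reflLength_add_finrank g
    rw [Module.finrank_fin_fun]
    omega
  refine Equiv.ext fun x => ?_
  have h2 : (Pi.single x 1 : Fin n → ℝ) ∈ fixSpace g := h1 ▸ Submodule.mem_top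
  have h3 := h2 x
  rw [Pi.single_eq_same] at h3
  by_contra hne
  rw [Pi.single_eq_of_ne (i := x) (i' := g x) hne] at h3
  exact zero_ne_one h3

theorem reflLength_conj (g k : Equiv.Perm (Fin n)) : reflLength (k⁻¹ * g * k) = reflLength g := by
  have key : ∀ g k : Equiv.Perm (Fin n), reflLength (k⁻¹ * g * k) ≤ reflLength g := by
    intro g k
    have h : Module.finrank ℝ (fixSpace g) ≤ Module.finrank ℝ (fixSpace (k⁻¹ * g * k)) := by
      refine LinearMap.finrank_le_finrank_of_injective
        (f := (LinearMap.funLeft ℝ ℝ k).restrict (p := fixSpace g)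
          (q := fixSpace (k⁻¹ * g * k)) ?_) ?_
      · intro v hv x
        simp only [LinearMap.funLeft_apply, Equiv.Perm.mul_apply]
        rw [show k (k⁻¹ (g (k x))) = g (k x) from k.apply_symm_apply _]
        exact hv (k x)
      · intro v w hvw
        ext x
        have : v.1 (k (k⁻¹ x)) = w.1 (k (k⁻¹ x)) := congrFun (congrArg Subtype.val hvw) (k⁻¹ x)
        rwa [show k (k⁻¹ x) = x from k.apply_symm_apply _] at this
    have h4 := reflLength_add_finrank g
    have h5 := reflLength_add_finrank (k⁻¹ * g * k)
    omega
  refine le_antisymm (key g k) ?_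
  have := key (k⁻¹ * g * k) k⁻¹
  rwa [inv_inv, mul_assoc, mul_assoc, mul_inv_cancel, mul_one, mul_inv_cancel_left] at this

theorem prefixLE_reflLength_iff {g h : Equiv.Perm (Fin n)} :
    PrefixLE reflLength g h ↔ Module.finrank ℝ (fixSpace g) +
      Module.finrank ℝ (fixSpace (g⁻¹ * h)) = n + Module.finrank ℝ (fixSpace h) := by
  have h4 := reflLength_add_finrank g
  have h5 := reflLength_add_finrank h
  have h6 := reflLength_add_finrank (g⁻¹ * h)
  rw [PrefixLE]
  omega

/-- One inclusion always holds; additivity of lengths forces equal dimensions. -/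
theorem fixSpace_inf_eq {g h : Equiv.Perm (Fin n)} (hgh : PrefixLE reflLength g h) :
    fixSpace g ⊓ fixSpace (g⁻¹ * h) = fixSpace h := by
  rw [prefixLE_reflLength_iff] at hgh
  have h1 := fixSpace_inf_le g (g⁻¹ * h)
  rw [mul_inv_cancel_left] at h1
  refine Submodule.eq_of_le_of_finrank_le h1 ?_
  have h2 := finrank_sup_add_inf_fixSpace g (g⁻¹ * h)
  have h3 := finrank_le_n (fixSpace g ⊔ fixSpace (g⁻¹ * h))
  omega

theorem fixSpace_le_of_prefixLE {g h : Equiv.Perm (Fin n)} (hgh : PrefixLE reflLength g h) :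
    fixSpace h ≤ fixSpace g := by
  rw [← fixSpace_inf_eq hgh]
  exact inf_le_left

/-- Writing `(g⁻¹ h)⁻¹ c = (h⁻¹ g h) (h⁻¹ c)` and using invariance of the length under conjugation
bounds it by `len g + len c - len h`, which is exactly what is needed. -/
theorem prefixLE_inv_mul {g h c : Equiv.Perm (Fin n)} (hgh : PrefixLE reflLength g h)
    (hc : PrefixLE reflLength h c) : PrefixLE reflLength (g⁻¹ * h) c := by
  have h1 := reflLength_mul_le (g⁻¹ * h) ((g⁻¹ * h)⁻¹ * c)
  have h2 := reflLength_mul_le (h⁻¹ * g * h) (h⁻¹ * c)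
  have e : h⁻¹ * g * h * (h⁻¹ * c) = (g⁻¹ * h)⁻¹ * c := by group
  rw [mul_inv_cancel_left] at h1
  rw [e, reflLength_conj] at h2
  unfold PrefixLE at *
  omega

/-- The operator `v ↦ v ∘ g⁻¹ - v`. -/
noncomputable def moveMap (g : Equiv.Perm (Fin n)) : (Fin n → ℝ) →ₗ[ℝ] (Fin n → ℝ) :=
  LinearMap.funLeft ℝ ℝ ⇑g⁻¹ - LinearMap.id

theorem moveMap_apply (g : Equiv.Perm (Fin n)) (v : Fin n → ℝ) (x : Fin n) :
    moveMap g v x = v (g⁻¹ x) - v x := rfl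

theorem ker_moveMap (g : Equiv.Perm (Fin n)) : LinearMap.ker (moveMap g) = fixSpace g := by
  rw [← fixSpace_inv]
  ext v
  rw [LinearMap.mem_ker, mem_fixSpace, funext_iff]
  exact forall_congr' fun x => sub_eq_zero

theorem moveMap_single (g : Equiv.Perm (Fin n)) (x : Fin n) :
    moveMap g (Pi.single x 1) = Pi.single (g x) 1 - Pi.single x 1 := by
  ext y
  rw [moveMap_apply, Pi.sub_apply]
  congr 1
  by_cases h : y = g x
  · rw [h, Pi.single_eq_same, show g⁻¹ (g x) = x from g.symm_apply_apply x, Pi.single_eq_same]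
  · rw [Pi.single_eq_of_ne h, Pi.single_eq_of_ne]
    rintro rfl
    exact h (g.apply_symm_apply y).symm

/-- The indicator of a cycle of `u` is fixed by `g`, so `g x` lies in the cycle of `x`, and `e_{g x}
- e_x` telescopes along the powers of `u`. -/
theorem range_moveMap_le {g u : Equiv.Perm (Fin n)} (h : fixSpace u ≤ fixSpace g) :
    LinearMap.range (moveMap g) ≤ LinearMap.range (moveMap u) := by
  classical
  have hcycle : ∀ x, u.SameCycle x (g x) := by
    intro x
    have h1 : (fun y => if u.SameCycle x y then (1 : ℝ) else 0) ∈ fixSpace u := by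
      intro y
      simp only [Equiv.Perm.sameCycle_apply_right]
    have h2 := h h1 x
    simp only [Equiv.Perm.SameCycle.refl, if_true] at h2
    by_contra hno
    rw [if_neg hno] at h2
    exact zero_ne_one h2
  have hpow : ∀ (m : ℕ) (x : Fin n),
      (Pi.single ((u ^ m) x) 1 - Pi.single x 1 : Fin n → ℝ) ∈ LinearMap.range (moveMap u) := by
    intro m
    induction m with
    | zero => intro x; simp
    | succ m ih =>
      intro x
      have h1 := Submodule.add_mem _ (ih (u x)) ⟨_, moveMap_single u x⟩
      rwa [sub_add_sub_cancel, ← Equiv.Perm.mul_apply, ← pow_succ] at h1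
  rintro _ ⟨v, rfl⟩
  rw [pi_eq_sum_univ' v, map_sum]
  refine Submodule.sum_mem _ fun x _ => ?_
  rw [map_smul]
  refine Submodule.smul_mem _ _ ?_
  obtain ⟨m, hm⟩ := (hcycle x).exists_nat_pow_eq
  have h1 := hpow m x
  rw [hm, ← moveMap_single] at h1
  convert h1 using 2

/-- A vector fixed by `u⁻¹ c` is moved equally by `c` and `u`, which gives one inclusion;
rank-nullity and additivity of lengths give the other. The description makes `fixSpace (u⁻¹ c)`
monotone in the range of `moveMap u`. -/
theorem fixSpace_inv_mul_eq_comap {u c : Equiv.Perm (Fin n)} (hu : PrefixLE reflLength u c) :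
    fixSpace (u⁻¹ * c) = (LinearMap.range (moveMap u)).comap (moveMap c) := by
  refine Submodule.eq_of_le_of_finrank_le ?_ ?_
  · intro v hv
    refine ⟨v, ?_⟩
    ext x
    rw [moveMap_apply, moveMap_apply]
    have := hv (c⁻¹ x)
    rw [Equiv.Perm.mul_apply, show c (c⁻¹ x) = x from c.apply_symm_apply x] at this
    rw [this]
  · rw [prefixLE_reflLength_iff] at hu
    have h1 := LinearMap.finrank_range_add_finrank_ker (moveMap u)
    rw [ker_moveMap, Module.finrank_fin_fun] at h1
    have h2 := LinearMap.finrank_range_add_finrank_ker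
      ((moveMap c).domRestrict ((LinearMap.range (moveMap u)).comap (moveMap c)))
    have h3 : Module.finrank ℝ (LinearMap.range ((moveMap c).domRestrict
        ((LinearMap.range (moveMap u)).comap (moveMap c)))) ≤
        Module.finrank ℝ (LinearMap.range (moveMap u)) := by
      apply Submodule.finrank_mono
      rintro _ ⟨⟨v, hv⟩, rfl⟩
      exact hv
    have h4 : Module.finrank ℝ (LinearMap.ker ((moveMap c).domRestrict
        ((LinearMap.range (moveMap u)).comap (moveMap c)))) ≤
        Module.finrank ℝ (fixSpace c) := by
      rw [← ker_moveMap]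
      refine LinearMap.finrank_le_finrank_of_injective
        (f := (Submodule.subtype _).restrict (p := LinearMap.ker ((moveMap c).domRestrict
        ((LinearMap.range (moveMap u)).comap (moveMap c)))) (q := LinearMap.ker (moveMap c))
        fun v hv => hv) ?_
      intro v w hvw
      exact Subtype.ext (Subtype.ext
        (congrArg (fun z : LinearMap.ker (moveMap c) => (z : Fin n → ℝ)) hvw))
    omega

/-- Below a fixed permutation, the absolute order is the reverse inclusion of fixed spaces. -/
theorem prefixLE_of_fixSpace_le {g u c : Equiv.Perm (Fin n)} (hg : PrefixLE reflLength g c)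
    (hu : PrefixLE reflLength u c) (h : fixSpace u ≤ fixSpace g) : PrefixLE reflLength g u := by
  have h1 : fixSpace (g⁻¹ * c) ≤ fixSpace (u⁻¹ * c) := by
    rw [fixSpace_inv_mul_eq_comap hg, fixSpace_inv_mul_eq_comap hu]
    exact Submodule.comap_mono (range_moveMap_le h)
  -- The sum of these two spaces is fixed by `g⁻¹ u`, and their intersection is contained in the
  -- fixed space of `c`. Counting dimensions gives `len (g⁻¹ u) ≤ len u - len g`.
  have h2 : fixSpace (g⁻¹ * c) ⊔ fixSpace u ≤ fixSpace (g⁻¹ * u) := by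
    refine sup_le (fun v hv => ?_) fun v hv => ?_
    · have := fixSpace_inf_le (g⁻¹ * c) (u⁻¹ * c)⁻¹ ⟨hv, by rw [fixSpace_inv]; exact h1 hv⟩
      rwa [mul_inv_rev, inv_inv, mul_assoc, mul_inv_cancel_left] at this
    · exact fixSpace_inf_le g⁻¹ u ⟨by rw [fixSpace_inv]; exact h hv, hv⟩
  have h3 : fixSpace (g⁻¹ * c) ⊓ fixSpace u ≤ fixSpace c := by
    rw [← fixSpace_inf_eq hg, inf_comm]
    exact inf_le_inf_right _ h
  have h4 := Submodule.finrank_mono h2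
  have h5 := Submodule.finrank_mono h3
  have h6 := finrank_sup_add_inf_fixSpace (g⁻¹ * c) u
  rw [prefixLE_reflLength_iff] at hg
  have h7 := reflLength_mul_le g (g⁻¹ * u)
  rw [mul_inv_cancel_left] at h7
  have e1 := reflLength_add_finrank g
  have e2 := reflLength_add_finrank u
  have e3 := reflLength_add_finrank (g⁻¹ * u)
  rw [PrefixLE]
  omega

theorem mem_fixSpace_swap {i j : Fin n} {v : Fin n → ℝ} :
    v ∈ fixSpace (Equiv.swap i j) ↔ v i = v j := by
  refine ⟨fun h => ?_, fun h x => ?_⟩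
  · have := h j
    rwa [Equiv.swap_apply_right] at this
  · rw [Equiv.swap_apply_def]
    split_ifs with h1 h2
    · rw [h1, h]
    · rw [h2, h]
    · rfl

theorem reflLength_swap {i j : Fin n} (hij : i ≠ j) : reflLength (Equiv.swap i j) = 1 := by
  have h1 : fixSpace (Equiv.swap i j) =
      LinearMap.ker (LinearMap.proj (R := ℝ) (φ := fun _ : Fin n => ℝ) i - LinearMap.proj j) := by
    ext v
    rw [mem_fixSpace_swap, LinearMap.mem_ker, LinearMap.sub_apply, sub_eq_zero]
    rfl
  have h2 := Module.Dual.finrank_ker_add_one_of_ne_zero (K := ℝ)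
    (f := LinearMap.proj (R := ℝ) (φ := fun _ : Fin n => ℝ) i - LinearMap.proj j) (by
      intro h
      have := LinearMap.congr_fun h (Pi.single i 1)
      simp [Pi.single_eq_of_ne hij.symm] at this)
  rw [← h1, Module.finrank_fin_fun] at h2
  have := reflLength_add_finrank (Equiv.swap i j)
  omega

/-- If `i` and `j` lie in the same cycle of `c` but not in the same cycle of `(i j) c`, then the
transposition `(i j)` is below `c`. -/
theorem prefixLE_swap {i j : Fin n} {c : Equiv.Perm (Fin n)}
    (hc : fixSpace c ≤ fixSpace (Equiv.swap i j)) {w : Fin n → ℝ}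
    (hw : w ∈ fixSpace ((Equiv.swap i j)⁻¹ * c)) (hne : w i ≠ w j) :
    PrefixLE reflLength (Equiv.swap i j) c := by
  have hij : i ≠ j := fun h => hne (by rw [h])
  have h1 : fixSpace c < fixSpace ((Equiv.swap i j)⁻¹ * c) := by
    refine lt_of_le_of_ne (fun v hv => ?_) fun h => ?_
    · exact fixSpace_inf_le _ _ ⟨by rw [fixSpace_inv]; exact hc hv, hv⟩
    · exact hne (mem_fixSpace_swap.1 (hc (h ▸ hw)))
  have h2 := Submodule.finrank_lt_finrank_of_lt h1
  have h3 := reflLength_mul_le (Equiv.swap i j) ((Equiv.swap i j)⁻¹ * c)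
  rw [mul_inv_cancel_left] at h3
  have h4 := reflLength_swap hij
  have e1 := reflLength_add_finrank c
  have e2 := reflLength_add_finrank ((Equiv.swap i j)⁻¹ * c)
  rw [PrefixLE]
  omega

end AbsoluteOrder

/-! ### Noncrossing permutations as a model of the simple dual braids -/

section DualModel

variable {n : ℕ}

/-- The cycle `x ↦ x + 1`. -/
def dualCycle (n : ℕ) : Equiv.Perm (Fin n) where
  toFun x := ⟨if (x : ℕ) + 1 < n then x + 1 else 0, by
    have := x.2
    split_ifs <;> omega⟩
  invFun x := ⟨if (x : ℕ) = 0 then n - 1 else x - 1, by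
    have := x.2
    split_ifs <;> omega⟩
  left_inv x := by
    have := x.2
    ext
    simp only
    grind
  right_inv x := by
    have := x.2
    ext
    simp only
    split_ifs <;> omega

theorem dualCycle_val (x : Fin n) :
    ((dualCycle n x : Fin n) : ℕ) = if (x : ℕ) + 1 < n then (x : ℕ) + 1 else 0 := rfl

theorem eq_of_mem_fixSpace_dualCycle {v : Fin n → ℝ} (hv : v ∈ fixSpace (dualCycle n))
    (x y : Fin n) : v x = v y := by
  have key : ∀ k (hk : k < n), v ⟨k, hk⟩ = v ⟨0, by omega⟩ := by
    intro k
    induction k with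
    | zero => exact fun _ => rfl
    | succ k ih =>
      intro hk
      rw [← ih (by omega), ← hv ⟨k, by omega⟩]
      congr 1
      ext
      rw [dualCycle_val]
      simp only
      rw [if_pos hk]
  exact (key x x.2).trans (key y y.2).symm

/-- The indicator function of the interval `[i, j)`. -/
noncomputable def dualArc (i j x : Fin n) : ℝ := if i ≤ x ∧ x < j then 1 else 0

/-- Multiplication by `(i j)` cuts the long cycle into the interval `[i, j)` and its complement. -/
theorem dualArc_mem {i j : Fin n} (hij : i < j) :
    dualArc i j ∈ fixSpace ((Equiv.swap i j)⁻¹ * dualCycle n) := by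
  intro x
  have hx := dualCycle_val x
  have h1 := x.2
  have h2 := j.2
  unfold dualArc
  refine if_congr ?_ rfl rfl
  rw [Equiv.swap_inv, Equiv.Perm.mul_apply, Equiv.swap_apply_def]
  by_cases e1 : dualCycle n x = i
  · rw [if_pos e1]
    rw [e1] at hx
    split_ifs at hx <;> omega
  · rw [if_neg e1]
    by_cases e2 : dualCycle n x = j
    · rw [if_pos e2]
      rw [e2] at hx
      split_ifs at hx <;> omega
    · rw [if_neg e2]
      split_ifs at hx <;> omega

theorem dualArc_left {i j : Fin n} (hij : i < j) : dualArc i j i = 1 := if_pos ⟨le_rfl, hij⟩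

theorem dualArc_right (i j : Fin n) : dualArc i j j = 0 := if_neg fun h => h.2.false

theorem swap_le_dualCycle {i j : Fin n} (hij : i < j) :
    PrefixLE reflLength (Equiv.swap i j) (dualCycle n) := by
  refine prefixLE_swap (fun v hv => ?_) (dualArc_mem hij) ?_
  · exact mem_fixSpace_swap.2 (eq_of_mem_fixSpace_dualCycle hv i j)
  · rw [dualArc_left hij, dualArc_right]
    exact one_ne_zero

/-- The points `k` and `l` are on the same side of the interval `[i, j)`. -/
def SameSide (i j k l : Fin n) : Prop := (i ≤ k ∧ k < j) ↔ (i ≤ l ∧ l < j)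

/-- The fixed space is spanned by the constants and the indicator of `[i, j)`: subtracting a
multiple of the latter makes the values at `i` and `j` agree, and the result is then fixed by the
long cycle. -/
theorem fixSpace_swap_mul_dualCycle_le_iff {i j k l : Fin n} (hij : i < j) :
    fixSpace ((Equiv.swap i j)⁻¹ * dualCycle n) ≤ fixSpace (Equiv.swap k l) ↔
      SameSide i j k l := by
  refine ⟨fun h => ?_, fun h v hv => ?_⟩
  · have h1 := mem_fixSpace_swap.1 (h (dualArc_mem hij))
    unfold dualArc at h1
    unfold SameSide
    split_ifs at h1 with h2 h3 h3
    · tauto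
    · exact absurd h1 one_ne_zero
    · exact absurd h1 zero_ne_one
    · tauto
  · have h1 : v - (v i - v j) • dualArc i j ∈ fixSpace ((Equiv.swap i j)⁻¹ * dualCycle n) :=
      Submodule.sub_mem _ hv (Submodule.smul_mem _ _ (dualArc_mem hij))
    have h2 : v - (v i - v j) • dualArc i j ∈ fixSpace (Equiv.swap i j) := by
      rw [mem_fixSpace_swap]
      simp only [Pi.sub_apply, Pi.smul_apply, dualArc_left hij, dualArc_right, smul_eq_mul]
      ring
    have h3 := fixSpace_inf_le _ _ ⟨h2, h1⟩
    rw [mul_inv_cancel_left] at h3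
    have h4 := eq_of_mem_fixSpace_dualCycle h3 k l
    have h5 : dualArc i j k = dualArc i j l := if_congr h rfl rfl
    simp only [Pi.sub_apply, Pi.smul_apply, h5] at h4
    exact mem_fixSpace_swap.2 (sub_left_injective h4)

theorem swap_mul_swap_le {i j k l : Fin n} (hij : i < j) (hkl : k < l) (h : SameSide i j k l) :
    PrefixLE reflLength (Equiv.swap i j * Equiv.swap k l) (dualCycle n) ∧
      reflLength (Equiv.swap i j * Equiv.swap k l) = 2 := by
  have h0 := swap_le_dualCycle hij
  have h1 := h0.mul (a := Equiv.swap k l) reflLength_mul_le (prefixLE_of_fixSpace_le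
    (swap_le_dualCycle hkl) (prefixLE_inv_mul h0 (by simp [PrefixLE, reflLength_one]))
    ((fixSpace_swap_mul_dualCycle_le_iff hij).2 h))
  rw [reflLength_swap hij.ne, reflLength_swap hkl.ne] at h1
  exact h1

/-- The index of the dual generator `σ_{i,j}`. -/
def dualGen (i j : Fin n) (h : i < j) : BraidGen .dual n := ⟨(i, j), h⟩

theorem exists_dualGen (a : BraidGen .dual n) : ∃ i j h, a = dualGen i j h :=
  ⟨a.1.1, a.1.2, a.2, rfl⟩

theorem swap_triangle₁ {i j k : Fin n} (hij : i < j) (hjk : j < k) :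
    Equiv.swap i j * Equiv.swap j k = Equiv.swap j k * Equiv.swap i k := by
  rw [Equiv.swap_mul_eq_mul_swap (Equiv.swap j k), Equiv.swap_inv, Equiv.swap_apply_left,
    Equiv.swap_apply_of_ne_of_ne hij.ne (hij.trans hjk).ne]

theorem swap_triangle₂ {i j k : Fin n} (hij : i < j) (hjk : j < k) :
    Equiv.swap j k * Equiv.swap i k = Equiv.swap i k * Equiv.swap i j := by
  rw [Equiv.swap_mul_eq_mul_swap (Equiv.swap i k), Equiv.swap_inv, Equiv.swap_apply_right,
    Equiv.swap_apply_of_ne_of_ne hij.ne' hjk.ne, Equiv.swap_comm j i]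

theorem swap_comm_of_ne {i j k l : Fin n} (hik : i ≠ k) (hil : i ≠ l) (hjk : j ≠ k) (hjl : j ≠ l) :
    Equiv.swap i j * Equiv.swap k l = Equiv.swap k l * Equiv.swap i j := by
  rw [Equiv.swap_mul_eq_mul_swap, Equiv.swap_inv, Equiv.swap_apply_of_ne_of_ne hik hil,
    Equiv.swap_apply_of_ne_of_ne hjk hjl]

/-- The projection of dual braids to permutations. -/
noncomputable def dualProj (n : ℕ) : Braid .dual n →* Equiv.Perm (Fin n) :=
  PresentedMonoid.lift (fun a : {p : Fin n × Fin n // p.1 < p.2} => Equiv.swap a.1.1 a.1.2) (by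
    intro u v h
    cases h with
    | triangle₁ i j k hij hjk => simpa [dualLetter] using swap_triangle₁ hij hjk
    | triangle₂ i j k hij hjk => simpa [dualLetter] using swap_triangle₂ hij hjk
    | separated i j k l hij hjk hkl =>
      simpa [dualLetter] using swap_comm_of_ne (hij.trans hjk).ne ((hij.trans hjk).trans hkl).ne
        hjk.ne (hjk.trans hkl).ne
    | nested i k l j hik hkl hlj =>
      simpa [dualLetter] using swap_comm_of_ne hik.ne (hik.trans hkl).ne (hkl.trans hlj).ne' hlj.ne')

theorem dualProj_of {i j : Fin n} (h : i < j) :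
    dualProj n (braidOf (dualGen i j h)) = Equiv.swap i j := rfl

theorem braidOf_triangle₁ {i j k : Fin n} (hij : i < j) (hjk : j < k) :
    braidOf (dualGen i j hij) * braidOf (dualGen j k hjk) =
      braidOf (dualGen j k hjk) * braidOf (dualGen i k (hij.trans hjk)) :=
  PresentedMonoid.mk_eq_mk_of_rel (rels := braidRel .dual n) (DualRel.triangle₁ i j k hij hjk)

theorem braidOf_triangle₂ {i j k : Fin n} (hij : i < j) (hjk : j < k) :
    braidOf (dualGen j k hjk) * braidOf (dualGen i k (hij.trans hjk)) =
      braidOf (dualGen i k (hij.trans hjk)) * braidOf (dualGen i j hij) :=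
  PresentedMonoid.mk_eq_mk_of_rel (rels := braidRel .dual n) (DualRel.triangle₂ i j k hij hjk)

theorem braidOf_separated {i j k l : Fin n} (hij : i < j) (hjk : j < k) (hkl : k < l) :
    braidOf (dualGen i j hij) * braidOf (dualGen k l hkl) =
      braidOf (dualGen k l hkl) * braidOf (dualGen i j hij) :=
  PresentedMonoid.mk_eq_mk_of_rel (rels := braidRel .dual n)
    (DualRel.separated i j k l hij hjk hkl)

theorem braidOf_nested {i k l j : Fin n} (hik : i < k) (hkl : k < l) (hlj : l < j) :
    braidOf (dualGen i j (hik.trans (hkl.trans hlj))) * braidOf (dualGen k l hkl) =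
      braidOf (dualGen k l hkl) * braidOf (dualGen i j (hik.trans (hkl.trans hlj))) :=
  PresentedMonoid.mk_eq_mk_of_rel (rels := braidRel .dual n) (DualRel.nested i k l j hik hkl hlj)

/-- Below the long cycle the order is read on fixed spaces, so the join property reduces to the
implication `hv` between equalities of coordinates. -/
theorem atomsLinked_of_mul_eq {i j k l p q : Fin n} (hij : i < j) (hkl : k < l) (hpq : p < q)
    {r : Braid .dual n} (hs : SameSide i j p q)
    (h : braidOf (dualGen i j hij) * braidOf (dualGen p q hpq) = braidOf (dualGen k l hkl) * r)
    (hv : ∀ v : Fin n → ℝ, v i = v j → v k = v l → v p = v q) :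
    AtomsLinked reflLength (dualCycle n) (dualProj n) (dualGen i j hij) (dualGen k l hkl) := by
  have h1 := swap_mul_swap_le hij hpq hs
  refine ⟨_, r, h, ?_, ?_, fun u hu ha hb => ?_⟩
  · rw [map_mul, dualProj_of, dualProj_of, h1.2, braidLength_mul, braidLength_of, braidLength_of]
  · rw [map_mul, dualProj_of, dualProj_of]
    exact h1.1
  · rw [map_mul, dualProj_of, dualProj_of]
    refine prefixLE_of_fixSpace_le h1.1 hu fun v hvu => fixSpace_inf_le _ _ ?_
    have e1 := fixSpace_le_of_prefixLE ha hvu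
    have e2 := fixSpace_le_of_prefixLE hb hvu
    exact ⟨e1, mem_fixSpace_swap.2 (hv v (mem_fixSpace_swap.1 e1) (mem_fixSpace_swap.1 e2))⟩

theorem atomsLinked_dual_self {i j : Fin n} (hij : i < j) :
    AtomsLinked reflLength (dualCycle n) (dualProj n) (dualGen i j hij) (dualGen i j hij) :=
  atomsLinked_self (reflLength_swap hij.ne) (swap_le_dualCycle hij)

theorem atomsLinked_consecutive {i j k : Fin n} (hij : i < j) (hjk : j < k) :
    AtomsLinked reflLength (dualCycle n) (dualProj n) (dualGen i j hij) (dualGen j k hjk) :=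
  atomsLinked_of_mul_eq hij hjk hjk (by unfold SameSide; omega) (braidOf_triangle₁ hij hjk)
    fun _ _ h => h

theorem atomsLinked_right {i j k : Fin n} (hij : i < j) (hjk : j < k) :
    AtomsLinked reflLength (dualCycle n) (dualProj n) (dualGen j k hjk)
      (dualGen i k (hij.trans hjk)) :=
  atomsLinked_of_mul_eq hjk (hij.trans hjk) (hij.trans hjk) (by unfold SameSide; omega)
    (braidOf_triangle₂ hij hjk) fun _ _ h => h

theorem atomsLinked_left {i j k : Fin n} (hij : i < j) (hjk : j < k) :
    AtomsLinked reflLength (dualCycle n) (dualProj n) (dualGen i k (hij.trans hjk))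
      (dualGen i j hij) :=
  atomsLinked_of_mul_eq (hij.trans hjk) hij hij (by unfold SameSide; omega)
    ((braidOf_triangle₂ hij hjk).symm.trans (braidOf_triangle₁ hij hjk).symm) fun _ _ h => h

theorem atomsLinked_separated {i j k l : Fin n} (hij : i < j) (hjk : j < k) (hkl : k < l) :
    AtomsLinked reflLength (dualCycle n) (dualProj n) (dualGen i j hij) (dualGen k l hkl) :=
  atomsLinked_of_mul_eq hij hkl hkl (by unfold SameSide; omega) (braidOf_separated hij hjk hkl)
    fun _ _ h => h

theorem atomsLinked_nested {i k l j : Fin n} (hik : i < k) (hkl : k < l) (hlj : l < j) :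
    AtomsLinked reflLength (dualCycle n) (dualProj n)
      (dualGen i j (hik.trans (hkl.trans hlj))) (dualGen k l hkl) :=
  atomsLinked_of_mul_eq (hik.trans (hkl.trans hlj)) hkl hkl (by unfold SameSide; omega)
    (braidOf_nested hik hkl hlj) fun _ _ h => h

/-- Noncrossing: crossing transpositions below a noncrossing permutation move the same cycle. -/
theorem eq_of_crossing {i j k l : Fin n} (hij : i < j) (hjk : j < k) (hkl : k < l)
    {u : Equiv.Perm (Fin n)} (hu : PrefixLE reflLength u (dualCycle n))
    (h₁ : PrefixLE reflLength (Equiv.swap i k) u) (h₂ : PrefixLE reflLength (Equiv.swap j l) u)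
    {v : Fin n → ℝ} (hv : v ∈ fixSpace u) : v i = v j := by
  have hik := hij.trans hjk
  -- The quotient of `u` by `(i k)` is a prefix of that of the long cycle, so it preserves the
  -- interval `[i, k)`.
  have h3 : fixSpace ((Equiv.swap i k)⁻¹ * dualCycle n) ≤ fixSpace ((Equiv.swap i k)⁻¹ * u) := by
    apply fixSpace_le_of_prefixLE
    unfold PrefixLE at *
    have e := reflLength_mul_le ((Equiv.swap i k)⁻¹ * u) (u⁻¹ * dualCycle n)
    have e' := reflLength_mul_le (Equiv.swap i k) ((Equiv.swap i k)⁻¹ * dualCycle n)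
    rw [mul_assoc, mul_inv_cancel_left] at e
    rw [mul_inv_cancel_left] at e'
    rw [mul_inv_rev, inv_inv, mul_assoc, mul_inv_cancel_left]
    omega
  have h4 := h3 (dualArc_mem hik)
  have h5 := mem_fixSpace_swap.1 (fixSpace_le_of_prefixLE h₁ hv)
  have h6 := mem_fixSpace_swap.1 (fixSpace_le_of_prefixLE h₂ hv)
  have h7 : v ∈ fixSpace ((Equiv.swap i k)⁻¹ * u) :=
    fixSpace_inf_le _ _ ⟨by rw [fixSpace_inv]; exact mem_fixSpace_swap.2 h5, hv⟩
  -- This truncation of `v - v i` to `[i, k)` vanishes at `i` and `k`, hence is fixed by `(i k)` as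
  -- well as by the quotient. Comparing its values at `j` and `l` gives `v j = v i`.
  have h8 : (fun x => (v x - v i) * dualArc i k x) ∈ fixSpace u := by
    have := fixSpace_inf_le (Equiv.swap i k) ((Equiv.swap i k)⁻¹ * u)
      (x := fun x => (v x - v i) * dualArc i k x) ⟨mem_fixSpace_swap.2 (by simp [dualArc_right]),
        fun x => by simp only [h7 x, h4 x]⟩
    rwa [mul_inv_cancel_left] at this
  have h9 := mem_fixSpace_swap.1 (fixSpace_le_of_prefixLE h₂ h8)
  have e1 : dualArc i k j = 1 := if_pos ⟨hij.le, hjk⟩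
  have e2 : dualArc i k l = 0 := if_neg fun h => hkl.not_gt h.2
  simp only [e1, e2] at h9
  linarith

/-- Crossing chords `(i, k)` and `(j, l)` are linked through the side `(i, j)`: triangle relations
connect it to both, and `eq_of_crossing` puts it below any common upper bound. -/
theorem linked_crossing {i j k l : Fin n} (hij : i < j) (hjk : j < k) (hkl : k < l) :
    ∃ d, AtomsLinked reflLength (dualCycle n) (dualProj n) (dualGen i k (hij.trans hjk)) d ∧
      AtomsLinked reflLength (dualCycle n) (dualProj n) d (dualGen j l (hjk.trans hkl)) ∧
      ∀ u, PrefixLE reflLength u (dualCycle n) →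
        PrefixLE reflLength (dualProj n (braidOf (dualGen i k (hij.trans hjk)))) u →
        PrefixLE reflLength (dualProj n (braidOf (dualGen j l (hjk.trans hkl)))) u →
        PrefixLE reflLength (dualProj n (braidOf d)) u := by
  refine ⟨dualGen i j hij, atomsLinked_left hij hjk, atomsLinked_consecutive hij _,
    fun u hu h₁ h₂ => ?_⟩
  exact prefixLE_of_fixSpace_le (swap_le_dualCycle hij) hu fun v hv =>
    mem_fixSpace_swap.2 (eq_of_crossing hij hjk hkl hu h₁ h₂ hv)

theorem linked_dual (a b : BraidGen .dual n) :
    ∃ d, AtomsLinked reflLength (dualCycle n) (dualProj n) a d ∧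
      AtomsLinked reflLength (dualCycle n) (dualProj n) d b ∧
      ∀ u, PrefixLE reflLength u (dualCycle n) →
        PrefixLE reflLength (dualProj n (braidOf a)) u →
        PrefixLE reflLength (dualProj n (braidOf b)) u →
        PrefixLE reflLength (dualProj n (braidOf d)) u := by
  obtain ⟨i, j, hij, rfl⟩ := exists_dualGen a
  obtain ⟨k, l, hkl, rfl⟩ := exists_dualGen b
  have direct : AtomsLinked reflLength (dualCycle n) (dualProj n) (dualGen i j hij)
      (dualGen k l hkl) → _ := fun h => (⟨dualGen k l hkl, h, atomsLinked_dual_self hkl,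
        fun _ _ _ h => h⟩ : ∃ d, AtomsLinked reflLength (dualCycle n) (dualProj n)
          (dualGen i j hij) d ∧ AtomsLinked reflLength (dualCycle n) (dualProj n) d
          (dualGen k l hkl) ∧ ∀ u, PrefixLE reflLength u (dualCycle n) →
        PrefixLE reflLength (dualProj n (braidOf (dualGen i j hij))) u →
        PrefixLE reflLength (dualProj n (braidOf (dualGen k l hkl))) u →
        PrefixLE reflLength (dualProj n (braidOf d)) u)
  rcases lt_trichotomy i k with hik | rfl | hki
  · rcases lt_trichotomy j k with hjk | rfl | hkj
    · exact direct (atomsLinked_separated hij hjk hkl)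
    · exact direct (atomsLinked_consecutive hij hkl)
    · rcases lt_trichotomy j l with hjl | rfl | hlj
      · exact linked_crossing hik hkj hjl
      · exact direct (atomsLinked_right hik hkl).symm
      · exact direct (atomsLinked_nested hik hkl hlj)
  · rcases lt_trichotomy j l with hjl | rfl | hlj
    · exact direct (atomsLinked_left hij hjl).symm
    · exact direct (atomsLinked_dual_self hij)
    · exact direct (atomsLinked_left hkl hlj)
  · rcases lt_trichotomy l i with hli | rfl | hil
    · exact direct (atomsLinked_separated hkl hli hij).symm
    · exact direct (atomsLinked_consecutive hkl hij).symm
    · rcases lt_trichotomy l j with hlj | rfl | hjl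
      · obtain ⟨d, h1, h2, h3⟩ := linked_crossing hki hil hlj
        exact ⟨d, h2.symm, h1.symm, fun u hu ha hb => h3 u hu hb ha⟩
      · exact direct (atomsLinked_right hki hij)
      · exact direct (atomsLinked_nested hki hij hjl).symm

theorem exists_dualGen_swap {i j : Fin n} (h : i ≠ j) :
    ∃ a : BraidGen .dual n, dualProj n (braidOf a) = Equiv.swap i j := by
  rcases lt_or_gt_of_ne h with h | h
  · exact ⟨dualGen i j h, rfl⟩
  · exact ⟨dualGen j i h, Equiv.swap_comm _ _⟩

/-- The permutations below the long cycle model the simple dual braids. -/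
noncomputable def dualModel (n : ℕ) : GermModel .dual n (Equiv.Perm (Fin n)) where
  len := reflLength
  top := dualCycle n
  proj := dualProj n
  len_one := reflLength_one
  len_mul_le := reflLength_mul_le
  eq_one_of_len _ := eq_one_of_reflLength
  len_atom a := reflLength_swap a.2.ne
  balanced _ _ := prefixLE_inv_mul
  exists_atom g hg hne := by
    obtain ⟨x, hx⟩ : ∃ x, g x ≠ x := by
      by_contra! h
      exact hne (Equiv.ext h)
    obtain ⟨a, ha⟩ := exists_dualGen_swap hx
    obtain ⟨i, j, hij, rfl⟩ := exists_dualGen a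
    refine ⟨dualGen i j hij, prefixLE_of_fixSpace_le (g := Equiv.swap i j)
      (swap_le_dualCycle hij) hg fun v hv => ?_⟩
    have : v ∈ fixSpace (Equiv.swap (g x) x) := mem_fixSpace_swap.2 (hv x)
    rw [← ha] at this
    exact this
  linked := linked_dual
  rel_reduced u v h := by
    cases h with
    | triangle₁ i j k hij hjk =>
      have hs : SameSide i j j k := by unfold SameSide; omega
      exact swap_mul_swap_le hij hjk hs
    | triangle₂ i j k hij hjk =>
      have hs : SameSide j k i k := by unfold SameSide; omega
      exact swap_mul_swap_le hjk (hij.trans hjk) hs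
    | separated i j k l hij hjk hkl =>
      have hs : SameSide i j k l := by unfold SameSide; omega
      exact swap_mul_swap_le hij hkl hs
    | nested i k l j hik hkl hlj =>
      have hs : SameSide i j k l := by unfold SameSide; omega
      exact swap_mul_swap_le (hik.trans (hkl.trans hlj)) hkl hs
  atom_le_top a := swap_le_dualCycle a.2
  -- A vector fixed by `u` is fixed by every transposition, hence by the long cycle, so the order
  -- comparison goes both ways.
  eq_top u hu hall := by
    have h1 : PrefixLE reflLength (dualCycle n) u := by
      refine prefixLE_of_fixSpace_le (by simp [PrefixLE, reflLength_one]) hu fun v hv x => ?_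
      by_cases hx : dualCycle n x = x
      · rw [hx]
      · obtain ⟨a, ha⟩ := exists_dualGen_swap hx
        have := fixSpace_le_of_prefixLE (hall a) hv
        rw [ha] at this
        exact mem_fixSpace_swap.1 this
    unfold PrefixLE at h1 hu
    exact inv_mul_eq_one.1 (eq_one_of_reflLength (by omega))
  atom_sq a := Equiv.swap_mul_self _ _
  conj_atom a := by
    obtain ⟨i, j, hij, rfl⟩ := exists_dualGen a
    obtain ⟨b, hb⟩ := exists_dualGen_swap (i := (dualCycle n)⁻¹ i) (j := (dualCycle n)⁻¹ j)
      fun h => hij.ne ((dualCycle n)⁻¹.injective h)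
    exact ⟨b, by rw [hb, dualProj_of, Equiv.swap_mul_eq_mul_swap]⟩

end DualModel

/-! ### Connectivity for dual braids -/

section Dual

variable {n : ℕ}

theorem dual_atom_le_iff {k l : Fin n} (hkl : k < l) {g : (dualModel n).Simp} :
    (dualModel n).atom (dualGen k l hkl) ≤ g ↔ fixSpace g.1 ≤ fixSpace (Equiv.swap k l) :=
  ⟨fun h => fixSpace_le_of_prefixLE (g := Equiv.swap k l) h,
    fun h => prefixLE_of_fixSpace_le (g := Equiv.swap k l) (swap_le_dualCycle hkl) g.2 h⟩

theorem dual_step_atom {i j : Fin n} (hij : i < j) {h : (dualModel n).Simp}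
    (hne : h ≠ (dualModel n).unit)
    (hs : ∀ k l, k < l → fixSpace h.1 ≤ fixSpace (Equiv.swap k l) → ¬SameSide i j k l) :
    (dualModel n).Step ((dualModel n).atom (dualGen i j hij)) h := by
  refine ⟨hne, fun a h1 h2 => ?_⟩
  obtain ⟨k, l, hkl, rfl⟩ := exists_dualGen a
  exact hs k l hkl ((dual_atom_le_iff hkl).1 h1)
    ((fixSpace_swap_mul_dualCycle_le_iff hij).1 ((dual_atom_le_iff hkl).1 h2))

/-- The only transpositions below an involution are its cycles. -/
theorem eq_apply_of_fixSpace_le {g : Equiv.Perm (Fin n)} (hg : ∀ x, g (g x) = x) {k l : Fin n}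
    (hkl : k ≠ l) (h : fixSpace g ≤ fixSpace (Equiv.swap k l)) : l = g k := by
  -- The indicator of the cycle `{k, g k}`.
  have h1 : (fun x => if x = k ∨ x = g k then (1 : ℝ) else 0) ∈ fixSpace g := by
    intro x
    refine if_congr ?_ rfl rfl
    rw [g.injective.eq_iff, or_comm]
    refine or_congr_right ⟨fun h => ?_, fun h => ?_⟩
    · rw [← h, hg]
    · rw [h, hg]
  have h2 := mem_fixSpace_swap.1 (h h1)
  simp only [true_or, if_true] at h2
  by_contra hne
  rw [if_neg (by rintro (h | h); exacts [hkl h.symm, hne h])] at h2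
  exact one_ne_zero h2

theorem swap_involutive (k l x : Fin n) : Equiv.swap k l (Equiv.swap k l x) = x :=
  Equiv.swap_apply_self _ _ _

theorem dual_step_atom_involution {i j : Fin n} (hij : i < j) {h : (dualModel n).Simp}
    (hne : h.1 ≠ 1) (hinv : ∀ x, h.1 (h.1 x) = x)
    (hs : ∀ k, k < h.1 k → ¬SameSide i j k (h.1 k)) :
    (dualModel n).Step ((dualModel n).atom (dualGen i j hij)) h := by
  refine dual_step_atom hij (fun h' => hne (congrArg Subtype.val h')) fun k l hkl hle => ?_
  obtain rfl := eq_apply_of_fixSpace_le hinv hkl.ne hle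
  exact hs k hkl

theorem dual_step_atom_atom {i j k l : Fin n} (hij : i < j) (hkl : k < l)
    (hs : ¬SameSide i j k l) : (dualModel n).Step ((dualModel n).atom (dualGen i j hij))
      ((dualModel n).atom (dualGen k l hkl)) := by
  refine dual_step_atom_involution hij (h := (dualModel n).atom (dualGen k l hkl)) ?_
    (swap_involutive k l) fun x hx => ?_
  · intro h
    have : Equiv.swap k l = 1 := h
    rw [Equiv.swap_eq_one_iff] at this
    exact hkl.ne this
  · change x < Equiv.swap k l x at hx
    change ¬SameSide i j x (Equiv.swap k l x)
    rw [Equiv.swap_apply_def] at hx ⊢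
    split_ifs at hx ⊢ with h1 h2
    · rwa [h1]
    · rw [h2] at hx
      exact absurd hx hkl.not_gt
    · exact absurd hx (lt_irrefl _)

/-- An atom `(i, j)` can be followed by any atom whose endpoints are separated by `[i, j)`. The
route is `(i, j) → (0, m) → (0, n - 1)`, then directly to `(s, t)` if `t = n - 1`, and otherwise
through `(s + 1, n - 1)`. -/
theorem dual_reach_atom (a b : BraidGen .dual n) :
    Relation.ReflTransGen (dualModel n).Step ((dualModel n).atom a) ((dualModel n).atom b) := by
  obtain ⟨i, j, hij, rfl⟩ := exists_dualGen a
  obtain ⟨s, t, hst, rfl⟩ := exists_dualGen b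
  have hj := j.2
  have hij' : (i : ℕ) < j := hij
  let z : Fin n := ⟨0, by omega⟩
  let w : Fin n := ⟨n - 1, by omega⟩
  have hz : (z : ℕ) = 0 := rfl
  have hw : (w : ℕ) = n - 1 := rfl
  have hzw : z < w := by omega
  have h1 : ∃ (m : Fin n) (hm : z < m), (dualModel n).Step
      ((dualModel n).atom (dualGen i j hij)) ((dualModel n).atom (dualGen z m hm)) := by
    by_cases hi : (i : ℕ) = 0
    · exact ⟨j, by omega, dual_step_atom_atom hij _ (by unfold SameSide; omega)⟩
    · exact ⟨i, by omega, dual_step_atom_atom hij _ (by unfold SameSide; omega)⟩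
  obtain ⟨m, hm, h1⟩ := h1
  have h2 : (dualModel n).Step ((dualModel n).atom (dualGen z m hm))
      ((dualModel n).atom (dualGen z w hzw)) :=
    dual_step_atom_atom hm hzw (by unfold SameSide; omega)
  refine .head h1 (.head h2 ?_)
  by_cases ht : t = w
  · have ht' : (t : ℕ) = n - 1 := congrArg Fin.val ht
    exact .single (dual_step_atom_atom hzw hst (by unfold SameSide; omega))
  · have hs1 : (s : ℕ) + 1 < n := by omega
    have ht' : (t : ℕ) ≠ n - 1 := fun h => ht (Fin.ext h)
    have hsw : (⟨s + 1, hs1⟩ : Fin n) < w := by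
      rw [Fin.lt_def]
      simp only
      omega
    refine .head (dual_step_atom_atom hzw hsw ?_) (.single (dual_step_atom_atom hsw hst ?_))
    · simp only [SameSide, Fin.le_def, Fin.lt_def]
      omega
    · simp only [SameSide, Fin.le_def, Fin.lt_def]
      omega

/-- The points `e x` are the smaller elements of distinct cycles of `y`, on which an invariant
function can be prescribed freely. -/
theorem le_finrank_fixSpace {y : Equiv.Perm (Fin n)} (hy : ∀ x, y (y x) = x) {k : ℕ}
    {e : Fin k → Fin n} (he : Function.Injective e) (hle : ∀ x, e x ≤ y (e x)) :
    k ≤ Module.finrank ℝ (fixSpace y) := by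
  have h := LinearMap.finrank_le_finrank_of_surjective
    (f := (LinearMap.funLeft ℝ ℝ e).comp (fixSpace y).subtype) (fun f => by
      refine ⟨⟨fun x => Function.extend e f 0 (min x (y x)), fun x => ?_⟩, ?_⟩
      · simp only [hy, min_comm]
      · ext x
        simp only [LinearMap.comp_apply, LinearMap.funLeft_apply, Submodule.subtype_apply]
        rw [min_eq_left (hle x), he.extend_apply])
  rwa [Module.finrank_fin_fun] at h

theorem finrank_fixSpace_dualCycle (hn : 0 < n) :
    Module.finrank ℝ (fixSpace (dualCycle n)) ≤ 1 := by
  have h : fixSpace (dualCycle n) ≤ Submodule.span ℝ {fun _ => 1} := by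
    intro v hv
    refine Submodule.mem_span_singleton.2 ⟨v ⟨0, hn⟩, ?_⟩
    ext x
    simp only [Pi.smul_apply, smul_eq_mul, mul_one]
    exact eq_of_mem_fixSpace_dualCycle hv _ _
  refine (Submodule.finrank_mono h).trans ?_
  exact (finrank_span_le_card _).trans (by simp)

theorem inv_eq_self_of_involutive {y : Equiv.Perm (Fin n)} (hy : ∀ x, y (y x) = x) : y⁻¹ = y := by
  rw [inv_eq_iff_mul_eq_one]
  exact Equiv.ext hy

/-- The long cycle is the product of `y` and `y'`. With at least `n + 1` cycles between them, their
lengths add up to at most `n - 1`, the length of the long cycle. -/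
theorem involution_le_dualCycle (hn : 0 < n) {y y' : Equiv.Perm (Fin n)} (hy : ∀ x, y (y x) = x)
    (hy' : ∀ x, y' (y' x) = x) (hyy : y * dualCycle n = y') {k k' : ℕ} (hk : n + 1 ≤ k + k')
    {e : Fin k → Fin n} (he : Function.Injective e) (hle : ∀ x, e x ≤ y (e x))
    {e' : Fin k' → Fin n} (he' : Function.Injective e') (hle' : ∀ x, e' x ≤ y' (e' x)) :
    PrefixLE reflLength y (dualCycle n) := by
  have hinv := inv_eq_self_of_involutive hy
  have h1 := le_finrank_fixSpace hy he hle
  have h2 := le_finrank_fixSpace hy' he' hle'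
  have h3 := finrank_fixSpace_dualCycle hn
  have h4 := reflLength_mul_le y (y⁻¹ * dualCycle n)
  rw [mul_inv_cancel_left] at h4
  have e1 := reflLength_add_finrank y
  have e2 := reflLength_add_finrank (y⁻¹ * dualCycle n)
  have e3 := reflLength_add_finrank (dualCycle n)
  rw [← hyy] at h2
  unfold PrefixLE
  rw [hinv] at *
  omega

/-- The reflection `x ↦ -x` modulo `n`. -/
def dualNeg (n : ℕ) : Equiv.Perm (Fin n) :=
  Function.Involutive.toPerm (fun x => ⟨if (x : ℕ) = 0 then 0 else n - x, by
    have := x.2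
    split_ifs <;> omega⟩) (fun x => by
    have := x.2
    ext
    simp only
    grind)

/-- The reflection `x ↦ 1 - x` modulo `n`. -/
def dualOneSub (n : ℕ) (hn : 2 ≤ n) : Equiv.Perm (Fin n) :=
  Function.Involutive.toPerm (fun x => ⟨if (x : ℕ) ≤ 1 then 1 - x else n + 1 - x, by
    have := x.2
    split_ifs <;> omega⟩) (fun x => by
    have := x.2
    ext
    simp only
    grind)

theorem dualNeg_val (x : Fin n) :
    ((dualNeg n x : Fin n) : ℕ) = if (x : ℕ) = 0 then 0 else n - x := rfl

theorem dualOneSub_val (hn : 2 ≤ n) (x : Fin n) :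
    ((dualOneSub n hn x : Fin n) : ℕ) = if (x : ℕ) ≤ 1 then 1 - (x : ℕ) else n + 1 - x := rfl

theorem dualNeg_dualNeg (x : Fin n) : dualNeg n (dualNeg n x) = x :=
  Function.Involutive.toPerm_involutive _ x

theorem dualOneSub_dualOneSub (hn : 2 ≤ n) (x : Fin n) :
    dualOneSub n hn (dualOneSub n hn x) = x :=
  Function.Involutive.toPerm_involutive _ x

theorem dualNeg_mul_dualCycle : dualNeg n * dualCycle n = Fin.revPerm := by
  ext x
  have := x.2
  rw [Equiv.Perm.mul_apply, dualNeg_val, dualCycle_val, Fin.revPerm_apply, Fin.val_rev]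
  grind

theorem dualOneSub_mul_dualCycle (hn : 2 ≤ n) : dualOneSub n hn * dualCycle n = dualNeg n := by
  ext x
  have := x.2
  rw [Equiv.Perm.mul_apply, dualOneSub_val, dualCycle_val, dualNeg_val]
  split_ifs <;> omega

theorem dualNeg_le (hn : 2 ≤ n) : PrefixLE reflLength (dualNeg n) (dualCycle n) := by
  refine involution_le_dualCycle (by omega) dualNeg_dualNeg Fin.rev_rev
    dualNeg_mul_dualCycle (k := n / 2 + 1) (k' := (n + 1) / 2) (by omega)
    (e := fun x => ⟨x, by omega⟩) (fun x y h => Fin.ext (Fin.mk.inj h)) (fun x => ?_)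
    (e' := fun x => ⟨x, by omega⟩) (fun x y h => Fin.ext (Fin.mk.inj h)) fun x => ?_
  · rw [Fin.le_def, dualNeg_val]
    simp only
    split_ifs <;> omega
  · rw [Fin.le_def, Fin.revPerm_apply, Fin.val_rev]
    simp only
    omega

theorem dualOneSub_le (hn : 2 ≤ n) : PrefixLE reflLength (dualOneSub n hn) (dualCycle n) := by
  refine involution_le_dualCycle (by omega) (dualOneSub_dualOneSub hn) dualNeg_dualNeg
    (dualOneSub_mul_dualCycle hn) (k := (n + 1) / 2) (k' := n / 2 + 1) (by omega)
    -- The points `0` and `1` are exchanged, so the chosen representatives are `0, 2, 3, …`.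
    (e := fun x => ⟨if (x : ℕ) = 0 then 0 else x + 1, by split_ifs <;> omega⟩)
    (fun x y h => ?_) (fun x => ?_)
    (e' := fun x => ⟨x, by omega⟩) (fun x y h => Fin.ext (Fin.mk.inj h)) fun x => ?_
  · have := Fin.mk.inj h
    ext
    split_ifs at this <;> omega
  · rw [Fin.le_def, dualOneSub_val]
    simp only
    split_ifs <;> omega
  · rw [Fin.le_def, dualNeg_val]
    simp only
    split_ifs <;> omega

theorem dualNeg_ne_one (hn : 3 ≤ n) : dualNeg n ≠ 1 := by
  intro h
  have h1 := congrArg (fun g => ((g (⟨1, by omega⟩ : Fin n) : Fin n) : ℕ)) h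
  simp only [dualNeg_val, Equiv.Perm.one_apply] at h1
  split_ifs at h1 <;> omega

theorem dualOneSub_ne_one (hn : 2 ≤ n) : dualOneSub n hn ≠ 1 := by
  intro h
  have h1 := congrArg (fun g => ((g (⟨1, by omega⟩ : Fin n) : Fin n) : ℕ)) h
  simp only [dualOneSub_val, Equiv.Perm.one_apply] at h1
  split_ifs at h1
  omega

/-- The reflection `x ↦ -x` as a simple element. -/
noncomputable def dualNegSimp (hn : 2 ≤ n) : (dualModel n).Simp := ⟨dualNeg n, dualNeg_le hn⟩

/-- The reflection `x ↦ 1 - x` as a simple element. -/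
noncomputable def dualOneSubSimp (hn : 2 ≤ n) : (dualModel n).Simp :=
  ⟨dualOneSub n hn, dualOneSub_le hn⟩

theorem compl_dualNegSimp (hn : 2 ≤ n) :
    ((dualModel n).compl (dualNegSimp hn)).1 = Fin.revPerm := by
  change (dualNeg n)⁻¹ * dualCycle n = _
  rw [inv_eq_self_of_involutive dualNeg_dualNeg, dualNeg_mul_dualCycle]

theorem compl_dualOneSubSimp (hn : 2 ≤ n) :
    (dualModel n).compl (dualOneSubSimp hn) = dualNegSimp hn := by
  apply Subtype.ext
  change (dualOneSub n hn)⁻¹ * dualCycle n = dualNeg n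
  rw [inv_eq_self_of_involutive (dualOneSub_dualOneSub hn), dualOneSub_mul_dualCycle]

/-- Both `x ↦ -x` and `x ↦ 1 - x` are noncrossing matchings whose chords are all cut by one
interval, so each follows a single atom. The complement of `1 - x` is `-x`, and `-x` may follow
itself: chords below it have endpoints with sum `n`, those below its complement have sum `n - 1`. -/
theorem connected_dual (hn : 3 ≤ n) (x y : ProperSimple .dual n) :
    Relation.ReflTransGen (fun a b : ProperSimple .dual n => Arrow a.1 b.1) x y := by
  have hn2 : 2 ≤ n := by omega
  have h₁ : (⟨1, by omega⟩ : Fin n) < ⟨(n + 1) / 2, by omega⟩ := by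
    rw [Fin.lt_def]
    simp only
    omega
  have h₂ : (⟨1, by omega⟩ : Fin n) < ⟨n / 2 + 1, by omega⟩ := by
    rw [Fin.lt_def]
    simp only
    omega
  refine (dualModel n).connected ?_ dual_reach_atom (a := dualGen _ _ h₁) (b := dualGen _ _ h₂)
    (g₁ := dualNegSimp hn2) (g₂ := dualOneSubSimp hn2) ?_ ?_ ?_ x y
  · intro a h
    obtain ⟨i, j, hij, rfl⟩ := exists_dualGen a
    have h1 : Equiv.swap i j = dualCycle n := congrArg Subtype.val h
    have h2 := swap_involutive i j ⟨0, by omega⟩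
    rw [h1, Fin.ext_iff, dualCycle_val, dualCycle_val] at h2
    simp only at h2
    split_ifs at h2 <;> omega
  · refine .single (dual_step_atom_involution h₁ (dualNeg_ne_one hn) dualNeg_dualNeg fun k hk => ?_)
    have h3 : ((dualNegSimp hn2).1 k).val = _ := dualNeg_val k
    rw [Fin.lt_def] at hk
    simp only [SameSide, Fin.le_def, Fin.lt_def]
    split_ifs at h3 <;> omega
  · refine .single (dual_step_atom_involution h₂ (dualOneSub_ne_one hn2)
      (dualOneSub_dualOneSub hn2) fun k hk => ?_)
    have h3 : ((dualOneSubSimp hn2).1 k).val = _ := dualOneSub_val hn2 k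
    rw [Fin.lt_def] at hk
    simp only [SameSide, Fin.le_def, Fin.lt_def]
    split_ifs at h3 <;> omega
  · rw [compl_dualOneSubSimp]
    refine ⟨fun h => dualNeg_ne_one hn (congrArg Subtype.val h), fun a h1 h2 => ?_⟩
    obtain ⟨k, l, hkl, rfl⟩ := exists_dualGen a
    rw [dual_atom_le_iff] at h1 h2
    rw [compl_dualNegSimp] at h2
    have e1 := eq_apply_of_fixSpace_le dualNeg_dualNeg hkl.ne h1
    have e2 := eq_apply_of_fixSpace_le Fin.rev_rev hkl.ne h2
    have h3 := dualNeg_val k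
    rw [← e1] at h3
    have h4 : (l : ℕ) = n - (k + 1) := by rw [e2, Fin.revPerm_apply, Fin.val_rev]
    have := l.2
    have := k.2
    have : (k : ℕ) < l := hkl
    split_ifs at h3 <;> omega

end Dual

/-! ### The space of generalized braids -/

section Space

variable {t : BraidType} {n : ℕ}

instance instDiscreteSimpleBraid (t : BraidType) (n : ℕ) : DiscreteTopology (SimpleBraid t n) :=
  ⟨rfl⟩

instance instT2GenBraid (t : BraidType) (n : ℕ) : T2Space (GenBraid t n) :=
  inferInstanceAs (T2Space {ξ : ℕ → SimpleBraid t n // ∀ k, Arrow (ξ k) (ξ (k + 1))})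

instance instSecondCountableGenBraid (t : BraidType) (n : ℕ) :
    SecondCountableTopology (GenBraid t n) :=
  haveI : SecondCountableTopology (ℕ → SimpleBraid t n) := inferInstance
  TopologicalSpace.Subtype.secondCountableTopology
    {ξ : ℕ → SimpleBraid t n | ∀ k, Arrow (ξ k) (ξ (k + 1))}

instance instCompactGenBraid (t : BraidType) (n : ℕ) : CompactSpace (GenBraid t n) := by
  suffices h : IsClosed {ξ : ℕ → SimpleBraid t n | ∀ k, Arrow (ξ k) (ξ (k + 1))} from
    isCompact_iff_compactSpace.1 h.isCompact
  rw [Set.ofPred_forall]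
  refine isClosed_iInter fun k => ?_
  have h : Continuous fun ξ : ℕ → SimpleBraid t n => (ξ k, ξ (k + 1)) := by fun_prop
  exact (isClosed_discrete {p : SimpleBraid t n × SimpleBraid t n | Arrow p.1 p.2}).preimage h

instance instCountableBraid (t : BraidType) (n : ℕ) : Countable (Braid t n) :=
  haveI : Countable (FreeMonoid (BraidGen t n)) := inferInstanceAs (Countable (List _))
  PresentedMonoid.surjective_mk.countable

theorem isLocallyConstant_coord (k : ℕ) :
    IsLocallyConstant fun ξ : GenBraid t n => ξ.1 k :=
  (IsLocallyConstant.iff_continuous _).2 ((continuous_apply (A := fun _ => SimpleBraid t n) k).comp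
    (continuous_subtype_val (p := fun ξ : ℕ → SimpleBraid t n => ∀ k, Arrow (ξ k) (ξ (k + 1)))))

theorem isLocallyConstant_pathPrefix (k : ℕ) :
    IsLocallyConstant fun ξ : GenBraid t n => pathPrefix ξ k := by
  induction k with
  | zero => exact IsLocallyConstant.const 1
  | succ k ih =>
    simp_rw [pathPrefix_succ]
    exact ih.mul ((isLocallyConstant_coord k).comp Subtype.val)

theorem finite_range_pathPrefix (k : ℕ) :
    (Set.range fun ξ : GenBraid t n => pathPrefix ξ k).Finite :=
  (isLocallyConstant_pathPrefix k).range_finite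

theorem isClopen_pathPrefix (k : ℕ) (p : Braid t n → Prop) :
    IsClopen {ξ : GenBraid t n | p (pathPrefix ξ k)} :=
  ⟨⟨isLocallyConstant_pathPrefix k {x | ¬ p x}⟩, isLocallyConstant_pathPrefix k {x | p x}⟩

namespace GarsideFacts

variable (hG : GarsideFacts t n)
include hG

theorem tendsto_toGen_pathPrefix (ξ : GenBraid t n) :
    Tendsto (fun k => toGen (pathPrefix ξ k)) atTop (𝓝 ξ) := by
  refine tendsto_subtype_rng.2 (tendsto_pi_nhds.2 fun i => ?_)
  refine tendsto_const_nhds.congr' ?_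
  filter_upwards [eventually_gt_atTop i] with k hk
  exact (hG.toGen_pathPrefix_apply ξ hk).symm

/-- If `x` has at most `k` factors, divisibility by `x` is visible on the first `k` factors, a
clopen condition; conversely a path is the limit of its finite prefixes. -/
theorem fullVisualCylinder_eq {k : ℕ} {x : Braid t n} (hx : braidPrefix k x = x) :
    fullVisualCylinder x = {ξ | x ∣ pathPrefix ξ k} := by
  apply Set.Subset.antisymm
  · refine closure_minimal ?_ (isClopen_pathPrefix k (x ∣ ·)).1
    rintro _ ⟨z, rfl⟩
    change x ∣ pathPrefix (toGen (x * z)) k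
    rw [hG.pathPrefix_toGen]
    exact hG.dvd_prefix_of_prefix_eq hx (dvd_mul_right x z)
  · intro ξ hξ
    refine mem_closure_of_tendsto (hG.tendsto_toGen_pathPrefix ξ) ?_
    filter_upwards [eventually_ge_atTop k] with m hm
    obtain ⟨z, hz⟩ := dvd_trans hξ (pathPrefix_dvd ξ hm)
    exact ⟨z, by rw [hz]⟩

theorem isClopen_fullVisualCylinder (x : Braid t n) : IsClopen (fullVisualCylinder x) := by
  rw [hG.fullVisualCylinder_eq (hG.prefix_eq_self le_rfl)]
  exact isClopen_pathPrefix _ (x ∣ ·)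

theorem toGen_mem_fullVisualCylinder {x y : Braid t n} :
    toGen y ∈ fullVisualCylinder x ↔ x ∣ y := by
  refine ⟨fun h => ?_, fun ⟨z, hz⟩ => subset_closure ⟨z, by rw [hz]⟩⟩
  rw [hG.fullVisualCylinder_eq (hG.prefix_eq_self le_rfl), Set.mem_ofPred_eq,
    hG.pathPrefix_toGen] at h
  exact h.trans (hG.prefix_dvd _ y)

/-- Finite braids are isolated among generalized braids. -/
theorem isClopen_singleton_toGen (x : Braid t n) : IsClopen {toGen x} := by
  have h : ({toGen x} : Set (GenBraid t n)) =
      {ξ | pathPrefix ξ (braidLength x) = x} ∩ {ξ | ξ.1 (braidLength x) ∈ ({simpleOne t n} : Set (SimpleBraid t n))} := by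
    ext ξ
    simp only [Set.mem_singleton_iff, Set.mem_inter_iff, Set.mem_ofPred_eq]
    constructor
    · rintro rfl
      have h1 := hG.prefix_eq_self (x := x) le_rfl
      refine ⟨by rw [hG.pathPrefix_toGen, h1], Subtype.ext ?_⟩
      have h2 := pathPrefix_succ (toGen x) (braidLength x)
      rw [hG.pathPrefix_toGen, hG.pathPrefix_toGen, h1, hG.prefix_eq_self (Nat.le_succ _)] at h2
      exact hG.mul_left_cancel x _ _ (h2.symm.trans (mul_one x).symm)
    · rintro ⟨h1, h2⟩
      rw [hG.eq_toGen_of_eq_one h2, h1]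
  rw [h]
  exact (isClopen_pathPrefix _ (· = x)).inter
    ⟨⟨isLocallyConstant_coord _ {simpleOne t n}ᶜ⟩, isLocallyConstant_coord _ {simpleOne t n}⟩

theorem isTopologicalBasis_pathPrefix :
    TopologicalSpace.IsTopologicalBasis {s : Set (GenBraid t n) | ∃ k x, s = {ξ | pathPrefix ξ k = x}} := by
  refine TopologicalSpace.isTopologicalBasis_of_isOpen_of_nhds ?_ ?_
  · rintro _ ⟨k, x, rfl⟩
    exact (isClopen_pathPrefix k (· = x)).2
  · rintro ξ U hξ hU
    obtain ⟨V, hV, rfl⟩ := isOpen_induced_iff.1 hU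
    obtain ⟨I, u, hu, hI⟩ := isOpen_pi_iff.1 hV ξ.1 hξ
    refine ⟨_, ⟨I.sup id + 1, pathPrefix ξ (I.sup id + 1), rfl⟩, rfl, fun η hη => hI ?_⟩
    intro i hi
    have h : η.1 i = ξ.1 i :=
      hG.eq_of_pathPrefix_eq hη (Nat.lt_succ_of_le (Finset.le_sup (f := id) hi))
    exact Set.mem_of_eq_of_mem h (hu i hi).2

/-- Cylinders of prescribed prefix are nested or disjoint, hence form a generating π-system. -/
theorem measure_ext {μ ν : Measure (GenBraid t n)} [IsProbabilityMeasure μ]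
    [IsProbabilityMeasure ν]
    (h : ∀ k x, μ {ξ | pathPrefix ξ k = x} = ν {ξ | pathPrefix ξ k = x}) : μ = ν := by
  refine ext_of_generate_finite {s | ∃ k x, s = {ξ : GenBraid t n | pathPrefix ξ k = x}}
    hG.isTopologicalBasis_pathPrefix.borel_eq_generateFrom ?_ ?_ (by simp)
  · have key : ∀ k l x y, k ≤ l →
        ({ξ : GenBraid t n | pathPrefix ξ k = x} ∩ {ξ | pathPrefix ξ l = y}).Nonempty →
        {ξ : GenBraid t n | pathPrefix ξ k = x} ∩ {ξ | pathPrefix ξ l = y} =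
          {ξ | pathPrefix ξ l = y} := by
      rintro k l x y hkl ⟨η, rfl, rfl⟩
      refine Set.inter_eq_right.2 fun ξ hξ => ?_
      change pathPrefix ξ k = pathPrefix η k
      rw [← hG.prefix_pathPrefix ξ hkl, ← hG.prefix_pathPrefix η hkl, hξ]
    rintro _ ⟨k, x, rfl⟩ _ ⟨l, y, rfl⟩ hne
    rcases le_total k l with hkl | hlk
    · exact ⟨l, y, key k l x y hkl hne⟩
    · rw [Set.inter_comm] at hne ⊢
      exact ⟨k, x, key l k y x hlk hne⟩
  · rintro _ ⟨k, x, rfl⟩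
    exact h k x

/-- The measures of the full visual cylinders determine a probability measure. -/
theorem measure_ext_of_fullVisualCylinder {μ ν : Measure (GenBraid t n)} [IsProbabilityMeasure μ]
    [IsProbabilityMeasure ν] (h : ∀ x, μ (fullVisualCylinder x) = ν (fullVisualCylinder x)) :
    μ = ν := by
  classical
  refine hG.measure_ext fun k => ?_
  have hfin := finite_range_pathPrefix (t := t) (n := n) k
  obtain ⟨N, hN⟩ := (hfin.image braidLength).bddAbove
  intro x
  -- Descending induction on length: at depth `k` only finitely many prefixes occur, so their
  -- lengths are bounded.
  induction hj : N - braidLength x using Nat.strong_induction_on generalizing x with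
  | _ j ih =>
    by_cases hx : x ∈ Set.range fun ξ : GenBraid t n => pathPrefix ξ k
    swap
    · have : {ξ : GenBraid t n | pathPrefix ξ k = x} = ∅ :=
        Set.eq_empty_of_forall_notMem fun ξ hξ => hx ⟨ξ, hξ⟩
      rw [this, measure_empty, measure_empty]
    obtain ⟨η, hη⟩ := hx
    have hpx : braidPrefix k x = x := by
      rw [← hη]
      exact hG.prefix_pathPrefix η le_rfl
    set T := hfin.toFinset.filter fun y => x ∣ y ∧ y ≠ x
    -- The full cylinder splits into the prefix cylinder of `x` and those of its strict multiples,
    -- which are longer and already treated.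
    have hdec : fullVisualCylinder x = {ξ | pathPrefix ξ k = x} ∪
        ⋃ y ∈ T, {ξ | pathPrefix ξ k = y} := by
      rw [hG.fullVisualCylinder_eq hpx]
      ext ξ
      simp only [T, Set.mem_ofPred_eq, Set.mem_union, Set.mem_iUnion, Finset.mem_filter,
        Set.Finite.mem_toFinset, Set.mem_range, exists_prop, exists_eq_right']
      constructor
      · intro hd
        by_cases he : pathPrefix ξ k = x
        · exact Or.inl he
        · exact Or.inr ⟨⟨ξ, rfl⟩, hd, he⟩
      · rintro (h | h)
        · rw [h]
        · exact h.2.1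
    have hmeas : ∀ μ : Measure (GenBraid t n), μ (fullVisualCylinder x) =
        μ {ξ | pathPrefix ξ k = x} + ∑ y ∈ T, μ {ξ | pathPrefix ξ k = y} := by
      intro μ
      rw [hdec, measure_union, measure_biUnion_finset]
      · intro y _ z _ hyz
        exact Set.disjoint_left.2 fun ξ h1 h2 => hyz (h1.symm.trans h2)
      · exact fun y _ => (isClopen_pathPrefix k (· = y)).2.measurableSet
      · refine Set.disjoint_left.2 fun ξ h1 h2 => ?_
        simp only [Set.mem_iUnion, exists_prop] at h2
        obtain ⟨y, hy, hξ⟩ := h2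
        exact (Finset.mem_filter.1 hy).2.2 (hξ.symm.trans h1)
      · exact Finset.measurableSet_biUnion _
          fun y _ => (isClopen_pathPrefix k (· = y)).2.measurableSet
    have hsum : ∑ y ∈ T, μ {ξ | pathPrefix ξ k = y} = ∑ y ∈ T, ν {ξ | pathPrefix ξ k = y} := by
      refine Finset.sum_congr rfl fun y hy => ?_
      obtain ⟨hyr, hxy, hne⟩ := Finset.mem_filter.1 hy
      refine ih _ ?_ y rfl
      have h1 : braidLength y ≤ N := hN ⟨y, hfin.mem_toFinset.1 hyr, rfl⟩
      have h2 : braidLength x < braidLength y := by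
        by_contra hle
        exact hne (braid_eq_of_dvd hxy (not_lt.1 hle)).symm
      omega
    have h1 := h x
    rw [hmeas, hmeas, hsum] at h1
    exact (ENNReal.add_left_inj
      (ENNReal.sum_ne_top.2 fun y _ => measure_ne_top ν _)).1 h1

end GarsideFacts

theorem braidBoundary_compl (t : BraidType) (n : ℕ) :
    (braidBoundary t n)ᶜ = Set.range (toGen : Braid t n → GenBraid t n) := compl_compl _

theorem measurableSet_braidBoundary (t : BraidType) (n : ℕ) :
    MeasurableSet (braidBoundary t n) := (Set.countable_range _).measurableSet.compl

theorem measure_visualCylinder {μ : Measure (GenBraid t n)} (h : μ (braidBoundary t n)ᶜ = 0)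
    (x : Braid t n) : μ (visualCylinder x) = μ (fullVisualCylinder x) :=
  measure_inter_conull h

namespace GarsideFacts

variable (hG : GarsideFacts t n)
include hG

theorem isUniformAtInfinity_unique {μ ν : ProbabilityMeasure (GenBraid t n)}
    (hμ : IsUniformAtInfinity μ) (hν : IsUniformAtInfinity ν) : μ = ν := by
  have hnull : ∀ μ : ProbabilityMeasure (GenBraid t n), IsUniformAtInfinity μ →
      (μ : Measure (GenBraid t n)) (braidBoundary t n)ᶜ = 0 := by
    intro μ hμ
    have := μ.2
    refine (prob_compl_eq_zero_iff (μ := μ.1) (measurableSet_braidBoundary t n)).2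
      (le_antisymm prob_le_one ?_)
    -- The condition at `x = 1` says that the boundary has full measure.
    have h1 := hμ 1
    rw [braidLength_one, pow_zero, ENNReal.ofReal_one] at h1
    rw [← h1]
    exact measure_mono Set.inter_subset_right
  have := μ.2
  have := ν.2
  refine Subtype.ext (hG.measure_ext_of_fullVisualCylinder (μ := μ.1) (ν := ν.1) fun x => ?_)
  exact ((measure_visualCylinder (hnull μ hμ) x).symm.trans ((hμ x).trans (hν x).symm)).trans
    (measure_visualCylinder (hnull ν hν) x)

end GarsideFacts

/-! ### Convergence of the uniform distributions -/

open Classical in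
theorem uniformSphere_apply (hn : 2 ≤ n) (k : ℕ) {A : Set (GenBraid t n)} (hA : MeasurableSet A) :
    (uniformSphere t hn k : Measure (GenBraid t n)) A =
      (((sphereFinset t n k).filter fun x => toGen x ∈ A).card : ENNReal) / braidCount t n k := by
  change PMF.toMeasure _ A = _
  rw [PMF.toMeasure_apply_eq_toOuterMeasure_apply _ hA, PMF.toOuterMeasure_map_apply,
    PMF.toOuterMeasure_uniformOfFinset_apply, ← card_sphereFinset]
  rfl

namespace GarsideFacts

variable (hG : GarsideFacts t n)
include hG

theorem uniformSphere_fullVisualCylinder (hn : 2 ≤ n) {k : ℕ} (x : Braid t n)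
    (hk : braidLength x ≤ k) :
    (uniformSphere t hn k : Measure (GenBraid t n)) (fullVisualCylinder x) =
      ENNReal.ofReal (braidCount t n (k - braidLength x) / braidCount t n k) := by
  classical
  rw [uniformSphere_apply hn k (hG.isClopen_fullVisualCylinder x).2.measurableSet]
  simp_rw [hG.toGen_mem_fullVisualCylinder]
  rw [hG.card_filter_dvd, if_pos hk, ENNReal.ofReal_div_of_pos
    (Nat.cast_pos.2 (braidCount_pos t hn k)), ENNReal.ofReal_natCast, ENNReal.ofReal_natCast]

theorem uniformSphere_singleton (hn : 2 ≤ n) {k : ℕ} (x : Braid t n) (hk : braidLength x ≠ k) :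
    (uniformSphere t hn k : Measure (GenBraid t n)) {toGen x} = 0 := by
  classical
  rw [uniformSphere_apply hn k (hG.isClopen_singleton_toGen x).2.measurableSet]
  rw [Finset.filter_eq_empty_iff.2 fun y hy hxy => hk (by
    rw [← hG.toGen_injective hxy, mem_sphereFinset.1 hy]), Finset.card_empty, Nat.cast_zero, ENNReal.zero_div]

theorem tendsto_uniformSphere_fullVisualCylinder (hn : 2 ≤ n) {L : ℝ} (hL : 0 < L)
    (hlim : Tendsto (fun k => (braidCount t n k : ℝ) * braidRadius t n ^ k) atTop (𝓝 L))
    (x : Braid t n) :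
    Tendsto (fun k => (uniformSphere t hn k : Measure (GenBraid t n)) (fullVisualCylinder x)) atTop
      (𝓝 (ENNReal.ofReal (braidRadius t n ^ braidLength x))) := by
  obtain ⟨m, hm⟩ : ∃ m, braidLength x = m := ⟨_, rfl⟩
  rw [hm]
  have hq := braidRadius_pos t hn
  have h1 : Tendsto (fun k => (braidCount t n (k - m) : ℝ) * braidRadius t n ^ (k - m) /
      ((braidCount t n k : ℝ) * braidRadius t n ^ k) * braidRadius t n ^ m) atTop
      (𝓝 (braidRadius t n ^ m)) := by
    have := ((hlim.comp (tendsto_sub_atTop_nat m)).div hlim hL.ne').mul_const (braidRadius t n ^ m)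
    rwa [div_self hL.ne', one_mul] at this
  refine (ENNReal.tendsto_ofReal h1).congr' ?_
  filter_upwards [eventually_ge_atTop m] with k hk
  rw [hG.uniformSphere_fullVisualCylinder hn x (hm.trans_le hk), hm]
  congr 1
  have h2 : (braidCount t n k : ℝ) ≠ 0 := Nat.cast_ne_zero.2 (braidCount_pos t hn k).ne'
  have h3 : braidRadius t n ^ k = braidRadius t n ^ (k - m) * braidRadius t n ^ m := by
    rw [← pow_add, Nat.sub_add_cancel hk]
  rw [h3]
  field_simp

/-- Compactness provides a limit along the ultrafilter. Clopen sets have empty frontier, so their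
masses pass to the limit: full cylinders get `q ^ |x|`, and each finite braid gets `0` because it is
charged at one length only. -/
theorem exists_isUniformAtInfinity (hn : 2 ≤ n) {L : ℝ} (hL : 0 < L)
    (hlim : Tendsto (fun k => (braidCount t n k : ℝ) * braidRadius t n ^ k) atTop (𝓝 L))
    (g : Ultrafilter ℕ) (hg : (g : Filter ℕ) ≤ atTop) :
    ∃ ν : ProbabilityMeasure (GenBraid t n), IsUniformAtInfinity ν ∧
      Tendsto (uniformSphere t hn) g (𝓝 ν) := by
  obtain ⟨ν, -, hν⟩ := isCompact_univ.ultrafilter_le_nhds (g.map (uniformSphere t hn))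
    (by simp)
  have hν : Tendsto (uniformSphere t hn) g (𝓝 ν) := hν
  have hclopen : ∀ A : Set (GenBraid t n), IsClopen A →
      Tendsto (fun k => (uniformSphere t hn k : Measure (GenBraid t n)) A) g
        (𝓝 ((ν : Measure (GenBraid t n)) A)) := fun A hA =>
    ProbabilityMeasure.tendsto_measure_of_null_frontier_of_tendsto' hν (by simp [hA.frontier_eq])
  refine ⟨ν, fun x => ?_, hν⟩
  rw [measure_visualCylinder]
  · exact tendsto_nhds_unique (hclopen _ (hG.isClopen_fullVisualCylinder x))
      ((hG.tendsto_uniformSphere_fullVisualCylinder hn hL hlim x).mono_left hg)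
  · rw [braidBoundary_compl, ← Set.iUnion_singleton_eq_range, measure_iUnion_null_iff]
    intro y
    refine tendsto_nhds_unique (hclopen _ (hG.isClopen_singleton_toGen y))
      (tendsto_const_nhds.congr' ?_)
    refine Filter.EventuallyEq.filter_mono ?_ hg
    filter_upwards [eventually_gt_atTop (braidLength y)] with k hk
    exact (hG.uniformSphere_singleton hn y hk.ne).symm

theorem exists_unique_limit (hn : 2 ≤ n) {L : ℝ} (hL : 0 < L)
    (hlim : Tendsto (fun k => (braidCount t n k : ℝ) * braidRadius t n ^ k) atTop (𝓝 L)) :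
    ∃ ν : ProbabilityMeasure (GenBraid t n), IsUniformAtInfinity ν ∧
      (∀ ν' : ProbabilityMeasure (GenBraid t n), IsUniformAtInfinity ν' → ν' = ν) ∧
      Tendsto (uniformSphere t hn) atTop (𝓝 ν) := by
  obtain ⟨ν, hν, -⟩ := hG.exists_isUniformAtInfinity hn hL hlim (Ultrafilter.of atTop)
    (Ultrafilter.of_le _)
  refine ⟨ν, hν, fun ν' hν' => hG.isUniformAtInfinity_unique hν' hν, ?_⟩
  rw [tendsto_iff_ultrafilter]
  intro g hg
  obtain ⟨ν', hν', h⟩ := hG.exists_isUniformAtInfinity hn hL hlim g hg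
  rwa [hG.isUniformAtInfinity_unique hν' hν] at h

end GarsideFacts

end Space

/-! ### Both braid types together, and the conclusion -/

theorem garsideFacts (t : BraidType) (n : ℕ) : GarsideFacts t n := by
  cases t with
  | artin => exact (artinModel n).garsideFacts
  | dual => exact (dualModel n).garsideFacts

theorem connected_properSimple (t : BraidType) {n : ℕ} (hn : 3 ≤ n) (x y : ProperSimple t n) :
    Relation.ReflTransGen (fun a b : ProperSimple t n => Arrow a.1 b.1) x y := by
  cases t with
  | artin => exact connected_artin hn x y
  | dual => exact connected_dual hn x y

theorem exists_braidOf_ne (t : BraidType) {n : ℕ} (hn : 3 ≤ n) :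
    ∃ a b : BraidGen t n, braidOf a ≠ braidOf b := by
  cases t with
  | artin =>
    refine ⟨(⟨0, by omega⟩ : Fin (n - 1)), (⟨1, by omega⟩ : Fin (n - 1)), fun h => ?_⟩
    have h1 : artinSwap (⟨0, by omega⟩ : Fin (n - 1)) = artinSwap ⟨1, by omega⟩ :=
      congrArg (artinProj n) h
    have h2 := congrArg (fun g => ((g (⟨0, by omega⟩ : Fin n) : Fin n) : ℕ)) h1
    simp [artinSwap_val] at h2
  | dual =>
    have h01 : (⟨0, by omega⟩ : Fin n) < ⟨1, by omega⟩ := Nat.zero_lt_one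
    have h12 : (⟨1, by omega⟩ : Fin n) < ⟨2, by omega⟩ := Nat.one_lt_two
    refine ⟨dualGen _ _ h01, dualGen _ _ h12, fun h => ?_⟩
    have h1 : Equiv.swap (⟨0, by omega⟩ : Fin n) ⟨1, by omega⟩ =
      Equiv.swap ⟨1, by omega⟩ ⟨2, by omega⟩ := congrArg (dualProj n) h
    have h2 := congrArg (fun g => g (⟨0, by omega⟩ : Fin n)) h1
    simp [Equiv.swap_apply_def] at h2

theorem subsingleton_braidGen_two (t : BraidType) : Subsingleton (BraidGen t 2) := by
  cases t with
  | artin => exact inferInstanceAs (Subsingleton (Fin 1))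
  | dual =>
    refine ⟨fun a b => ?_⟩
    obtain ⟨i, j, hij, rfl⟩ := exists_dualGen a
    obtain ⟨k, l, hkl, rfl⟩ := exists_dualGen b
    obtain rfl : i = k := by omega
    obtain rfl : j = l := by omega
    rfl

theorem exists_moebius_bound (t : BraidType) {n : ℕ} (hn : 2 ≤ n) :
    ∃ C, ∀ z : ℂ, ‖z‖ < braidRadius t n →
      ‖1 - z‖ - (1 - braidRadius t n) ≤ C * ‖aeval z (moebiusPoly t n)‖ := by
  rcases hn.eq_or_lt with rfl | hn'
  · have := subsingleton_braidGen_two t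
    exact (garsideFacts t 2).exists_moebius_bound_of_subsingleton hn
  · exact (garsideFacts t n).exists_moebius_bound_of_connected hn (connected_properSimple t hn')
      (exists_braidOf_ne t hn')

theorem theorem5p1 (t : BraidType) (n : ℕ) (hn : 2 ≤ n) :
    (0 < braidRadius t n ∧ (moebiusPoly t n).IsRoot (braidRadius t n) ∧
      ∀ z : ℂ, aeval z (moebiusPoly t n) = 0 → braidRadius t n ≤ ‖z‖) ∧
    ∃ ν : ProbabilityMeasure (GenBraid t n),
      IsUniformAtInfinity ν ∧
      (∀ ν' : ProbabilityMeasure (GenBraid t n), IsUniformAtInfinity ν' → ν' = ν) ∧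
      Tendsto (uniformSphere t hn) atTop (𝓝 ν) := by
  have hG := garsideFacts t n
  obtain ⟨C, hC⟩ := exists_moebius_bound t hn
  obtain ⟨L, hL, hlim⟩ := exists_tendsto_coeff (braidRadius_pos t hn) (fun _ => Nat.cast_nonneg _)
    hG.growthSeries_mul (summable_braidCount t hn) (not_summable_braidCount t hn) C hC
  exact ⟨⟨braidRadius_pos t hn, hG.isRoot_braidRadius hn,
    radius_le_norm_root hG.growthSeries_mul (summable_braidCount t hn)⟩,
    hG.exists_unique_limit hn hL hlim⟩
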